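/- Let $A\in\mathbb{R}^{m\times n}_{\ge 0}$ have no zero column, let $\min_j\|A_{j:}\|_\infty=1$, and let $\mathrm{OPT}=\min\{\vec 1^Tx : x\ge 0,\ Ax\ge \vec 1\}$. Let $0<\epsilon<1$, and $\epsilon\le 1/2$ in case $m=n=1$. *Diameter reduction.* For each column $i$ let $a_i=\min_j\{A_{ji}:A_{ji}>0\}$, let $r_i=\max_j A_{ji}/a_i$ and $n_i=\max\{1,\lceil\log_2 r_i\rceil\}$. The reduced matrix $\bar A\in\mathbb{R}^{m\times\bar n}$, $\bar n=\sum_i n_i$, has the columns $(i,l)$, $1\le l\le n_i$, with $\bar A_{j,(i,l)}=\min\{A_{ji},2^l a_i\}$. For a column index $k$ of $\bar A$ write $\|\bar A_{:k}\|_\infty$ for the largest entry of that column. *Smoothed objective.* Let $\mu=\frac{\epsilon}{4\log(\bar nm/\epsilon)}$ and $$f_\mu(x)=\vec 1^Tx+\max_{y\ge 0}\Big\{y^T(\vec 1-\bar Ax)+\mu\sum_j(-y_j\log y_j+y_j)\Big\}.$$ *Algorithm.* Let $L=4/\mu$, $\tau=\frac1{8\bar nL}$, $T=\lceil 8\bar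 nL\log(1/\epsilon)\rceil$, $\alpha_0=\frac1{\bar nL}$, $\Delta=\{x\in\mathbb{R}^{\bar n}: 0\le x_k\le 3/\|\bar A_{:k}\|_\infty\}$ and $V_x(y)=\frac12\sum_k\|\bar A_{:k}\|_\infty(x_k-y_k)^2$. Given $x^{\mathrm{start}}\in\Delta$, put $y_0=z_0=x^{\mathrm{start}}$. For $k=1,\dots,T$ let $\alpha_k=\alpha_{k-1}/(1-\tau)$ and $x_k=\tau z_{k-1}+(1-\tau)y_{k-1}$, select a coordinate $i$ uniformly and independently at random, let $\xi_k=\max\{-1,\min\{1,\nabla_if_\mu(x_k)\}\}\,e_i$, and put $$z_k=\operatorname{argmin}_{z\in\Delta}\{V_{z_{k-1}}(z)+\langle z,\bar n\alpha_k\xi_k\rangle\},\qquad y_k=x_k+\tfrac{1}{\bar n\alpha_kL}(z_k-z_{k-1}).$$ The output is $y_T$. *Theorem.* 1. Let $x^{\#}$ satisfy $0\le x^{\#}_k\le 2/\|\bar A_{:k}\|_\infty$ for all $k$, $\bar Ax^{\#}\ge\vec 1$ and $\vec 1^Tx^{\#}\le 2\,\mathrm{OPT}$. Then the algorithm started at $x^{\mathrm{start}}=(1+\epsilon/2)x^{\#}$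 satisfies $\mathbb{E}[f_\mu(y_T)]\le(1+6\epsilon)\,\mathrm{OPT}$. 2. Let $\bar N$ be the number of non-zero entries of $\bar A$. On a random-access machine with unit-cost exact real arithmetic (including $\exp$, $\log$ and comparisons) and uniform random draws, whose input is $\epsilon$ and $A$ in sparse column format, there are a fixed deterministic program which computes a starting point $x^{\mathrm{start}}=(1+\epsilon/2)x^{\#}$ as in 1 in time $O(\bar N\log^{p}(\bar N/\epsilon))$, and a fixed program which, run after it, carries out the algorithm from this $x^{\mathrm{start}}$ and returns $y_T$, such that the expected total time of both is $O\big(\frac{\bar N}{\epsilon}\log^{p}(\bar N/\epsilon)\big)$. Here $p$ and the implied constants are absolute. 3. If moreover all non-zero entries of $A$ lie in $[\epsilon/(mn),\,n/\epsilon]$, the same time bounds hold with $\bar N$ replaced by the number $N$ of non-zero entries of $A$. -/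

import Mathlib

open scoped BigOperators Matrix

noncomputable section

namespace CovLP

/-! ### The covering linear program -/

/-- Optimal value of `min {1ᵀx : x ≥ 0, A x ≥ 1}`. -/
def opt {m n : ℕ} (A : Matrix (Fin m) (Fin n) ℝ) : ℝ :=
  sInf {v | ∃ x : Fin n → ℝ, (∀ i, 0 ≤ x i) ∧ (∀ j, 1 ≤ (A *ᵥ x) j) ∧ v = ∑ i, x i}

/-- Number of non-zero entries. -/
def nnz {m n : ℕ} (A : Matrix (Fin m) (Fin n) ℝ) : ℕ :=
  Nat.card {p : Fin m × Fin n // A p.1 p.2 ≠ 0}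

/-- Sup-norm of column `i`. -/
def colNorm {m n : ℕ} (A : Matrix (Fin m) (Fin n) ℝ) (i : Fin n) : ℝ := ‖fun j => A j i‖

/-- Sup-norm of row `j`. -/
def rowNorm {m n : ℕ} (A : Matrix (Fin m) (Fin n) ℝ) (j : Fin m) : ℝ := ‖fun i => A j i‖

/-! ### Diameter reduction -/

/-- Smallest positive entry of column `i`. -/
def minPos {m n : ℕ} (A : Matrix (Fin m) (Fin n) ℝ) (i : Fin n) : ℝ :=
  sInf {a | ∃ j, 0 < A j i ∧ a = A j i}

/-- Largest positive entry of column `i`. -/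
def maxPos {m n : ℕ} (A : Matrix (Fin m) (Fin n) ℝ) (i : Fin n) : ℝ :=
  sSup {a | ∃ j, 0 < A j i ∧ a = A j i}

/-- Number of copies made of variable `i`: `⌈log₂ rᵢ⌉` where `rᵢ` is the ratio of the largest to
the smallest positive entry of the column, but at least one copy (also when `rᵢ = 1`). -/
def copies {m n : ℕ} (A : Matrix (Fin m) (Fin n) ℝ) (i : Fin n) : ℕ :=
  max 1 ⌈Real.logb 2 (maxPos A i / minPos A i)⌉₊

/-- Number of variables of the reduced program. -/
def redDim {m n : ℕ} (A : Matrix (Fin m) (Fin n) ℝ) : ℕ := ∑ i, copies A i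

/-- The reduced matrix; its columns are the pairs `(i, l)`, `1 ≤ l ≤ copies A i`, listed
lexicographically, and `l` is the second component below plus one. -/
def reduced {m n : ℕ} (A : Matrix (Fin m) (Fin n) ℝ) : Matrix (Fin m) (Fin (redDim A)) ℝ :=
  fun j k =>
    let p : (i : Fin n) × Fin (copies A i) := finSigmaFinEquiv.symm k
    min (A j p.1) (2 ^ ((p.2 : ℕ) + 1) * minPos A p.1)

/-- Solutions of the reduced program that are within a factor two of optimal and obey the upper
bounds `2 / ‖column‖∞` on the variables. -/
structure IsTwoApprox {m n : ℕ} (A : Matrix (Fin m) (Fin n) ℝ)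
    (x : Fin (redDim A) → ℝ) : Prop where
  nonneg : ∀ i, 0 ≤ x i
  le_bound : ∀ i, x i ≤ 2 / colNorm (reduced A) i
  feasible : ∀ j, 1 ≤ (reduced A *ᵥ x) j
  cost_le : ∑ i, x i ≤ 2 * opt A

/-! ### The smoothed objective -/

/-- Generalized entropy. -/
def entropy {m : ℕ} (y : Fin m → ℝ) : ℝ := ∑ j, (-(y j * Real.log (y j)) + y j)

/-- `f_μ(x) = 1ᵀx + max_{y ≥ 0} (yᵀ(1 - A x) + μ H(y))`. -/
def smoothed {m n : ℕ} (A : Matrix (Fin m) (Fin n) ℝ) (μ : ℝ) (x : Fin n → ℝ) : ℝ :=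
  ∑ i, x i + sSup {v | ∃ y : Fin m → ℝ, (∀ j, 0 ≤ y j) ∧
    v = y ⬝ᵥ (fun j => 1 - (A *ᵥ x) j) + μ * entropy y}

/-! ### The accelerated stochastic coordinate descent algorithm -/

def mu (m n : ℕ) (ε : ℝ) : ℝ := ε / (4 * Real.log ((n : ℝ) * m / ε))

def lip (m n : ℕ) (ε : ℝ) : ℝ := 4 / mu m n ε

def tau (m n : ℕ) (ε : ℝ) : ℝ := 1 / (8 * n * lip m n ε)

/-- Number `T` of iterations. -/
def iters (m n : ℕ) (ε : ℝ) : ℕ := ⌈8 * n * lip m n ε * Real.log (1 / ε)⌉₊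

/-- Step sizes `α_k`. -/
def alpha (m n : ℕ) (ε : ℝ) : ℕ → ℝ
  | 0 => 1 / (n * lip m n ε)
  | k + 1 => 1 / (1 - tau m n ε) * alpha m n ε k

/-- The box `Δ`. -/
def box {m n : ℕ} (A : Matrix (Fin m) (Fin n) ℝ) : Set (Fin n → ℝ) :=
  {x | ∀ i, 0 ≤ x i ∧ x i ≤ 3 / colNorm A i}

/-- The `A`-norm. -/
def normA {m n : ℕ} (A : Matrix (Fin m) (Fin n) ℝ) (x : Fin n → ℝ) : ℝ :=
  Real.sqrt (∑ i, colNorm A i * x i ^ 2)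

/-- The Bregman divergence `V_x(y)` of half the squared `A`-norm. -/
def bregman {m n : ℕ} (A : Matrix (Fin m) (Fin n) ℝ) (x y : Fin n → ℝ) : ℝ :=
  1 / 2 * normA A (x - y) ^ 2

/-- A minimizer of `g` on `S`, when there is one. -/
def argmin {n : ℕ} (S : Set (Fin n → ℝ)) (g : (Fin n → ℝ) → ℝ) : Fin n → ℝ :=
  Classical.epsilon fun z => z ∈ S ∧ ∀ w ∈ S, g z ≤ g w

/-- Partial derivative in coordinate `i`. -/
def partialDeriv {n : ℕ} (f : (Fin n → ℝ) → ℝ) (i : Fin n) (x : Fin n → ℝ) : ℝ :=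
  lineDeriv ℝ f x (Pi.single i 1)

/-- Truncation to `[-1, 1]`. -/
def trunc (g : ℝ) : ℝ := if g < -1 then -1 else if g > 1 then 1 else g

/-- The `k`-th iteration with selected coordinate `i`: from `(y_{k-1}, z_{k-1})` to `(y_k, z_k)`. -/
def iterate {m n : ℕ} (A : Matrix (Fin m) (Fin n) ℝ) (ε : ℝ) (k : ℕ) (i : Fin n)
    (yz : (Fin n → ℝ) × (Fin n → ℝ)) : (Fin n → ℝ) × (Fin n → ℝ) :=
  let x : Fin n → ℝ := tau m n ε • yz.2 + (1 - tau m n ε) • yz.1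
  let ξ : Fin n → ℝ := Pi.single i (trunc (partialDeriv (smoothed A (mu m n ε)) i x))
  let z : Fin n → ℝ :=
    argmin (box A) fun w => bregman A yz.2 w + w ⬝ᵥ ((n * alpha m n ε k) • ξ)
  (x + (1 / (n * alpha m n ε k * lip m n ε)) • (z - yz.2), z)

/-- `(y_K, z_K)` when started at `x₀`, with the coordinates `ω 0, …, ω (K - 1)` selected in
iterations `1, …, K`. -/
def run {m n : ℕ} (A : Matrix (Fin m) (Fin n) ℝ) (ε : ℝ) (x₀ : Fin n → ℝ) :
    (K : ℕ) → (Fin K → Fin n) → (Fin n → ℝ) × (Fin n → ℝ)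
  | 0, _ => (x₀, x₀)
  | K + 1, ω => iterate A ε (K + 1) (ω (Fin.last K)) (run A ε x₀ K fun k => ω k.castSucc)

/-- The possible sequences of selected coordinates; the algorithm draws one uniformly at random. -/
abbrev Choices (m n : ℕ) (ε : ℝ) : Type := Fin (iters m n ε) → Fin n

/-- The output `y_T` of the algorithm. -/
def output {m n : ℕ} (A : Matrix (Fin m) (Fin n) ℝ) (ε : ℝ) (x₀ : Fin n → ℝ)
    (ω : Choices m n ε) : Fin n → ℝ :=
  (run A ε x₀ (iters m n ε) ω).1

/-! ### A random-access machine with exact real arithmetic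

Memory consists of numbered arrays of natural numbers and numbered arrays of reals. A program is a
finite text which uses finitely many of these arrays. Every arithmetic operation, memory access,
comparison, exponential, logarithm and random draw costs one step. -/

structure Mem where
  nat : ℕ → ℕ → ℕ
  real : ℕ → ℕ → ℝ

/-- Set cell `i` of integer array `a`. -/
def Mem.setNat (s : Mem) (a i v : ℕ) : Mem :=
  { s with nat := Function.update s.nat a (Function.update (s.nat a) i v) }

/-- Set cell `i` of real array `a`. -/
def Mem.setReal (s : Mem) (a i : ℕ) (v : ℝ) : Mem :=
  { s with real := Function.update s.real a (Function.update (s.real a) i v) }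

/-- Integer expressions; `get a e` is cell `e` of integer array `a`. -/
inductive NExp
  | const (c : ℕ)
  | get (a : ℕ) (e : NExp)
  | plus (e e' : NExp)
  | sub (e e' : NExp)

def NExp.eval (s : Mem) : NExp → ℕ
  | .const c => c
  | .get a e => s.nat a (e.eval s)
  | .plus e e' => e.eval s + e'.eval s
  | .sub e e' => e.eval s - e'.eval s

def NExp.cost : NExp → ℕ
  | .const _ => 1
  | .get _ e => e.cost + 1
  | .plus e e' => e.cost + e'.cost + 1
  | .sub e e' => e.cost + e'.cost + 1

/-- Real expressions; `get a e` is cell `e` of real array `a`. -/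
inductive RExp
  | ofNat (e : NExp)
  | get (a : ℕ) (e : NExp)
  | plus (r r' : RExp)
  | sub (r r' : RExp)
  | mul (r r' : RExp)
  | div (r r' : RExp)
  | exp (r : RExp)
  | log (r : RExp)

def RExp.eval (s : Mem) : RExp → ℝ
  | .ofNat e => (e.eval s : ℝ)
  | .get a e => s.real a (e.eval s)
  | .plus r r' => r.eval s + r'.eval s
  | .sub r r' => r.eval s - r'.eval s
  | .mul r r' => r.eval s * r'.eval s
  | .div r r' => r.eval s / r'.eval s
  | .exp r => Real.exp (r.eval s)
  | .log r => Real.log (r.eval s)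

def RExp.cost : RExp → ℕ
  | .ofNat e => e.cost + 1
  | .get _ e => e.cost + 1
  | .plus r r' => r.cost + r'.cost + 1
  | .sub r r' => r.cost + r'.cost + 1
  | .mul r r' => r.cost + r'.cost + 1
  | .div r r' => r.cost + r'.cost + 1
  | .exp r => r.cost + 1
  | .log r => r.cost + 1

/-- Tests. -/
inductive BExp
  | natLt (e e' : NExp)
  | realLt (r r' : RExp)
  | not (b : BExp)
  | and (b b' : BExp)

def BExp.holds (s : Mem) : BExp → Prop
  | .natLt e e' => e.eval s < e'.eval s
  | .realLt r r' => r.eval s < r'.eval s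
  | .not b => ¬ b.holds s
  | .and b b' => b.holds s ∧ b'.holds s

def BExp.cost : BExp → ℕ
  | .natLt e e' => e.cost + e'.cost + 1
  | .realLt r r' => r.cost + r'.cost + 1
  | .not b => b.cost + 1
  | .and b b' => b.cost + b'.cost + 1

/-- Programs. -/
inductive Cmd
  | skip
  | setNat (a : ℕ) (i : NExp) (e : NExp)
  | setReal (a : ℕ) (i : NExp) (r : RExp)
  /-- store in cell `i` of integer array `a` a uniformly random element of `{0, …, b - 1}` -/
  | rand (a : ℕ) (i : NExp) (b : NExp)
  | seq (c c' : Cmd)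
  | ite (b : BExp) (c c' : Cmd)
  | while (b : BExp) (c : Cmd)

/-- `Exec c s ds s' t`: the program `c`, started with memory `s`, halts with memory `s'` after `t`
steps, where `ds` lists its random draws in order: an element `(b, d)` of `ds` says that a uniformly
random element of `{0, …, b - 1}` was requested and that the draw gave `d`. -/
inductive Exec : Cmd → Mem → List (ℕ × ℕ) → Mem → ℕ → Prop
  | skip (s) : Exec .skip s [] s 1
  | setNat (a i e s) :
      Exec (.setNat a i e) s [] (s.setNat a (i.eval s) (e.eval s)) (i.cost + e.cost + 1)
  | setReal (a i r s) :
      Exec (.setReal a i r) s [] (s.setReal a (i.eval s) (r.eval s)) (i.cost + r.cost + 1)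
  | rand (a i b s) (d : ℕ) (hd : d < b.eval s) :
      Exec (.rand a i b) s [(b.eval s, d)] (s.setNat a (i.eval s) d) (i.cost + b.cost + 1)
  | seq {c c' s s₁ s₂ ds ds' t t'} (h : Exec c s ds s₁ t) (h' : Exec c' s₁ ds' s₂ t') :
      Exec (.seq c c') s (ds ++ ds') s₂ (t + t')
  | ite_true {b c c' s s₁ ds t} (hb : b.holds s) (h : Exec c s ds s₁ t) :
      Exec (.ite b c c') s ds s₁ (b.cost + t)
  | ite_false {b c c' s s₁ ds t} (hb : ¬ b.holds s) (h : Exec c' s ds s₁ t) :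
      Exec (.ite b c c') s ds s₁ (b.cost + t)
  | while_true {b c s s₁ s₂ ds ds' t t'} (hb : b.holds s) (h : Exec c s ds s₁ t)
      (h' : Exec (.while b c) s₁ ds' s₂ t') :
      Exec (.while b c) s (ds ++ ds') s₂ (b.cost + t + t')
  | while_false {b c s} (hb : ¬ b.holds s) : Exec (.while b c) s [] s b.cost

/-- The memory `s` holds the input `(A, ε)`, with `A` in sparse format: integer array `0` starts
with `n, m`; the non-zero entries of column `i` are listed, each exactly once, at the positions from
`s.nat 1 i` up to but excluding `s.nat 1 (i + 1)`, with their row indices in integer array `2` and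
their values in real array `1`; real array `0` starts with `ε`; the remaining arrays are blank. -/
structure IsInput {m n : ℕ} (A : Matrix (Fin m) (Fin n) ℝ) (ε : ℝ) (s : Mem) : Prop where
  cols : s.nat 0 0 = n
  rows : s.nat 0 1 = m
  eps : s.real 0 0 = ε
  ptr_zero : s.nat 1 0 = 0
  ptr_mono : ∀ i < n, s.nat 1 i ≤ s.nat 1 (i + 1)
  index : ∀ i : Fin n, Set.BijOn (s.nat 2) (Set.Ico (s.nat 1 i) (s.nat 1 (i + 1)))
    {j | ∃ j' : Fin m, A j' i ≠ 0 ∧ j = (j' : ℕ)}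
  value : ∀ (i : Fin n) (e : ℕ), s.nat 1 i ≤ e → e < s.nat 1 (i + 1) →
    ∀ j : Fin m, s.nat 2 e = (j : ℕ) → s.real 1 e = A j i
  blank_nat : ∀ a ≥ 3, ∀ e, s.nat a e = 0
  blank_real : ∀ a ≥ 2, ∀ e, s.real a e = 0

/-- The memory `s` holds the vector `x` as result, in real array `2`. -/
def Mem.Holds {n : ℕ} (s : Mem) (x : Fin n → ℝ) : Prop := ∀ i : Fin n, s.real 2 i = x i

/-- The list of draws of a program whose random requests are all for uniformly random elements of
`{0, …, n - 1}` and are answered by `ω`. -/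
def draws {n K : ℕ} (ω : Fin K → Fin n) : List (ℕ × ℕ) := List.ofFn fun k => (n, (ω k : ℕ))

/-- No non-zero entry is below `ε / (m n)` or above `n / ε`. -/
def ModerateEntries {m n : ℕ} (A : Matrix (Fin m) (Fin n) ℝ) (ε : ℝ) : Prop :=
  ∀ j i, A j i ≠ 0 → ε / ((m : ℝ) * n) ≤ A j i ∧ A j i ≤ n / ε

end CovLP

end

open CovLP

/-! # Nearly linear time covering: approximation guarantee and running time

**Approximation.** The inner maximum of the smoothed objective is attained at an exponential, so
`f_μ(x) = 1ᵀx + μ ∑ⱼ exp ((1 - (A x)ⱼ) / μ)` (`smoothed_eq`), a convex function of which each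
partial derivative is at most one. Along coordinate `i` its curvature is at most proportional to
`(1 - ∇ᵢ f) ‖Aᵢ‖ / μ` on steps for which `exp` can be expanded (`smoothF_coord_step`). It is
unbounded exactly where the partial derivative is very negative; there the descent is
correspondingly large. The mirror step on the box separates into clipped one-dimensional steps
(`argmin_box_eq`). `coord_progress` compares one such step with an arbitrary point of the box: the
descent pays for the regret of the step with the truncated gradient and for the part of the
gradient which the truncation removes. Hence a combination of the objective at `y` and the
divergence of `z` from the comparison point does not increase in expectation
(`Setup.potential_step`), and after `T` iterations the initial gap has shrunk by the factor `ε`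
(`Setup.expect_output_le`). The comparison points are `(1 + ε / 2) v` for feasible `v`, at which
the smoothing term is negligible; `lift` moves each variable of a feasible point of the original
program to that one of its copies which respects the upper bounds, so the reduced program has
feasible points in the box at no extra cost.

**Starting point.** A feasible point of cost at most `2 opt` is found by multiplicative updates.
Unsatisfied rows have the weight `exp (-η (A x)ⱼ)`, and in each round the variables grow of which
the weighted column sum reaches a threshold. By weak duality the total weight decays exponentially
in `cost / opt` as long as the threshold is close to the largest column sum (`coverInv_step`). A
variable which stayed above the threshold for a whole phase would alone cost more than the total
(`coverPhase`), so polylogarithmically many rounds suffice (`cover_solution`).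

**Programs.** `Halts` is a program logic for the random-access machine in which the memory after a
program is described together with a bound on its time and the list of its draws. `startCmd` runs
the solver and builds the reduced matrix, its column norms and the lifted point. `mainCmd`
represents `y = z + θ w` with `θ = (1 - τ) ^ k` and maintains `A z` and `A w`
(`Setup.iterate_dir`, `halts_iterCmd`), so that an iteration touches only the entries of the
selected column. On average over the draws a column has `nnz (reduced A) / redDim A` entries, and
there are `O(redDim A * log² / ε)` iterations (`IsCovering.expect_mainTime_le`). If the entries
are moderate, each column has logarithmically many copies (`IsCovering.copies_le`). -/

noncomputable section

namespace CovLP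

/-! ### Closed form of the smoothed objective -/

/-- The smoothed objective with the inner maximum evaluated: `1ᵀx + μ ∑ⱼ exp ((1 - (A x)ⱼ) / μ)`. -/
def smoothF {m n : ℕ} (A : Matrix (Fin m) (Fin n) ℝ) (μ : ℝ) (x : Fin n → ℝ) : ℝ :=
  ∑ i, x i + μ * ∑ j, Real.exp ((1 - (A *ᵥ x) j) / μ)

/-- The gradient of `smoothF`. -/
def smoothGrad {m n : ℕ} (A : Matrix (Fin m) (Fin n) ℝ) (μ : ℝ) (x : Fin n → ℝ) (i : Fin n) : ℝ :=
  1 - ∑ j, A j i * Real.exp ((1 - (A *ᵥ x) j) / μ)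

/-- The conjugate inequality between the entropy and the exponential. -/
theorem mul_add_entropy_le {μ : ℝ} (hμ : 0 < μ) (c : ℝ) {y : ℝ} (hy : 0 ≤ y) :
    y * c + μ * (-(y * Real.log y) + y) ≤ μ * Real.exp (c / μ) := by
  rcases hy.eq_or_lt with rfl | hy
  · simp; positivity
  have h := Real.add_one_le_exp (c / μ - Real.log y)
  rw [Real.exp_sub, Real.exp_log hy, le_div_iff₀ hy] at h
  have h2 := mul_le_mul_of_nonneg_left h hμ.le
  have h3 : μ * (c / μ) = c := by field_simp
  linear_combination h2 - y * h3

theorem smoothed_eq {m n : ℕ} (A : Matrix (Fin m) (Fin n) ℝ) {μ : ℝ} (hμ : 0 < μ) :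
    smoothed A μ = smoothF A μ := by
  funext x
  unfold smoothed smoothF
  congr 1
  apply IsGreatest.csSup_eq
  constructor
  · refine ⟨fun j => Real.exp ((1 - (A *ᵥ x) j) / μ), fun j => (Real.exp_pos _).le, ?_⟩
    unfold entropy dotProduct
    rw [Finset.mul_sum, Finset.mul_sum, ← Finset.sum_add_distrib]
    refine Finset.sum_congr rfl fun j _ => ?_
    rw [Real.log_exp]
    field_simp
    ring
  · rintro v ⟨y, hy, rfl⟩
    unfold entropy dotProduct
    rw [Finset.mul_sum, Finset.mul_sum, ← Finset.sum_add_distrib]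
    exact Finset.sum_le_sum fun j _ => mul_add_entropy_le hμ _ (hy j)

theorem smoothF_pos_part {m n : ℕ} (A : Matrix (Fin m) (Fin n) ℝ) {μ : ℝ} (hμ : 0 < μ)
    (x : Fin n → ℝ) : ∑ i, x i ≤ smoothF A μ x := by
  unfold smoothF
  have : 0 ≤ ∑ j, Real.exp ((1 - (A *ᵥ x) j) / μ) :=
    Finset.sum_nonneg fun j _ => (Real.exp_pos _).le
  nlinarith [mul_nonneg hμ.le this]

theorem mulVec_add_single {m n : ℕ} (A : Matrix (Fin m) (Fin n) ℝ) (x : Fin n → ℝ) (i : Fin n)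
    (δ : ℝ) (j : Fin m) : (A *ᵥ (x + Pi.single i δ)) j = (A *ᵥ x) j + A j i * δ := by
  rw [Matrix.mulVec_add, Pi.add_apply, Matrix.mulVec_single]
  simp [mul_comm]

theorem smoothF_add_single {m n : ℕ} (A : Matrix (Fin m) (Fin n) ℝ) (μ : ℝ) (x : Fin n → ℝ)
    (i : Fin n) (δ : ℝ) : smoothF A μ (x + Pi.single i δ) =
      ∑ i, x i + δ + μ * ∑ j, Real.exp ((1 - (A *ᵥ x) j) / μ + -(A j i * δ / μ)) := by
  unfold smoothF
  simp only [mulVec_add_single, Pi.add_apply, Finset.sum_add_distrib, Finset.sum_pi_single',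
    Finset.mem_univ, if_true]
  congr 2
  refine Finset.sum_congr rfl fun j _ => ?_
  congr 1
  ring

theorem partialDeriv_smoothF {m n : ℕ} (A : Matrix (Fin m) (Fin n) ℝ) {μ : ℝ} (hμ : 0 < μ)
    (x : Fin n → ℝ) (i : Fin n) : partialDeriv (smoothF A μ) i x = smoothGrad A μ x i := by
  unfold partialDeriv lineDeriv
  have h1 : (fun t : ℝ => smoothF A μ (x + t • Pi.single i (1 : ℝ))) = fun t =>
      ∑ i, x i + t + μ * ∑ j, Real.exp ((1 - (A *ᵥ x) j) / μ + -(A j i * t / μ)) := by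
    funext t
    rw [← smoothF_add_single]
    congr 2
    rw [← Pi.single_smul]
    simp
  rw [h1]
  have h2 : ∀ j, HasDerivAt (fun t : ℝ => Real.exp ((1 - (A *ᵥ x) j) / μ + -(A j i * t / μ)))
      (Real.exp ((1 - (A *ᵥ x) j) / μ + -(A j i * 0 / μ)) * (-(A j i * 1 / μ))) 0 := fun j =>
    (((((hasDerivAt_id (0 : ℝ)).const_mul (A j i)).div_const μ).neg).const_add _).exp
  have h3 := ((hasDerivAt_id (0 : ℝ)).const_add (∑ i, x i)).add
    ((HasDerivAt.fun_sum fun j (_ : j ∈ Finset.univ) => h2 j).const_mul μ)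
  have h4 := h3.deriv
  simp only [id] at h4
  refine h4.trans ?_
  unfold smoothGrad
  rw [Finset.mul_sum, sub_eq_add_neg, ← Finset.sum_neg_distrib]
  congr 1
  refine Finset.sum_congr rfl fun j _ => ?_
  simp
  field_simp

theorem smoothF_convex {m n : ℕ} (A : Matrix (Fin m) (Fin n) ℝ) {μ : ℝ} (hμ : 0 < μ)
    (x v : Fin n → ℝ) :
    smoothF A μ x + ∑ i, smoothGrad A μ x i * (v i - x i) ≤ smoothF A μ v := by
  have key : ∀ j, Real.exp ((1 - (A *ᵥ x) j) / μ) -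
      Real.exp ((1 - (A *ᵥ x) j) / μ) * (((A *ᵥ v) j - (A *ᵥ x) j) / μ) ≤
      Real.exp ((1 - (A *ᵥ v) j) / μ) := by
    intro j
    have h := Real.add_one_le_exp (-(((A *ᵥ v) j - (A *ᵥ x) j) / μ))
    have h2 : Real.exp ((1 - (A *ᵥ v) j) / μ) = Real.exp ((1 - (A *ᵥ x) j) / μ) *
        Real.exp (-(((A *ᵥ v) j - (A *ᵥ x) j) / μ)) := by
      rw [← Real.exp_add]; congr 1; ring
    rw [h2]
    nlinarith [Real.exp_pos ((1 - (A *ᵥ x) j) / μ)]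
  have h1 : ∑ i, smoothGrad A μ x i * (v i - x i) = ∑ i, v i - ∑ i, x i -
      ∑ j, Real.exp ((1 - (A *ᵥ x) j) / μ) * ((A *ᵥ v) j - (A *ᵥ x) j) := by
    have h2 : ∀ j, (A *ᵥ v) j - (A *ᵥ x) j = ∑ i, A j i * (v i - x i) := by
      intro j
      simp only [Matrix.mulVec, dotProduct, ← Finset.sum_sub_distrib, mul_sub]
    simp only [h2, smoothGrad, sub_mul, one_mul, Finset.sum_sub_distrib]
    congr 1
    simp only [Finset.mul_sum, Finset.sum_mul]
    rw [Finset.sum_comm]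
    refine Finset.sum_congr rfl fun j _ => Finset.sum_congr rfl fun i _ => ?_
    ring
  have h3 := Finset.sum_le_sum fun j (_ : j ∈ Finset.univ) => key j
  rw [Finset.sum_sub_distrib] at h3
  have h4 : μ * ∑ j, Real.exp ((1 - (A *ᵥ x) j) / μ) * (((A *ᵥ v) j - (A *ᵥ x) j) / μ) =
      ∑ j, Real.exp ((1 - (A *ᵥ x) j) / μ) * ((A *ᵥ v) j - (A *ᵥ x) j) := by
    rw [Finset.mul_sum]
    refine Finset.sum_congr rfl fun j _ => ?_
    field_simp
  unfold smoothF
  rw [h1]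
  have h5 := mul_le_mul_of_nonneg_left h3 hμ.le
  rw [mul_sub, h4] at h5
  linarith

/-- Change of the smoothed objective along a coordinate step which is short enough for `exp` to be
replaced by its quadratic expansion. The curvature is proportional to `1 - ∇ᵢ f`, so it is not
bounded uniformly. -/
theorem smoothF_coord_step {m n : ℕ} {A : Matrix (Fin m) (Fin n) ℝ} {μ : ℝ} (hμ : 0 < μ)
    (hA : ∀ j i, 0 ≤ A j i) (x : Fin n → ℝ) (i : Fin n) {c δ : ℝ} (hc : ∀ j, A j i ≤ c)
    (hδ : c * |δ| ≤ μ) :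
    smoothF A μ (x + Pi.single i δ) ≤
      smoothF A μ x + δ * smoothGrad A μ x i + c * (1 - smoothGrad A μ x i) / μ * δ ^ 2 := by
  rw [smoothF_add_single]
  have key : ∀ j, Real.exp ((1 - (A *ᵥ x) j) / μ + -(A j i * δ / μ)) ≤
      Real.exp ((1 - (A *ᵥ x) j) / μ) + A j i * Real.exp ((1 - (A *ᵥ x) j) / μ) *
        (-(δ / μ) + c * δ ^ 2 / μ ^ 2) := by
    intro j
    have h1 : |-(A j i * δ / μ)| ≤ 1 := by
      rw [abs_neg, abs_div, abs_mul, abs_of_pos hμ, abs_of_nonneg (hA j i), div_le_one hμ]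
      exact (mul_le_mul_of_nonneg_right (hc j) (abs_nonneg _)).trans hδ
    have h2 := (abs_le.1 (Real.abs_exp_sub_one_sub_id_le h1)).2
    have h3 : (-(A j i * δ / μ)) ^ 2 ≤ A j i * (c * δ ^ 2 / μ ^ 2) := by
      have : (-(A j i * δ / μ)) ^ 2 = A j i * (A j i * (δ ^ 2 / μ ^ 2)) := by ring
      rw [this, mul_div_assoc]
      exact mul_le_mul_of_nonneg_left (mul_le_mul_of_nonneg_right (hc j) (by positivity)) (hA j i)
    rw [Real.exp_add]
    have h4 : Real.exp (-(A j i * δ / μ)) ≤ 1 + A j i * (-(δ / μ) + c * δ ^ 2 / μ ^ 2) := by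
      have : A j i * (-(δ / μ)) = -(A j i * δ / μ) := by ring
      linarith
    nlinarith [Real.exp_pos ((1 - (A *ᵥ x) j) / μ)]
  have h := mul_le_mul_of_nonneg_left
    (Finset.sum_le_sum fun j (_ : j ∈ Finset.univ) => key j) hμ.le
  rw [Finset.sum_add_distrib, ← Finset.sum_mul] at h
  have hS : ∑ j, A j i * Real.exp ((1 - (A *ᵥ x) j) / μ) = 1 - smoothGrad A μ x i := by
    unfold smoothGrad; ring
  rw [hS] at h
  have h5 : μ * ((1 - smoothGrad A μ x i) * (-(δ / μ) + c * δ ^ 2 / μ ^ 2)) =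
      -(δ * (1 - smoothGrad A μ x i)) + c * (1 - smoothGrad A μ x i) / μ * δ ^ 2 := by
    field_simp
  unfold smoothF
  rw [mul_add, h5] at h
  linarith

theorem smoothGrad_le_one {m n : ℕ} {A : Matrix (Fin m) (Fin n) ℝ} (μ : ℝ)
    (hA : ∀ j i, 0 ≤ A j i) (x : Fin n → ℝ) (i : Fin n) : smoothGrad A μ x i ≤ 1 := by
  unfold smoothGrad
  have : 0 ≤ ∑ j, A j i * Real.exp ((1 - (A *ᵥ x) j) / μ) :=
    Finset.sum_nonneg fun j _ => mul_nonneg (hA j i) (Real.exp_pos _).le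
  linarith

/-! ### The projection step -/

/-- Projection of a real number to `[0, b]`. -/
def clip (b t : ℝ) : ℝ := if t < 0 then 0 else if b < t then b else t

theorem clip_mem {b : ℝ} (hb : 0 ≤ b) (t : ℝ) : 0 ≤ clip b t ∧ clip b t ≤ b := by
  unfold clip; split_ifs <;> constructor <;> linarith

/-- Variational characterization of the one-dimensional proximal step. -/
theorem clip_variational {b c z s w : ℝ} (hc : 0 < c) (hw : 0 ≤ w ∧ w ≤ b) :
    0 ≤ (c * (clip b (z - s / c) - z) + s) * (w - clip b (z - s / c)) := by
  have e : c * (z - s / c - z) + s = 0 := by field_simp; ring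
  unfold clip
  split_ifs with h1 h2
  · have : c * (z - s / c) ≤ 0 := by nlinarith
    have h3 : 0 ≤ c * (0 - z) + s := by nlinarith
    exact mul_nonneg h3 (by linarith)
  · have h3 : c * (b - z) + s ≤ 0 := by nlinarith
    exact mul_nonneg_of_nonpos_of_nonpos h3 (by linarith)
  · rw [e]; simp

theorem clip_three_point {b c z s w : ℝ} (hc : 0 < c) (hw : 0 ≤ w ∧ w ≤ b) :
    1 / 2 * (c * (z - clip b (z - s / c)) ^ 2) + s * clip b (z - s / c) +
      1 / 2 * (c * (clip b (z - s / c) - w) ^ 2) ≤ 1 / 2 * (c * (z - w) ^ 2) + s * w := by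
  have h := clip_variational (z := z) (s := s) hc hw
  nlinarith

theorem clip_of_mem {b t : ℝ} (h : 0 ≤ t ∧ t ≤ b) : clip b t = t := by
  unfold clip; rw [if_neg (by linarith), if_neg (by linarith)]

theorem bregman_eq {m n : ℕ} {A : Matrix (Fin m) (Fin n) ℝ} (hc : ∀ i, 0 < colNorm A i)
    (x y : Fin n → ℝ) : bregman A x y = ∑ i, 1 / 2 * (colNorm A i * (x i - y i) ^ 2) := by
  unfold bregman normA
  rw [Real.sq_sqrt (Finset.sum_nonneg fun i _ => mul_nonneg (hc i).le (sq_nonneg _)),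
    Finset.mul_sum]
  rfl

/-- The mirror step separates into proximal steps in the coordinates. -/
theorem argmin_box_eq {m n : ℕ} {A : Matrix (Fin m) (Fin n) ℝ} (hc : ∀ i, 0 < colNorm A i)
    (z s : Fin n → ℝ) :
    argmin (box A) (fun w => bregman A z w + w ⬝ᵥ s) =
      fun i => clip (3 / colNorm A i) (z i - s i / colNorm A i) := by
  set p : Fin n → ℝ := fun i => clip (3 / colNorm A i) (z i - s i / colNorm A i) with hp
  have hpb : p ∈ box A := fun i => clip_mem (div_nonneg (by norm_num) (hc i).le) _
  have key : ∀ w ∈ box A, bregman A z p + p ⬝ᵥ s + bregman A p w ≤ bregman A z w + w ⬝ᵥ s := by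
    intro w hw
    rw [bregman_eq hc, bregman_eq hc, bregman_eq hc]
    unfold dotProduct
    rw [← Finset.sum_add_distrib, ← Finset.sum_add_distrib, ← Finset.sum_add_distrib]
    refine Finset.sum_le_sum fun i _ => ?_
    have := clip_three_point (z := z i) (s := s i) (hc i) (hw i)
    rw [mul_comm (p i), mul_comm (w i)]
    exact this
  have hex : ∃ q, q ∈ box A ∧ ∀ w ∈ box A, bregman A z q + q ⬝ᵥ s ≤ bregman A z w + w ⬝ᵥ s := by
    refine ⟨p, hpb, fun w hw => ?_⟩
    have h := key w hw
    have h0 : 0 ≤ bregman A p w := by unfold bregman; positivity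
    linarith
  have hq := Classical.epsilon_spec hex
  set q := Classical.epsilon fun q => q ∈ box A ∧
    ∀ w ∈ box A, bregman A z q + q ⬝ᵥ s ≤ bregman A z w + w ⬝ᵥ s with hqd
  have h1 := key q hq.1
  have h2 := hq.2 p hpb
  have h3 : bregman A p q ≤ 0 := by linarith
  rw [bregman_eq hc] at h3
  have hnn : ∀ i ∈ Finset.univ, 0 ≤ 1 / 2 * (colNorm A i * (p i - q i) ^ 2) := fun i _ =>
    mul_nonneg (by norm_num) (mul_nonneg (hc i).le (sq_nonneg _))
  have h4 := (Finset.sum_eq_zero_iff_of_nonneg hnn).1 (le_antisymm h3 (Finset.sum_nonneg hnn))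
  have : q = p := by
    funext i
    have h5 := h4 i (Finset.mem_univ i)
    have h6 : (p i - q i) ^ 2 = 0 := by
      have := (hc i).ne'
      simpa [this] using h5
    have := pow_eq_zero_iff (two_ne_zero) |>.1 h6
    linarith
  exact this

/-! ### Progress of one iteration -/

theorem trunc_abs_le (g : ℝ) : -1 ≤ trunc g ∧ trunc g ≤ 1 := by
  unfold trunc; split_ifs <;> constructor <;> linarith

/-- The part of the partial derivative `G` below `-1`, which the truncation ignores, is paid for by
the descent: either `u` is below the new coordinate `z + D`, or the step `D` was not clipped. -/
theorem truncated_part_le {c a z u q D : ℝ} (ha : 0 < a) (ha1 : a ≤ 1)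
    (hz : 0 ≤ z) (hu : u ≤ 3 / c) (hq : 0 ≤ q) (hD : 0 ≤ D) (h : u ≤ z + D ∨ D = a / c) :
    a * q * (u - z) ≤ 3 * q * D := by
  have h6 : a * (u - z) ≤ 3 * D := by
    rcases h with h | h
    · have h1 : a * (u - z) ≤ a * D := mul_le_mul_of_nonneg_left (by linarith) ha.le
      have h2 : a * D ≤ 1 * D := mul_le_mul_of_nonneg_right ha1 hD
      linarith
    · rw [h]
      calc a * (u - z) ≤ a * (3 / c) := mul_le_mul_of_nonneg_left (by linarith) ha.le
        _ = 3 * (a / c) := by ring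
  have := mul_le_mul_of_nonneg_left h6 hq
  linarith

/-- The descent along a step `D / (a L)` of the algorithm, after scaling by `8 a L`, dominates the
error terms of the mirror step `D`. -/
theorem descent_dominates {c a z u G D : ℝ} (hc : 0 < c) (ha : 0 < a) (ha1 : a ≤ 1)
    (hz : 0 ≤ z) (hu : u ≤ 3 / c) (hG : G ≤ 1) (hcD : c * |D| ≤ a)
    (hv : c * D ^ 2 ≤ -(a * trunc G) * D) (h : G < -1 → u ≤ z + D ∨ D = a / c) :
    a * (G - trunc G) * (z - u) - 1 / 2 * (c * D ^ 2) - a * trunc G * D ≤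
      -(8 * D * G) - 2 * (c * D ^ 2 / a) * (1 - G) := by
  have hX : 0 ≤ c * D ^ 2 := mul_nonneg hc.le (sq_nonneg D)
  by_cases hG1 : G < -1
  · have htG : trunc G = -1 := by unfold trunc; rw [if_pos hG1]
    rw [htG] at hv ⊢
    have hD0 : 0 ≤ D := by
      have h1 : 0 ≤ a * D := by linarith
      exact nonneg_of_mul_nonneg_right h1 ha
    obtain ⟨q, hq⟩ : ∃ q, q = -1 - G := ⟨_, rfl⟩
    have hGq : G = -1 - q := by linarith
    have hq0 : 0 ≤ q := by linarith
    have hkey := truncated_part_le ha ha1 hz hu hq0 hD0 (h hG1)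
    rw [abs_of_nonneg hD0] at hcD
    have h6 : c * D ^ 2 / a ≤ D := by
      rw [div_le_iff₀ ha]
      have := mul_le_mul_of_nonneg_right hcD hD0
      linarith
    have h7 : c * D ^ 2 / a * (2 + q) ≤ D * (2 + q) := mul_le_mul_of_nonneg_right h6 (by linarith)
    have h8 : a * D ≤ 1 * D := mul_le_mul_of_nonneg_right ha1 hD0
    have h9 : 0 ≤ D * q := mul_nonneg hD0 hq0
    have e : 2 * (c * D ^ 2 / a) * (1 - G) = 2 * (c * D ^ 2 / a * (2 + q)) := by rw [hGq]; ring
    rw [e, hGq]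
    linarith
  · have htG : trunc G = G := by
      unfold trunc; rw [if_neg hG1, if_neg (by linarith)]
    rw [htG] at hv ⊢
    push Not at hG1
    have h1 : c * D ^ 2 / a ≤ -(G * D) := by rw [div_le_iff₀ ha]; linarith
    have h2 : 0 ≤ c * D ^ 2 / a := by positivity
    have h3 : c * D ^ 2 / a * (1 - G) ≤ c * D ^ 2 / a * 2 :=
      mul_le_mul_of_nonneg_left (by linarith) h2
    have h5 : a * (-(G * D)) ≤ 1 * (-(G * D)) := mul_le_mul_of_nonneg_right ha1 (h2.trans h1)
    have e : 2 * (c * D ^ 2 / a) * (1 - G) = 2 * (c * D ^ 2 / a * (1 - G)) := by ring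
    rw [e]
    linarith

/-- The progress made by one coordinate step. `G` is the partial derivative, `a = n α_k`, and `F`,
`F'` are the values of the objective before and after the step. The descent `F - F'` pays
both for the mirror step with the truncated gradient and for the part of `G` below `-1` which the
truncation ignores. -/
theorem coord_progress {L c a z u G F F' p : ℝ} (hL : 0 < L) (hc : 0 < c) (ha : 0 < a)
    (ha1 : a ≤ 1) (hz : 0 ≤ z ∧ z ≤ 3 / c) (hu : 0 ≤ u ∧ u ≤ 3 / c) (hG : G ≤ 1)
    (hp : p = clip (3 / c) (z - a * trunc G / c))
    (hF : c * |(p - z) / (a * L)| ≤ 4 / L →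
      F' ≤ F + (p - z) / (a * L) * G + c * (1 - G) / (4 / L) * ((p - z) / (a * L)) ^ 2) :
    a * G * (z - u) ≤ 8 * (a * L) * (F - F') + (1 / 2 * (c * (z - u) ^ 2) -
      1 / 2 * (c * (p - u) ^ 2)) := by
  have h3 := clip_three_point (z := z) (s := a * trunc G) hc hu
  have hv := clip_variational (z := z) (s := a * trunc G) hc hz
  rw [← hp] at h3 hv
  obtain ⟨D, hD⟩ : ∃ D, D = p - z := ⟨_, rfl⟩
  have hpD : p = z + D := by linarith
  rw [← hD] at hF hv
  have hv' : c * D ^ 2 ≤ -(a * trunc G) * D := by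
    have : (c * D + a * trunc G) * (z - p) = -(c * D ^ 2) - a * trunc G * D := by
      rw [hpD]; ring
    linarith
  have htr := trunc_abs_le G
  have hcD : c * |D| ≤ a := by
    rcases eq_or_ne D 0 with h0 | h0
    · rw [h0]; simp [ha.le]
    have hpos : 0 < |D| := abs_pos.2 h0
    have h1 : -(a * trunc G) * D ≤ a * |D| := by
      have h2 : -(trunc G * D) ≤ |D| := by
        calc -(trunc G * D) ≤ |trunc G * D| := neg_le_abs _
          _ = |trunc G| * |D| := abs_mul _ _
          _ ≤ 1 * |D| := mul_le_mul_of_nonneg_right (abs_le.2 htr) hpos.le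
          _ = |D| := one_mul _
      have := mul_le_mul_of_nonneg_left h2 ha.le
      linarith
    have h2 : c * |D| * |D| ≤ a * |D| := by
      have : c * |D| * |D| = c * D ^ 2 := by rw [mul_assoc, abs_mul_abs_self]; ring
      linarith
    exact le_of_mul_le_mul_right h2 hpos
  have haL : 0 < a * L := mul_pos ha hL
  have hcδ : c * |D / (a * L)| ≤ 4 / L := by
    rw [abs_div, abs_of_pos haL, ← mul_div_assoc, div_le_div_iff₀ haL hL]
    have := mul_le_mul_of_nonneg_right hcD hL.le
    linarith
  have hF' := hF hcδ
  have hdom : a * (G - trunc G) * (z - u) - 1 / 2 * (c * D ^ 2) - a * trunc G * D ≤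
      -(8 * D * G) - 2 * (c * D ^ 2 / a) * (1 - G) := by
    refine descent_dominates hc ha ha1 hz.1 hu.2 hG hcD hv' fun hG1 => ?_
    have htG : trunc G = -1 := by unfold trunc; rw [if_pos hG1]
    rw [htG] at hp
    have hac : 0 < a / c := by positivity
    have e : z - a * -1 / c = z + a / c := by ring
    rw [e] at hp
    unfold clip at hp
    rw [if_neg (by linarith [hz.1])] at hp
    split_ifs at hp with h5
    · left; linarith [hu.2]
    · right; linarith
  have hdesc : 8 * (a * L) * (-(D / (a * L) * G) - c * (1 - G) / (4 / L) * (D / (a * L)) ^ 2) ≤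
      8 * (a * L) * (F - F') := mul_le_mul_of_nonneg_left (by linarith) (by positivity)
  have e3 : 8 * (a * L) * (-(D / (a * L) * G) - c * (1 - G) / (4 / L) * (D / (a * L)) ^ 2) =
      -(8 * D * G) - 2 * (c * D ^ 2 / a) * (1 - G) := by
    field_simp; ring
  have e1 : (z - p) ^ 2 = D ^ 2 := by rw [hpD]; ring
  rw [e1] at h3
  have e2 : a * trunc G * p = a * trunc G * z + a * trunc G * D := by rw [hpD]; ring
  linarith

/-- Standing assumptions on the matrix and the step sizes for the convergence analysis. -/
structure Setup {m n : ℕ} (A : Matrix (Fin m) (Fin n) ℝ) (ε : ℝ) : Prop where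
  nonneg : ∀ j i, 0 ≤ A j i
  norm_pos : ∀ i, 0 < colNorm A i
  n_pos : 0 < n
  m_pos : 0 < m
  eps_pos : 0 < ε
  eps_lt : ε < 1
  eps_le : 2 * ε ≤ (n : ℝ) * m

namespace Setup
variable {m n : ℕ} {A : Matrix (Fin m) (Fin n) ℝ} {ε : ℝ}

theorem one_le_mul (h : Setup A ε) : (1 : ℝ) ≤ (n : ℝ) * m := by
  exact_mod_cast Nat.mul_pos h.n_pos h.m_pos

theorem log_lower (h : Setup A ε) : Real.log (1 / ε) ≤ Real.log ((n : ℝ) * m / ε) := by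
  apply Real.log_le_log (by have := h.eps_pos; positivity)
  have := h.one_le_mul
  have := h.eps_pos
  gcongr

theorem log_two_le (h : Setup A ε) : Real.log 2 ≤ Real.log ((n : ℝ) * m / ε) := by
  apply Real.log_le_log (by norm_num)
  rw [le_div_iff₀ h.eps_pos]
  exact h.eps_le

theorem log_pos (h : Setup A ε) : 0 < Real.log ((n : ℝ) * m / ε) :=
  (Real.log_pos (by norm_num)).trans_le h.log_two_le

theorem mu_pos (h : Setup A ε) : 0 < mu m n ε := by
  unfold mu; have := h.log_pos; have := h.eps_pos; positivity

theorem lip_eq (h : Setup A ε) : lip m n ε = 16 * Real.log ((n : ℝ) * m / ε) / ε := by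
  unfold lip mu; have := h.log_pos; have := h.eps_pos; field_simp; norm_num

theorem mu_eq (h : Setup A ε) : mu m n ε = 4 / lip m n ε := by
  unfold lip; have := h.mu_pos; field_simp

theorem lip_lower (h : Setup A ε) : 11 ≤ lip m n ε := by
  rw [h.lip_eq, le_div_iff₀ h.eps_pos]
  have := h.log_two_le
  have := Real.log_two_gt_d9
  have := h.eps_lt
  linarith

theorem lip_pos (h : Setup A ε) : 0 < lip m n ε := by linarith [h.lip_lower]

theorem one_le_n (h : Setup A ε) : (1 : ℝ) ≤ n := by exact_mod_cast h.n_pos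

theorem tau_pos (h : Setup A ε) : 0 < tau m n ε := by
  unfold tau; have := h.lip_pos; have := h.one_le_n; positivity

theorem tau_le (h : Setup A ε) : tau m n ε ≤ 1 / 88 := by
  unfold tau
  apply one_div_le_one_div_of_le (by norm_num)
  have := h.lip_lower; have := h.one_le_n
  nlinarith

theorem one_sub_tau_pos (h : Setup A ε) : 0 < 1 - tau m n ε := by linarith [h.tau_le]

theorem alpha_eq (h : Setup A ε) (k : ℕ) :
    alpha m n ε k = 1 / (n * lip m n ε) / (1 - tau m n ε) ^ k := by
  induction k with
  | zero => simp [alpha]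
  | succ k ih =>
    rw [alpha, ih, pow_succ]
    have := h.one_sub_tau_pos
    have := h.lip_pos
    have := h.one_le_n
    field_simp

theorem alpha_pos (h : Setup A ε) (k : ℕ) : 0 < alpha m n ε k := by
  rw [h.alpha_eq]
  have := h.one_sub_tau_pos
  have := h.lip_pos
  have := h.one_le_n
  positivity

/-- The decay over all iterations is at most `ε`. -/
theorem pow_iters_le (h : Setup A ε) : (1 - tau m n ε) ^ iters m n ε ≤ ε := by
  have h1 : (1 - tau m n ε) ^ iters m n ε ≤ Real.exp (-tau m n ε) ^ iters m n ε := by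
    apply pow_le_pow_left₀ h.one_sub_tau_pos.le
    linarith [Real.add_one_le_exp (-tau m n ε)]
  refine h1.trans ?_
  rw [← Real.exp_nat_mul]
  have h2 : Real.log (1 / ε) ≤ (iters m n ε : ℝ) * tau m n ε := by
    have h3 : 8 * n * lip m n ε * Real.log (1 / ε) ≤ (iters m n ε : ℝ) := Nat.le_ceil _
    have h4 := mul_le_mul_of_nonneg_right h3 h.tau_pos.le
    refine le_trans (le_of_eq ?_) h4
    unfold tau
    have := h.lip_pos
    have := h.one_le_n
    field_simp
  calc Real.exp (iters m n ε * -tau m n ε) ≤ Real.exp (-Real.log (1 / ε)) := by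
        apply Real.exp_le_exp.2; linarith
    _ = ε := by rw [one_div, Real.log_inv, neg_neg, Real.exp_log h.eps_pos]

/-- The decay up to any iteration is not much below `ε`. -/
theorem le_pow_of_le_iters (h : Setup A ε) {k : ℕ} (hk : k ≤ iters m n ε) :
    ε / 2 ≤ (1 - tau m n ε) ^ k := by
  have ht := h.tau_pos
  have ht1 := h.tau_le
  have ht2 := h.one_sub_tau_pos
  have he := h.eps_pos
  have h0 : (1 - tau m n ε) ^ iters m n ε ≤ (1 - tau m n ε) ^ k :=
    pow_le_pow_of_le_one ht2.le (by linarith) hk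
  refine le_trans ?_ h0
  set T := iters m n ε with hT
  have hlog : 0 ≤ Real.log (1 / ε) := Real.log_nonneg (by
    rw [le_div_iff₀ he]; linarith [h.eps_lt])
  have hTle : (T : ℝ) * tau m n ε ≤ Real.log (1 / ε) + tau m n ε := by
    have h3 : (T : ℝ) < 8 * n * lip m n ε * Real.log (1 / ε) + 1 :=
      Nat.ceil_lt_add_one (by have := h.lip_pos; have := h.one_le_n; positivity)
    have h4 := mul_le_mul_of_nonneg_right h3.le ht.le
    refine le_trans h4 (le_of_eq ?_)
    unfold tau
    have := h.lip_pos
    have := h.one_le_n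
    field_simp
  -- `log (1 - τ) ≥ - τ - 2 τ²`
  have h5 : Real.exp (-(tau m n ε + 2 * tau m n ε ^ 2)) ≤ 1 - tau m n ε := by
    rw [Real.exp_neg, inv_le_comm₀ (Real.exp_pos _) ht2]
    have h6 := Real.add_one_le_exp (tau m n ε + 2 * tau m n ε ^ 2)
    refine le_trans ?_ h6
    rw [inv_le_iff_one_le_mul₀ ht2]
    nlinarith [mul_pos ht ht]
  have h6 : Real.exp (-(tau m n ε + 2 * tau m n ε ^ 2)) ^ T ≤ (1 - tau m n ε) ^ T :=
    pow_le_pow_left₀ (Real.exp_pos _).le h5 _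
  refine le_trans ?_ h6
  rw [← Real.exp_nat_mul]
  have h7 : tau m n ε * Real.log (1 / ε) ≤ 1 / 128 := by
    have h8 : tau m n ε ≤ 1 / (8 * (16 * Real.log (1 / ε) / ε)) ∨ Real.log (1 / ε) = 0 := by
      rcases hlog.eq_or_lt with h0 | h0
      · right; exact h0.symm
      left
      unfold tau
      rw [h.lip_eq]
      apply one_div_le_one_div_of_le (by positivity)
      have := h.log_lower
      have h9 : 16 * Real.log (1 / ε) / ε ≤ 16 * Real.log ((n : ℝ) * m / ε) / ε := by gcongr
      have h10 : 0 ≤ 16 * Real.log ((n : ℝ) * m / ε) / ε := by have := h.log_pos; positivity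
      nlinarith [h.one_le_n]
    rcases h8 with h8 | h8
    · rcases hlog.eq_or_lt with h0 | h0
      · rw [← h0]; norm_num
      calc tau m n ε * Real.log (1 / ε) ≤ 1 / (8 * (16 * Real.log (1 / ε) / ε)) *
            Real.log (1 / ε) := by gcongr
        _ = ε / 128 := by field_simp; norm_num
        _ ≤ 1 / 128 := by linarith [h.eps_lt]
    · rw [h8]; norm_num
  have h8 : (T : ℝ) * (tau m n ε + 2 * tau m n ε ^ 2) ≤ Real.log (1 / ε) + 1 / 2 := by
    have : (T : ℝ) * (tau m n ε + 2 * tau m n ε ^ 2) = (T * tau m n ε) * (1 + 2 * tau m n ε) := by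
      ring
    rw [this]
    have h9 := mul_le_mul_of_nonneg_right hTle (by linarith : 0 ≤ 1 + 2 * tau m n ε)
    nlinarith
  calc ε / 2 ≤ Real.exp (-(Real.log (1 / ε) + 1 / 2)) := by
        rw [neg_add, Real.exp_add, one_div, Real.log_inv, neg_neg, Real.exp_log he]
        have h9 : (1 : ℝ) / 2 ≤ Real.exp (-(1 / 2)) := by
          linarith [Real.add_one_le_exp (-(1 / 2) : ℝ)]
        rw [div_eq_mul_one_div]
        gcongr
    _ ≤ _ := by apply Real.exp_le_exp.2; linarith

theorem n_alpha_le (h : Setup A ε) {k : ℕ} (hk : k ≤ iters m n ε) : n * alpha m n ε k ≤ 1 := by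
  rw [h.alpha_eq]
  have h1 := h.le_pow_of_le_iters hk
  have h2 := h.lip_pos
  have h3 := h.one_le_n
  have he := h.eps_pos
  have e : (n : ℝ) * (1 / (n * lip m n ε) / (1 - tau m n ε) ^ k) =
      1 / (lip m n ε * (1 - tau m n ε) ^ k) := by
    have := h.one_sub_tau_pos
    field_simp
  rw [e]
  rw [div_le_one (by have := h.one_sub_tau_pos; positivity)]
  have h4 : lip m n ε * (ε / 2) ≤ lip m n ε * (1 - tau m n ε) ^ k := by gcongr
  refine le_trans ?_ h4
  rw [h.lip_eq]
  have : 16 * Real.log ((n : ℝ) * m / ε) / ε * (ε / 2) = 8 * Real.log ((n : ℝ) * m / ε) := by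
    field_simp; ring
  rw [this]
  linarith [h.log_two_le, Real.log_two_gt_d9]

end Setup

theorem le_colNorm {m n : ℕ} (A : Matrix (Fin m) (Fin n) ℝ) (j : Fin m) (i : Fin n) :
    A j i ≤ colNorm A i :=
  (le_abs_self _).trans (norm_le_pi_norm (fun j => A j i) j)

/-! ### Expected progress -/

theorem expect_choices_succ {n K : ℕ} (g : (Fin (K + 1) → Fin n) → ℝ) :
    (𝔼 ω, g ω) = 𝔼 ω : Fin K → Fin n, 𝔼 i, g (Fin.snoc ω i) := by
  rw [← Fintype.expect_equiv (Fin.snocEquiv fun _ => Fin n)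
    (fun p => g (Fin.snocEquiv (fun _ => Fin n) p)) g (fun _ => rfl)]
  rw [← Finset.univ_product_univ, Finset.expect_product, Finset.expect_comm]
  rfl

namespace Setup
variable {m n : ℕ} {A : Matrix (Fin m) (Fin n) ℝ} {ε : ℝ}

/-- The iteration in explicit form. -/
theorem iterate_eq (h : Setup A ε) (k : ℕ) (i : Fin n) {y z : Fin n → ℝ} (hz : z ∈ box A) :
    let x := tau m n ε • z + (1 - tau m n ε) • y
    let p := clip (3 / colNorm A i)
      (z i - n * alpha m n ε k * trunc (smoothGrad A (mu m n ε) x i) / colNorm A i)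
    iterate A ε k i (y, z) =
      (x + Pi.single i ((p - z i) / (n * alpha m n ε k * lip m n ε)), Function.update z i p) := by
  intro x p
  have hx : tau m n ε • z + (1 - tau m n ε) • y = x := rfl
  unfold iterate
  simp only [hx, smoothed_eq A h.mu_pos, partialDeriv_smoothF A h.mu_pos,
    argmin_box_eq h.norm_pos]
  have hzz : (fun i' => clip (3 / colNorm A i') (z i' - ((n * alpha m n ε k) •
      (Pi.single i (trunc (smoothGrad A (mu m n ε) x i)) : Fin n → ℝ)) i' / colNorm A i')) =
      Function.update z i p := by
    funext i'
    rcases eq_or_ne i' i with rfl | hi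
    · simp [p]
    · simp [hi, clip_of_mem (hz i')]
  rw [hzz]
  congr 1
  congr 1
  funext i'
  rcases eq_or_ne i' i with rfl | hi
  · simp; ring
  · simp [hi]

theorem iterate_mem_box (h : Setup A ε) (k : ℕ) (i : Fin n) {y z : Fin n → ℝ} (hz : z ∈ box A) :
    (iterate A ε k i (y, z)).2 ∈ box A := by
  have := h.iterate_eq k i (y := y) hz
  simp only at this
  rw [this]
  intro i'
  rcases eq_or_ne i' i with rfl | hi
  · simp only [Function.update_self]
    exact clip_mem (div_nonneg (by norm_num) (h.norm_pos _).le) _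
  · simp only [Function.update_of_ne hi]
    exact hz i'

theorem run_mem_box (h : Setup A ε) {x₀ : Fin n → ℝ} (hx : x₀ ∈ box A) :
    ∀ (K : ℕ) (ω : Fin K → Fin n), (run A ε x₀ K ω).2 ∈ box A
  | 0, _ => hx
  | K + 1, ω => by
    have := run_mem_box h hx K fun k => ω k.castSucc
    exact h.iterate_mem_box (K + 1) _ this

/-- The potential of the convergence analysis. -/
def potential (A : Matrix (Fin m) (Fin n) ℝ) (ε : ℝ) (u : Fin n → ℝ) (k : ℕ)
    (yz : (Fin n → ℝ) × (Fin n → ℝ)) : ℝ :=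
  alpha m n ε k / tau m n ε * (smoothF A (mu m n ε) yz.1 - smoothF A (mu m n ε) u) +
    bregman A yz.2 u

theorem eight_n_alpha_lip (h : Setup A ε) (k : ℕ) :
    8 * (n * alpha m n ε k * lip m n ε) = alpha m n ε k / tau m n ε := by
  unfold tau
  have := h.lip_pos
  have := h.one_le_n
  field_simp

/-- `coord_progress` for an iteration: the regret of the mirror step in the selected coordinate is
paid for by the descent and the decrease of the divergence. -/
theorem iterate_progress (h : Setup A ε) {k : ℕ} (hk : k ≤ iters m n ε) (i : Fin n)
    {y z u : Fin n → ℝ} (hz : z ∈ box A) (hu : u ∈ box A) :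
    let x := tau m n ε • z + (1 - tau m n ε) • y
    n * alpha m n ε k * smoothGrad A (mu m n ε) x i * (z i - u i) ≤
      alpha m n ε k / tau m n ε * (smoothF A (mu m n ε) x -
        smoothF A (mu m n ε) (iterate A ε k i (y, z)).1) +
      (bregman A z u - bregman A (iterate A ε k i (y, z)).2 u) := by
  intro x
  have hit := h.iterate_eq k i (y := y) hz
  simp only at hit
  rw [hit]
  have hx : tau m n ε • z + (1 - tau m n ε) • y = x := rfl
  rw [hx]
  set p := clip (3 / colNorm A i)
      (z i - n * alpha m n ε k * trunc (smoothGrad A (mu m n ε) x i) / colNorm A i) with hp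
  have hn := h.one_le_n
  have hα := h.alpha_pos k
  have hb : bregman A z u - bregman A (Function.update z i p) u =
      1 / 2 * (colNorm A i * (z i - u i) ^ 2) - 1 / 2 * (colNorm A i * (p - u i) ^ 2) := by
    rw [bregman_eq h.norm_pos, bregman_eq h.norm_pos, ← Finset.sum_sub_distrib,
      Finset.sum_eq_single i]
    · simp
    · intro i' _ hi
      simp [hi]
    · simp
  rw [hb, ← h.eight_n_alpha_lip]
  refine coord_progress h.lip_pos (h.norm_pos i) (by positivity) (h.n_alpha_le hk) (hz i) (hu i)
    (smoothGrad_le_one _ h.nonneg x i) hp fun hδ => ?_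
  rw [← h.mu_eq] at hδ ⊢
  exact smoothF_coord_step h.mu_pos h.nonneg x i (fun j => le_colNorm A j i) hδ

/-- The potential does not increase in expectation. The convexity of the objective turns the mean
regret over the coordinates into a bound on the objective, and the choice of `α` makes the terms at
`y` telescope. -/
theorem potential_step (h : Setup A ε) {k : ℕ} (hk : k + 1 ≤ iters m n ε)
    {y z u : Fin n → ℝ} (hz : z ∈ box A) (hu : u ∈ box A) :
    (𝔼 i, potential A ε u (k + 1) (iterate A ε (k + 1) i (y, z))) ≤ potential A ε u k (y, z) := by
  set x := tau m n ε • z + (1 - tau m n ε) • y with hx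
  have hn := h.one_le_n
  have hτ := h.tau_pos
  have hτ1 := h.one_sub_tau_pos
  have hα := h.alpha_pos (k + 1)
  have hαk : alpha m n ε k = (1 - tau m n ε) * alpha m n ε (k + 1) := by
    rw [alpha]; field_simp
  set α := alpha m n ε (k + 1) with hαd
  set f := smoothF A (mu m n ε) with hf
  set G := smoothGrad A (mu m n ε) x with hG
  have hprog : ∀ i, potential A ε u (k + 1) (iterate A ε (k + 1) i (y, z)) ≤
      α / tau m n ε * (f x - f u) + bregman A z u - n * α * (G i * (z i - u i)) := by
    intro i
    have := h.iterate_progress hk i (y := y) hz hu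
    simp only [← hx] at this
    unfold potential
    rw [← hαd, ← hf]
    rw [← hf, ← hG, ← hαd] at this
    linarith
  have h1 := Finset.expect_le_expect fun i (_ : i ∈ Finset.univ) => hprog i
  refine h1.trans ?_
  have : NeZero n := ⟨h.n_pos.ne'⟩
  rw [Finset.expect_sub_distrib, Fintype.expect_const, Fintype.expect_eq_sum_div_card,
    ← Finset.mul_sum, Fintype.card_fin]
  have e1 : (n : ℝ) * α * (∑ i, G i * (z i - u i)) / n = α * ∑ i, G i * (z i - u i) := by
    field_simp
  rw [e1]
  have hc1 := smoothF_convex A h.mu_pos x u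
  have hc2 := smoothF_convex A h.mu_pos x y
  rw [← hf, ← hG] at hc1 hc2
  have e2 : tau m n ε * ∑ i, G i * (u i - x i) = -(tau m n ε * ∑ i, G i * (z i - u i)) -
      (1 - tau m n ε) * ∑ i, G i * (y i - x i) := by
    rw [Finset.mul_sum, Finset.mul_sum, Finset.mul_sum, ← Finset.sum_neg_distrib,
      ← Finset.sum_sub_distrib]
    refine Finset.sum_congr rfl fun i _ => ?_
    have : x i = tau m n ε * z i + (1 - tau m n ε) * y i := by simp [hx]
    rw [this]; ring
  unfold potential
  rw [hαk, ← hf]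
  simp only
  have h2 := mul_le_mul_of_nonneg_left hc1 hτ.le
  have h3 := mul_le_mul_of_nonneg_left hc2 hτ1.le
  have h4 : f x - f u - tau m n ε * ∑ i, G i * (z i - u i) ≤ (1 - tau m n ε) * (f y - f u) := by
    linarith
  have h5 := mul_le_mul_of_nonneg_left h4 (div_nonneg hα.le hτ.le)
  have e3 : α / tau m n ε * (f x - f u - tau m n ε * ∑ i, G i * (z i - u i)) =
      α / tau m n ε * (f x - f u) - α * ∑ i, G i * (z i - u i) := by
    field_simp
  have e4 : α / tau m n ε * ((1 - tau m n ε) * (f y - f u)) =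
      (1 - tau m n ε) * α / tau m n ε * (f y - f u) := by ring
  linarith

theorem potential_run (h : Setup A ε) {x₀ u : Fin n → ℝ} (hx : x₀ ∈ box A) (hu : u ∈ box A) :
    ∀ K ≤ iters m n ε, (𝔼 ω : Fin K → Fin n, potential A ε u K (run A ε x₀ K ω)) ≤
      potential A ε u 0 (x₀, x₀)
  | 0, _ => by simp [run]
  | K + 1, hK => by
    rw [expect_choices_succ]
    refine le_trans ?_ (potential_run h hx hu K (by omega))
    refine Finset.expect_le_expect fun ω _ => ?_
    simp only [run, Fin.snoc_last, Fin.snoc_castSucc]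
    exact h.potential_step hK (h.run_mem_box hx K ω) hu

/-- Convergence of the method against an arbitrary comparison point. -/
theorem expect_output_le (h : Setup A ε) {x₀ u : Fin n → ℝ} (hx : x₀ ∈ box A) (hu : u ∈ box A) :
    (𝔼 ω : Choices m n ε, smoothed A (mu m n ε) (output A ε x₀ ω)) ≤
      smoothF A (mu m n ε) u + ε * smoothF A (mu m n ε) x₀ + ε / 8 * bregman A x₀ u := by
  have hp := h.potential_run hx hu _ le_rfl
  have : NeZero n := ⟨h.n_pos.ne'⟩
  rw [smoothed_eq A h.mu_pos]
  set f := smoothF A (mu m n ε) with hf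
  set T := iters m n ε with hT
  have hτ := h.tau_pos
  have hα := h.alpha_pos T
  have h1 : alpha m n ε T / tau m n ε * ((𝔼 ω : Choices m n ε, f (output A ε x₀ ω)) - f u) ≤
      𝔼 ω : Fin T → Fin n, potential A ε u T (run A ε x₀ T ω) := by
    have e : alpha m n ε T / tau m n ε * ((𝔼 ω : Choices m n ε, f (output A ε x₀ ω)) - f u) =
        𝔼 ω : Choices m n ε, alpha m n ε T / tau m n ε * (f (output A ε x₀ ω) - f u) := by
      rw [← Finset.mul_expect, Finset.expect_sub_distrib, Fintype.expect_const]
    rw [e]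
    refine Finset.expect_le_expect fun ω _ => ?_
    unfold potential output
    have : 0 ≤ bregman A (run A ε x₀ T ω).2 u := by unfold bregman; positivity
    change alpha m n ε T / tau m n ε * (f (run A ε x₀ T ω).1 - f u) ≤
      alpha m n ε T / tau m n ε * (f (run A ε x₀ T ω).1 - f u) + _
    linarith
  have h2 := h1.trans hp
  unfold potential at h2
  simp only [← hf] at h2
  set E := 𝔼 ω : Choices m n ε, f (output A ε x₀ ω) with hE
  have hρ := h.pow_iters_le
  rw [← hT] at hρ
  have hα0 : alpha m n ε 0 = (1 - tau m n ε) ^ T * alpha m n ε T := by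
    rw [h.alpha_eq, h.alpha_eq]
    have := h.one_sub_tau_pos
    field_simp
  have hα0v : alpha m n ε 0 = 8 * tau m n ε := by
    unfold tau; rw [alpha]
    have := h.lip_pos
    have := h.one_le_n
    field_simp
  set ρ := (1 - tau m n ε) ^ T with hρd
  have hρ0 : 0 ≤ ρ := pow_nonneg h.one_sub_tau_pos.le _
  have hαρ : 0 < alpha m n ε T / tau m n ε := by positivity
  have e1 : alpha m n ε 0 / tau m n ε * (f x₀ - f u) + bregman A x₀ u =
      alpha m n ε T / tau m n ε * (ρ * (f x₀ - f u) + ρ / 8 * bregman A x₀ u) := by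
    have e2 : alpha m n ε T / tau m n ε * ρ = 8 := by
      have : alpha m n ε T / tau m n ε * ρ = alpha m n ε 0 / tau m n ε := by rw [hα0]; ring
      rw [this, hα0v]; field_simp
    have e3 : alpha m n ε 0 / tau m n ε = 8 := by rw [hα0v]; field_simp
    rw [e3, mul_add]
    linear_combination (-(f x₀ - f u) - bregman A x₀ u / 8) * e2
  rw [e1] at h2
  have h3 := le_of_mul_le_mul_left h2 hαρ
  have h4 : 0 ≤ bregman A x₀ u := by unfold bregman; positivity
  have h5 : 0 ≤ f u := (Finset.sum_nonneg fun i _ => (hu i).1).trans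
    (smoothF_pos_part A h.mu_pos u)
  have h6 : 0 ≤ f x₀ := (Finset.sum_nonneg fun i _ => (hx i).1).trans
    (smoothF_pos_part A h.mu_pos x₀)
  have h7 : ρ * f x₀ ≤ ε * f x₀ := mul_le_mul_of_nonneg_right hρ h6
  have h8 : ρ * bregman A x₀ u ≤ ε * bregman A x₀ u := mul_le_mul_of_nonneg_right hρ h4
  have h9 : 0 ≤ ρ * f u := mul_nonneg hρ0 h5
  linarith

theorem bregman_le (h : Setup A ε) {x u : Fin n → ℝ} (hx : x ∈ box A) (hu : u ∈ box A) :
    bregman A x u ≤ 3 / 2 * (∑ i, x i + ∑ i, u i) := by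
  rw [bregman_eq h.norm_pos, ← Finset.sum_add_distrib, Finset.mul_sum]
  refine Finset.sum_le_sum fun i _ => ?_
  have hc := h.norm_pos i
  have h1 := (le_div_iff₀ hc).1 (hx i).2
  have h2 := (le_div_iff₀ hc).1 (hu i).2
  have h3 := mul_le_mul_of_nonneg_right h1 (hx i).1
  have h4 := mul_le_mul_of_nonneg_right h2 (hu i).1
  have h5 : 0 ≤ colNorm A i * (x i * u i) :=
    mul_nonneg hc.le (mul_nonneg (hx i).1 (hu i).1)
  linarith [sq (x i - u i), (by ring : colNorm A i * (x i - u i) ^ 2 = x i * colNorm A i * x i +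
    u i * colNorm A i * u i - 2 * (colNorm A i * (x i * u i)))]

/-- Scaling a feasible point by `1 + ε / 2` makes the smoothing term negligible. -/
theorem smoothF_scaled_le (h : Setup A ε) {x : Fin n → ℝ} (hx : ∀ j, 1 ≤ (A *ᵥ x) j) :
    smoothF A (mu m n ε) ((1 + ε / 2) • x) ≤ (1 + ε / 2) * ∑ i, x i + 2 / 5 * ε := by
  have hμ := h.mu_pos
  have he := h.eps_pos
  have hn := h.one_le_n
  have hm : (1 : ℝ) ≤ m := by exact_mod_cast h.m_pos
  have hlog := h.log_pos
  have key : ∀ j, Real.exp ((1 - (A *ᵥ ((1 + ε / 2) • x)) j) / mu m n ε) ≤ 1 / m := by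
    intro j
    have h1 : (1 - (A *ᵥ ((1 + ε / 2) • x)) j) / mu m n ε ≤
        -(2 * Real.log ((n : ℝ) * m / ε)) := by
      rw [Matrix.mulVec_smul, Pi.smul_apply, smul_eq_mul, div_le_iff₀ hμ]
      have : -(2 * Real.log ((n : ℝ) * m / ε)) * mu m n ε = -(ε / 2) := by
        unfold mu; field_simp; norm_num
      rw [this]
      nlinarith [hx j]
    refine (Real.exp_le_exp.2 h1).trans ?_
    have hq : 0 < (n : ℝ) * m / ε := by positivity
    have hmq : (m : ℝ) ≤ (n : ℝ) * m / ε := by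
      rw [le_div_iff₀ he]
      nlinarith [h.eps_lt]
    rw [Real.exp_neg, two_mul, Real.exp_add, Real.exp_log hq, one_div]
    apply inv_anti₀ (by linarith)
    nlinarith
  have hsum : ∑ j, Real.exp ((1 - (A *ᵥ ((1 + ε / 2) • x)) j) / mu m n ε) ≤ 1 := by
    refine (Finset.sum_le_sum fun j _ => key j).trans ?_
    rw [Finset.sum_const, Finset.card_univ, Fintype.card_fin, nsmul_eq_mul]
    rw [mul_one_div_cancel (by positivity)]
  have hμle : mu m n ε ≤ 2 / 5 * ε := by
    unfold mu
    rw [div_le_iff₀ (by positivity)]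
    have h1 := h.log_two_le
    have h2 := Real.log_two_gt_d9
    nlinarith
  unfold smoothF
  have e : ∑ i, ((1 + ε / 2) • x) i = (1 + ε / 2) * ∑ i, x i := by
    simp [Finset.mul_sum]
  rw [e]
  have := mul_le_mul_of_nonneg_left hsum hμ.le
  linarith

theorem smul_mem_box (h : Setup A ε) {x : Fin n → ℝ} (h0 : ∀ i, 0 ≤ x i)
    (hb : ∀ i, x i ≤ 2 / colNorm A i) : (1 + ε / 2) • x ∈ box A := by
  have he := h.eps_pos
  have he1 := h.eps_lt
  intro i
  refine ⟨mul_nonneg (by linarith) (h0 i), ?_⟩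
  have h1 := hb i
  have e : 3 / colNorm A i = 3 / 2 * (2 / colNorm A i) := by ring
  rw [e, Pi.smul_apply, smul_eq_mul]
  exact mul_le_mul (by linarith) h1 (h0 i) (by norm_num)

/-- The guarantee on the output in terms of any feasible point `v` of the program whose
cost is not below half of the cost of the starting point. -/
theorem expect_output_le_of_feasible (h : Setup A ε) {x v : Fin n → ℝ} {c : ℝ}
    (hx0 : ∀ i, 0 ≤ x i) (hxb : ∀ i, x i ≤ 2 / colNorm A i) (hxf : ∀ j, 1 ≤ (A *ᵥ x) j)
    (hv0 : ∀ i, 0 ≤ v i) (hvb : ∀ i, v i ≤ 2 / colNorm A i) (hvf : ∀ j, 1 ≤ (A *ᵥ v) j)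
    (hc1 : 1 ≤ c) (hvc : ∑ i, v i ≤ c) (hxc : ∑ i, x i ≤ 2 * c) :
    (𝔼 ω : Choices m n ε, smoothed A (mu m n ε) (output A ε ((1 + ε / 2) • x) ω)) ≤
      (1 + 6 * ε) * c := by
  have he := h.eps_pos
  have he1 := h.eps_lt
  have hxB := h.smul_mem_box hx0 hxb
  have hvB := h.smul_mem_box hv0 hvb
  refine (h.expect_output_le hxB hvB).trans ?_
  have h1 := h.smoothF_scaled_le hxf
  have h2 := h.smoothF_scaled_le hvf
  have h3 := h.bregman_le hxB hvB
  have ex : ∑ i, ((1 + ε / 2) • x) i = (1 + ε / 2) * ∑ i, x i := by simp [Finset.mul_sum]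
  have ev : ∑ i, ((1 + ε / 2) • v) i = (1 + ε / 2) * ∑ i, v i := by simp [Finset.mul_sum]
  rw [ex, ev] at h3
  have h4 : (1 + ε / 2) * ∑ i, x i ≤ 3 * c := by
    have := mul_le_mul_of_nonneg_left hxc (by linarith : 0 ≤ 1 + ε / 2)
    nlinarith
  have h5 : (1 + ε / 2) * ∑ i, v i ≤ (1 + ε / 2) * c :=
    mul_le_mul_of_nonneg_left hvc (by linarith)
  have h6 : (1 + ε / 2) * c ≤ 3 / 2 * c := by nlinarith
  have h7 : smoothF A (mu m n ε) ((1 + ε / 2) • x) ≤ 17 / 5 * c := by nlinarith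
  have h8 : bregman A ((1 + ε / 2) • x) ((1 + ε / 2) • v) ≤ 27 / 4 * c := by linarith
  have h9 := mul_le_mul_of_nonneg_left h7 he.le
  have h10 := mul_le_mul_of_nonneg_left h8 (by linarith : 0 ≤ ε / 8)
  nlinarith

end Setup

/-! ### The covering program and its diameter reduction -/

/-- The assumptions on the constraint matrix. -/
structure IsCovering {m n : ℕ} (A : Matrix (Fin m) (Fin n) ℝ) : Prop where
  nonneg : ∀ j i, 0 ≤ A j i
  col : ∀ i, ∃ j, A j i ≠ 0
  row : (⨅ j, rowNorm A j) = 1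

/-- Position of the `l`-th copy of column `i` in the reduced matrix. -/
def copyIdx {m n : ℕ} (A : Matrix (Fin m) (Fin n) ℝ) (i : Fin n) (l : Fin (copies A i)) :
    Fin (redDim A) := finSigmaFinEquiv ⟨i, l⟩

theorem symm_copyIdx {m n : ℕ} (A : Matrix (Fin m) (Fin n) ℝ) (i : Fin n)
    (l : Fin (copies A i)) : finSigmaFinEquiv.symm (copyIdx A i l) = ⟨i, l⟩ :=
  Equiv.symm_apply_apply _ _

theorem sum_redDim {m n : ℕ} (A : Matrix (Fin m) (Fin n) ℝ) {M : Type*} [AddCommMonoid M]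
    (g : Fin (redDim A) → M) : ∑ k, g k = ∑ i, ∑ l, g (copyIdx A i l) := by
  rw [← Fintype.sum_sigma']
  exact (Equiv.sum_comp finSigmaFinEquiv g).symm

theorem forall_redDim {m n : ℕ} {A : Matrix (Fin m) (Fin n) ℝ} {P : Fin (redDim A) → Prop} :
    (∀ k, P k) ↔ ∀ i l, P (copyIdx A i l) := by
  refine ⟨fun h i l => h _, fun h k => ?_⟩
  have := h (finSigmaFinEquiv.symm k).1 (finSigmaFinEquiv.symm k).2
  have e : copyIdx A (finSigmaFinEquiv.symm k).1 (finSigmaFinEquiv.symm k).2 = k :=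
    Equiv.apply_symm_apply finSigmaFinEquiv k
  rwa [e] at this

theorem reduced_copyIdx {m n : ℕ} (A : Matrix (Fin m) (Fin n) ℝ) (j : Fin m) (i : Fin n)
    (l : Fin (copies A i)) :
    reduced A j (copyIdx A i l) = min (A j i) (2 ^ ((l : ℕ) + 1) * minPos A i) := by
  unfold reduced
  simp only
  rw [symm_copyIdx]

namespace IsCovering
variable {m n : ℕ} {A : Matrix (Fin m) (Fin n) ℝ}

theorem posSet_finite (A : Matrix (Fin m) (Fin n) ℝ) (i : Fin n) :
    {a | ∃ j, 0 < A j i ∧ a = A j i}.Finite := by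
  apply (Set.finite_range fun j => A j i).subset
  rintro a ⟨j, _, rfl⟩
  exact ⟨j, rfl⟩

theorem posSet_nonempty (h : IsCovering A) (i : Fin n) :
    {a | ∃ j, 0 < A j i ∧ a = A j i}.Nonempty := by
  obtain ⟨j, hj⟩ := h.col i
  exact ⟨_, j, lt_of_le_of_ne (h.nonneg j i) hj.symm, rfl⟩

theorem isLeast_minPos (h : IsCovering A) (i : Fin n) :
    IsLeast {a | ∃ j, 0 < A j i ∧ a = A j i} (minPos A i) :=
  ⟨(h.posSet_nonempty i).csInf_mem (posSet_finite A i),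
    fun _ ha => csInf_le (posSet_finite A i).bddBelow ha⟩

theorem isGreatest_maxPos (h : IsCovering A) (i : Fin n) :
    IsGreatest {a | ∃ j, 0 < A j i ∧ a = A j i} (maxPos A i) :=
  ⟨(h.posSet_nonempty i).csSup_mem (posSet_finite A i),
    fun _ ha => le_csSup (posSet_finite A i).bddAbove ha⟩

theorem minPos_pos (h : IsCovering A) (i : Fin n) : 0 < minPos A i := by
  obtain ⟨j, hj, e⟩ := (h.isLeast_minPos i).1
  rwa [e]

theorem minPos_le (h : IsCovering A) {j : Fin m} {i : Fin n} (hj : A j i ≠ 0) :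
    minPos A i ≤ A j i :=
  (h.isLeast_minPos i).2 ⟨j, lt_of_le_of_ne (h.nonneg j i) hj.symm, rfl⟩

theorem maxPos_pos (h : IsCovering A) (i : Fin n) : 0 < maxPos A i := by
  obtain ⟨j, hj, e⟩ := (h.isGreatest_maxPos i).1
  rwa [e]

theorem le_maxPos (h : IsCovering A) (j : Fin m) (i : Fin n) : A j i ≤ maxPos A i := by
  rcases (h.nonneg j i).eq_or_lt with h0 | h0
  · rw [← h0]; exact (h.maxPos_pos i).le
  · exact (h.isGreatest_maxPos i).2 ⟨j, h0, rfl⟩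

/-- A counter `l` is below the number of copies iff it fails the stopping test of a doubling
loop. -/
theorem lt_copies_iff (h : IsCovering A) (i : Fin n) (l : ℕ) :
    l < copies A i ↔ l < 1 ∨ 2 ^ l * minPos A i < maxPos A i := by
  unfold copies
  rw [lt_max_iff, Nat.lt_ceil]
  have h1 := h.minPos_pos i
  have h2 := h.maxPos_pos i
  rw [Real.lt_logb_iff_rpow_lt (by norm_num) (by positivity), Real.rpow_natCast, lt_div_iff₀ h1]

theorem one_le_copies (A : Matrix (Fin m) (Fin n) ℝ) (i : Fin n) : 1 ≤ copies A i :=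
  le_max_left _ _

theorem le_redDim (A : Matrix (Fin m) (Fin n) ℝ) : n ≤ redDim A := by
  unfold redDim
  calc n = ∑ _i : Fin n, 1 := by simp
    _ ≤ _ := Finset.sum_le_sum fun i _ => one_le_copies A i

theorem reduced_nonneg (h : IsCovering A) (j : Fin m) (k : Fin (redDim A)) :
    0 ≤ reduced A j k := by
  revert k
  rw [forall_redDim]
  intro i l
  rw [reduced_copyIdx]
  exact le_min (h.nonneg j i) (mul_nonneg (by positivity) (h.minPos_pos i).le)

theorem reduced_ne_zero_iff (h : IsCovering A) (j : Fin m) (i : Fin n) (l : Fin (copies A i)) :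
    reduced A j (copyIdx A i l) ≠ 0 ↔ A j i ≠ 0 := by
  rw [reduced_copyIdx]
  have h1 : 0 < 2 ^ ((l : ℕ) + 1) * minPos A i := mul_pos (by positivity) (h.minPos_pos i)
  constructor
  · intro h2 h3
    rw [h3, min_eq_left h1.le] at h2
    exact h2 rfl
  · intro h2
    have h3 : 0 < A j i := lt_of_le_of_ne (h.nonneg j i) h2.symm
    exact (lt_min h3 h1).ne'

theorem colNorm_eq {B : Matrix (Fin m) (Fin n) ℝ} {i : Fin n} {c : ℝ} (h0 : ∀ j, 0 ≤ B j i)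
    (h1 : ∀ j, B j i ≤ c) (h2 : ∃ j, B j i = c) : colNorm B i = c := by
  obtain ⟨j, hj⟩ := h2
  apply le_antisymm
  · refine (pi_norm_le_iff_of_nonneg (hj ▸ h0 j)).2 fun j' => ?_
    rw [Real.norm_eq_abs, abs_of_nonneg (h0 j')]
    exact h1 j'
  · rw [← hj]
    exact le_colNorm B j i

theorem colNorm_reduced (h : IsCovering A) (i : Fin n) (l : Fin (copies A i)) :
    colNorm (reduced A) (copyIdx A i l) =
      min (maxPos A i) (2 ^ ((l : ℕ) + 1) * minPos A i) := by
  apply colNorm_eq (fun j => h.reduced_nonneg j _)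
  · intro j
    rw [reduced_copyIdx]
    exact min_le_min_right _ (h.le_maxPos j i)
  · obtain ⟨j, _, hj⟩ := (h.isGreatest_maxPos i).1
    exact ⟨j, by rw [reduced_copyIdx, ← hj]⟩

theorem colNorm_reduced_pos (h : IsCovering A) (k : Fin (redDim A)) :
    0 < colNorm (reduced A) k := by
  revert k
  rw [forall_redDim]
  intro i l
  rw [h.colNorm_reduced]
  exact lt_min (h.maxPos_pos i) (mul_pos (by positivity) (h.minPos_pos i))

/-! ### Bounds on the optimal value -/

theorem m_pos (h : IsCovering A) : 0 < m := by
  rcases Nat.eq_zero_or_pos m with rfl | h0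
  · have := h.row
    rw [Real.iInf_of_isEmpty] at this
    norm_num at this
  · exact h0

theorem one_le_rowNorm (h : IsCovering A) (j : Fin m) : 1 ≤ rowNorm A j := by
  rw [← h.row]
  exact ciInf_le (Set.finite_range _).bddBelow j

theorem n_pos (h : IsCovering A) : 0 < n := by
  rcases Nat.eq_zero_or_pos n with rfl | h0
  · have h1 := h.one_le_rowNorm ⟨0, h.m_pos⟩
    unfold rowNorm at h1
    rw [Subsingleton.elim (fun i => A ⟨0, h.m_pos⟩ i) 0, norm_zero] at h1
    norm_num at h1
  · exact h0

theorem exists_one_le (h : IsCovering A) (j : Fin m) : ∃ i, 1 ≤ A j i := by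
  by_contra hc
  push Not at hc
  have : Nonempty (Fin n) := ⟨⟨0, h.n_pos⟩⟩
  have h1 : rowNorm A j < 1 := by
    refine (pi_norm_lt_iff (by norm_num)).2 fun i => ?_
    rw [Real.norm_eq_abs, abs_of_nonneg (h.nonneg j i)]
    exact hc i
  linarith [h.one_le_rowNorm j]

/-- Some row has no entry above one, hence every feasible point costs at least one. -/
theorem one_le_sum (h : IsCovering A) {x : Fin n → ℝ} (hx : ∀ i, 0 ≤ x i)
    (hf : ∀ j, 1 ≤ (A *ᵥ x) j) : 1 ≤ ∑ i, x i := by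
  have : Nonempty (Fin m) := ⟨⟨0, h.m_pos⟩⟩
  obtain ⟨j, hj⟩ := exists_eq_ciInf_of_finite (f := fun j => rowNorm A j)
  rw [h.row] at hj
  refine (hf j).trans ?_
  unfold Matrix.mulVec dotProduct
  refine Finset.sum_le_sum fun i _ => ?_
  have h1 : A j i ≤ 1 := by
    rw [← hj]
    exact (le_abs_self _).trans (norm_le_pi_norm (fun i => A j i) i)
  nlinarith [hx i]

theorem ones_feasible (h : IsCovering A) (j : Fin m) : 1 ≤ (A *ᵥ fun _ => 1) j := by
  obtain ⟨i, hi⟩ := h.exists_one_le j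
  refine hi.trans ?_
  unfold Matrix.mulVec dotProduct
  simp only [mul_one]
  exact Finset.single_le_sum (f := fun i => A j i) (fun i _ => h.nonneg j i) (Finset.mem_univ i)

theorem opt_le (h : IsCovering A) {x : Fin n → ℝ} (hx : ∀ i, 0 ≤ x i)
    (hf : ∀ j, 1 ≤ (A *ᵥ x) j) : opt A ≤ ∑ i, x i := by
  apply csInf_le
  · refine ⟨1, ?_⟩
    rintro v ⟨y, hy, hfy, rfl⟩
    exact h.one_le_sum hy hfy
  · exact ⟨x, hx, hf, rfl⟩

theorem le_opt (h : IsCovering A) {b : ℝ} (hb : ∀ x : Fin n → ℝ, (∀ i, 0 ≤ x i) →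
    (∀ j, 1 ≤ (A *ᵥ x) j) → b ≤ ∑ i, x i) : b ≤ opt A := by
  apply le_csInf
  · exact ⟨_, fun _ => 1, fun _ => zero_le_one, h.ones_feasible, rfl⟩
  · rintro v ⟨x, hx, hf, rfl⟩
    exact hb x hx hf

theorem one_le_opt (h : IsCovering A) : 1 ≤ opt A := h.le_opt fun _ hx hf => h.one_le_sum hx hf

theorem opt_le_n (h : IsCovering A) : opt A ≤ n := by
  have := h.opt_le (x := fun _ => 1) (fun _ => zero_le_one) h.ones_feasible
  simpa using this

/-! ### Lifting feasible points to the reduced program -/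

end IsCovering

/-- The test which selects the copy with cap `q` for a variable with value `y`: the value
obeys the bound `2 / q`, and `q` is the last cap or its double would violate the bound. -/
def liftVal (M y q : ℝ) : ℝ := if y * q ≤ 2 ∧ (M ≤ q ∨ 2 < y * (2 * q)) then y else 0

/-- A point of the reduced program which is feasible if `x` is feasible and costs no more: the
variable `xᵢ` is truncated to `1 / aᵢ` and moved to one of its copies. -/
def lift {m n : ℕ} (A : Matrix (Fin m) (Fin n) ℝ) (x : Fin n → ℝ) (k : Fin (redDim A)) : ℝ :=
  let p : (i : Fin n) × Fin (copies A i) := finSigmaFinEquiv.symm k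
  liftVal (maxPos A p.1) (min (x p.1) (1 / minPos A p.1)) (2 ^ ((p.2 : ℕ) + 1) * minPos A p.1)

theorem lift_copyIdx {m n : ℕ} (A : Matrix (Fin m) (Fin n) ℝ) (x : Fin n → ℝ) (i : Fin n)
    (l : Fin (copies A i)) : lift A x (copyIdx A i l) =
      liftVal (maxPos A i) (min (x i) (1 / minPos A i)) (2 ^ ((l : ℕ) + 1) * minPos A i) := by
  unfold lift
  simp only
  rw [symm_copyIdx]

namespace IsCovering
variable {m n : ℕ} {A : Matrix (Fin m) (Fin n) ℝ}

/-- Exactly one copy passes the test of `liftVal`. -/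
theorem exists_copy (h : IsCovering A) (i : Fin n) {y : ℝ} (hy0 : 0 ≤ y)
    (hy : y ≤ 1 / minPos A i) :
    ∃ l : Fin (copies A i), (y * (2 ^ ((l : ℕ) + 1) * minPos A i) ≤ 2 ∧
      (maxPos A i ≤ 2 ^ ((l : ℕ) + 1) * minPos A i ∨
        2 < y * (2 * (2 ^ ((l : ℕ) + 1) * minPos A i)))) ∧
      ∀ l' : Fin (copies A i), l' ≠ l → ¬ (y * (2 ^ ((l' : ℕ) + 1) * minPos A i) ≤ 2 ∧
      (maxPos A i ≤ 2 ^ ((l' : ℕ) + 1) * minPos A i ∨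
        2 < y * (2 * (2 ^ ((l' : ℕ) + 1) * minPos A i)))) := by
  have ha := h.minPos_pos i
  set a := minPos A i with had
  have hmono : ∀ l l' : ℕ, l ≤ l' → y * (2 ^ l * a) ≤ y * (2 ^ l' * a) := fun l l' hl =>
    mul_le_mul_of_nonneg_left
      (mul_le_mul_of_nonneg_right (pow_le_pow_right₀ (by norm_num) hl) ha.le) hy0
  have hdbl : ∀ l : ℕ, y * (2 * (2 ^ (l + 1) * a)) = y * (2 ^ (l + 2) * a) := fun l => by ring
  -- two selected copies coincide: the larger one would violate the test of the smaller one
  have huniq : ∀ l l' : ℕ, l < l' → l' < copies A i →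
      (maxPos A i ≤ 2 ^ (l + 1) * a ∨ 2 < y * (2 * (2 ^ (l + 1) * a))) →
      ¬ y * (2 ^ (l' + 1) * a) ≤ 2 := by
    intro l l' hll hl' hor hle
    rcases hor with h1 | h1
    · have h2 := (h.lt_copies_iff i (l + 1)).1 (by omega)
      rcases h2 with h2 | h2
      · omega
      · rw [← had] at h2; linarith
    · rw [hdbl] at h1
      have := hmono (l + 2) (l' + 1) (by omega)
      linarith
  have h0 : y * (2 ^ 1 * a) ≤ 2 := by
    rw [le_div_iff₀ ha] at hy
    linarith
  let S := (Finset.range (copies A i)).filter fun l => y * (2 ^ (l + 1) * a) ≤ 2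
  have hS : S.Nonempty :=
    ⟨0, Finset.mem_filter.2 ⟨Finset.mem_range.2 (one_le_copies A i), by simpa using h0⟩⟩
  obtain ⟨l, hl⟩ : ∃ l, l = S.max' hS := ⟨_, rfl⟩
  have hlS : l ∈ S := hl ▸ S.max'_mem hS
  obtain ⟨hlr, hl2⟩ := Finset.mem_filter.1 hlS
  rw [Finset.mem_range] at hlr
  have hlor : maxPos A i ≤ 2 ^ (l + 1) * a ∨ 2 < y * (2 * (2 ^ (l + 1) * a)) := by
    by_contra hc
    push Not at hc
    obtain ⟨hc1, hc2⟩ := hc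
    have h3 : l + 1 < copies A i := (h.lt_copies_iff i (l + 1)).2 (Or.inr hc1)
    rw [hdbl] at hc2
    have h4 : l + 1 ∈ S := Finset.mem_filter.2 ⟨Finset.mem_range.2 h3, hc2⟩
    have := S.le_max' _ h4
    omega
  refine ⟨⟨l, hlr⟩, ⟨hl2, hlor⟩, ?_⟩
  rintro ⟨l', hl'⟩ hne ⟨h5, h6⟩
  have hne' : l' ≠ l := fun e => hne (Fin.ext e)
  rcases lt_or_gt_of_ne hne' with h7 | h7
  · exact huniq l' l h7 hlr h6 hl2
  · exact huniq l l' h7 hl' hlor h5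

/-- A sum over the copies of a column against the lifted point has a single term. -/
theorem sum_lift (h : IsCovering A) {x : Fin n → ℝ} (hx : ∀ i, 0 ≤ x i) (i : Fin n) :
    ∃ q : ℝ, (maxPos A i ≤ q ∨ 1 < min (x i) (1 / minPos A i) * q) ∧
      ∀ g : ℝ → ℝ, ∑ l : Fin (copies A i),
        g (2 ^ ((l : ℕ) + 1) * minPos A i) * lift A x (copyIdx A i l) =
        g q * min (x i) (1 / minPos A i) := by
  have hy0 : 0 ≤ min (x i) (1 / minPos A i) :=
    le_min (hx i) (by have := h.minPos_pos i; positivity)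
  obtain ⟨l, hl, hu⟩ := h.exists_copy i hy0 (min_le_right _ _)
  refine ⟨2 ^ ((l : ℕ) + 1) * minPos A i, ?_, fun g => ?_⟩
  · exact hl.2.imp_right fun h1 => by linarith
  · rw [Finset.sum_eq_single l]
    · rw [lift_copyIdx, liftVal, if_pos hl]
    · intro l' _ hne
      rw [lift_copyIdx, liftVal, if_neg (hu l' hne), mul_zero]
    · simp

theorem lift_nonneg (h : IsCovering A) {x : Fin n → ℝ} (hx : ∀ i, 0 ≤ x i)
    (k : Fin (redDim A)) : 0 ≤ lift A x k := by
  revert k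
  rw [forall_redDim]
  intro i l
  rw [lift_copyIdx, liftVal]
  split_ifs
  · exact le_min (hx i) (by have := h.minPos_pos i; positivity)
  · exact le_rfl

theorem lift_le_bound (h : IsCovering A) {x : Fin n → ℝ} (hx : ∀ i, 0 ≤ x i)
    (k : Fin (redDim A)) : lift A x k ≤ 2 / colNorm (reduced A) k := by
  rw [le_div_iff₀ (h.colNorm_reduced_pos k)]
  revert k
  rw [forall_redDim]
  intro i l
  rw [lift_copyIdx, h.colNorm_reduced, liftVal]
  split_ifs with h1
  · have hy0 : 0 ≤ min (x i) (1 / minPos A i) :=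
      le_min (hx i) (by have := h.minPos_pos i; positivity)
    exact (mul_le_mul_of_nonneg_left (min_le_right _ _) hy0).trans h1.1
  · simp

theorem sum_lift_le (h : IsCovering A) {x : Fin n → ℝ} (hx : ∀ i, 0 ≤ x i) :
    ∑ k, lift A x k ≤ ∑ i, x i := by
  rw [sum_redDim]
  refine Finset.sum_le_sum fun i _ => ?_
  obtain ⟨q, _, hq⟩ := h.sum_lift hx i
  have := hq fun _ => 1
  simp only [one_mul] at this
  rw [this]
  exact min_le_left _ _

/-- In every row, the copies of a variable together contribute what the variable contributed, or at
least one. -/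
theorem lift_feasible (h : IsCovering A) {x : Fin n → ℝ} (hx : ∀ i, 0 ≤ x i)
    (hf : ∀ j, 1 ≤ (A *ᵥ x) j) (j : Fin m) : 1 ≤ (reduced A *ᵥ lift A x) j := by
  have key : ∀ i, min (A j i * x i) 1 ≤
      ∑ l, reduced A j (copyIdx A i l) * lift A x (copyIdx A i l) := by
    intro i
    obtain ⟨q, hq1, hq⟩ := h.sum_lift hx i
    have e := hq fun q => min (A j i) q
    simp only [reduced_copyIdx]
    rw [e]
    have ha := h.minPos_pos i
    rcases eq_or_ne (A j i) 0 with h0 | h0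
    · have hq0 : 0 ≤ q := by
        rcases hq1 with h1 | h1
        · exact (h.maxPos_pos i).le.trans h1
        · by_contra hc
          push Not at hc
          have : 0 ≤ min (x i) (1 / minPos A i) := le_min (hx i) (by positivity)
          nlinarith
      rw [h0, min_eq_left hq0]
      simp
    have hap := h.minPos_le h0
    have hAm := h.le_maxPos j i
    -- truncating `xᵢ` to `1 / aᵢ` keeps an entry `≥ aᵢ` from contributing less than `1`
    have hcase : min (A j i * x i) 1 ≤ A j i * min (x i) (1 / minPos A i) := by
      rcases min_choice (x i) (1 / minPos A i) with e1 | e1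
      · rw [e1]; exact min_le_left _ _
      · rw [e1]
        refine (min_le_right _ _).trans ?_
        rw [mul_one_div, le_div_iff₀ ha]
        linarith
    rcases min_choice (A j i) q with e1 | e1
    · rw [e1]; exact hcase
    · rcases hq1 with h1 | h1
      · rw [min_eq_left (hAm.trans h1)]
        exact hcase
      · rw [e1]
        refine (min_le_right _ _).trans ?_
        linarith
  have h1 : (reduced A *ᵥ lift A x) j =
      ∑ i, ∑ l, reduced A j (copyIdx A i l) * lift A x (copyIdx A i l) := by
    unfold Matrix.mulVec dotProduct
    rw [sum_redDim]
  rw [h1]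
  refine le_trans ?_ (Finset.sum_le_sum fun i _ => key i)
  by_cases hbig : ∃ i, 1 ≤ A j i * x i
  · obtain ⟨i, hi⟩ := hbig
    calc (1 : ℝ) = min (A j i * x i) 1 := (min_eq_right hi).symm
      _ ≤ _ := Finset.single_le_sum (f := fun i => min (A j i * x i) 1)
        (fun i _ => le_min (mul_nonneg (h.nonneg j i) (hx i)) zero_le_one) (Finset.mem_univ i)
  · push Not at hbig
    refine (hf j).trans (le_of_eq ?_)
    unfold Matrix.mulVec dotProduct
    exact Finset.sum_congr rfl fun i _ => (min_eq_left (hbig i).le).symm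

theorem isTwoApprox_lift (h : IsCovering A) {x : Fin n → ℝ} (hx : ∀ i, 0 ≤ x i)
    (hf : ∀ j, 1 ≤ (A *ᵥ x) j) (hc : ∑ i, x i ≤ 2 * opt A) : IsTwoApprox A (lift A x) :=
  ⟨h.lift_nonneg hx, h.lift_le_bound hx, h.lift_feasible hx hf, (h.sum_lift_le hx).trans hc⟩

theorem setup (h : IsCovering A) {ε : ℝ} (h0 : 0 < ε) (h1 : ε < 1) (h2 : 2 * ε ≤ (n : ℝ) * m) :
    Setup (reduced A) ε where
  nonneg := h.reduced_nonneg
  norm_pos := h.colNorm_reduced_pos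
  n_pos := h.n_pos.trans_le (le_redDim A)
  m_pos := h.m_pos
  eps_pos := h0
  eps_lt := h1
  eps_le := h2.trans (mul_le_mul_of_nonneg_right (by exact_mod_cast le_redDim A)
    (by positivity))

/-- The approximation guarantee of the algorithm. -/
theorem approximation (h : IsCovering A) {ε : ℝ} (h0 : 0 < ε) (h1 : ε < 1)
    (h2 : 2 * ε ≤ (n : ℝ) * m) {x : Fin (redDim A) → ℝ} (hx : IsTwoApprox A x) :
    (𝔼 ω : Choices m (redDim A) ε, smoothed (reduced A) (mu m (redDim A) ε)
      (output (reduced A) ε ((1 + ε / 2) • x) ω)) ≤ (1 + 6 * ε) * opt A := by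
  have hpos : 0 < 1 + 6 * ε := by linarith
  rw [← div_le_iff₀' hpos]
  refine h.le_opt fun v hv hvf => ?_
  rw [div_le_iff₀' hpos]
  refine (h.setup h0 h1 h2).expect_output_le_of_feasible hx.nonneg hx.le_bound hx.feasible
    (h.lift_nonneg hv) (h.lift_le_bound hv) (h.lift_feasible hv hvf) (h.one_le_sum hv hvf)
    (h.sum_lift_le hv) ?_
  have := h.opt_le hv hvf
  linarith [hx.cost_le]

end IsCovering

/-! ### A deterministic factor-two solver by multiplicative updates -/

/-- Weight of a row whose left-hand side is `t`; satisfied rows have no weight. -/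
def rowWeight (η t : ℝ) : ℝ := if t < 1 then Real.exp (-(η * t)) else 0

/-- The weighted benefit of column `i`. -/
def benefit {m n : ℕ} (A : Matrix (Fin m) (Fin n) ℝ) (η : ℝ) (x : Fin n → ℝ) (i : Fin n) : ℝ :=
  ∑ j, A j i * rowWeight η ((A *ᵥ x) j)

/-- One round: the variables whose benefit reaches the threshold `lam` grow by the
factor `1 + β`. -/
def coverStep {m n : ℕ} (A : Matrix (Fin m) (Fin n) ℝ) (η β lam : ℝ) (x : Fin n → ℝ) :
    Fin n → ℝ :=
  fun i => if benefit A η x i < lam then x i else x i * (1 + β)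

/-- The logarithm of `n + m`, on which all parameters of the solver depend. -/
def logSize (m n : ℕ) : ℝ := Real.log (n + m)

/-- The exponent of the row weights. -/
def coverEta (m n : ℕ) : ℝ := 10 * logSize m n

/-- The relative growth of a variable in one round. -/
def coverBeta (m n : ℕ) : ℝ := 1 / (100 * logSize m n)

/-- Number of phases, during which the threshold stays the same. -/
def coverPhases (m n : ℕ) : ℕ := ⌈200 * logSize m n⌉₊

/-- Number of rounds of a phase. -/
def coverRounds (m n : ℕ) : ℕ := ⌈2000 * (logSize m n * logSize m n)⌉₊

/-- The threshold of phase `t`. -/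
def coverThreshold (m n : ℕ) (t : ℕ) : ℝ := 10 * ((n + m) * (n + m)) * (10 / 11) ^ t

/-- The point reached after `t` phases. -/
def coverRun {m n : ℕ} (A : Matrix (Fin m) (Fin n) ℝ) : ℕ → Fin n → ℝ
  | 0 => fun _ => 1 / (10 * (n + m))
  | t + 1 => (coverStep A (coverEta m n) (coverBeta m n) (coverThreshold m n t))^[coverRounds m n]
      (coverRun A t)

theorem rowWeight_nonneg (η t : ℝ) : 0 ≤ rowWeight η t := by
  unfold rowWeight; split_ifs
  · exact (Real.exp_pos _).le
  · exact le_rfl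

theorem rowWeight_anti {η : ℝ} (hη : 0 ≤ η) {t t' : ℝ} (h : t ≤ t') :
    rowWeight η t' ≤ rowWeight η t := by
  unfold rowWeight
  split_ifs with h1 h2
  · apply Real.exp_le_exp.2
    have := mul_le_mul_of_nonneg_left h hη
    linarith
  · linarith
  · exact (Real.exp_pos _).le
  · exact le_rfl

theorem rowWeight_le_one {η t : ℝ} (hη : 0 ≤ η) (ht : 0 ≤ t) : rowWeight η t ≤ 1 := by
  unfold rowWeight
  split_ifs with h1
  · rw [Real.exp_le_one_iff]
    have := mul_nonneg hη ht
    linarith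
  · exact zero_le_one

/-- Decrease of a row weight when the left-hand side grows by a small amount `d`. -/
theorem rowWeight_add_le {η t d : ℝ} (hd : 0 ≤ d) (h : t < 1 → η * d ≤ 1 / 10) (hη : 0 ≤ η) :
    rowWeight η (t + d) ≤ rowWeight η t - 9 / 10 * (η * (rowWeight η t * d)) := by
  by_cases ht : t < 1
  · have hs := h ht
    have hs0 : 0 ≤ η * d := mul_nonneg hη hd
    have hw : rowWeight η t = Real.exp (-(η * t)) := by unfold rowWeight; rw [if_pos ht]
    have h1 : rowWeight η (t + d) ≤ Real.exp (-(η * t)) * Real.exp (-(η * d)) := by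
      rw [← Real.exp_add]
      unfold rowWeight
      split_ifs
      · apply Real.exp_le_exp.2; linarith
      · exact (Real.exp_pos _).le
    have h2 : Real.exp (-(η * d)) ≤ 1 - 9 / 10 * (η * d) := by
      have h3 : |-(η * d)| ≤ 1 := by rw [abs_neg, abs_of_nonneg hs0]; linarith
      have h4 := (abs_le.1 (Real.abs_exp_sub_one_sub_id_le h3)).2
      nlinarith
    rw [hw]
    have h5 := mul_le_mul_of_nonneg_left h2 (Real.exp_pos (-(η * t))).le
    linarith
  · have hw : rowWeight η t = 0 := by unfold rowWeight; rw [if_neg ht]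
    have hw' : rowWeight η (t + d) = 0 := by unfold rowWeight; rw [if_neg (by linarith)]
    rw [hw, hw']; simp

/-- The total weight of the rows. -/
def rowPotential {m n : ℕ} (A : Matrix (Fin m) (Fin n) ℝ) (η : ℝ) (x : Fin n → ℝ) : ℝ :=
  ∑ j, rowWeight η ((A *ᵥ x) j)

namespace IsCovering
variable {m n : ℕ} {A : Matrix (Fin m) (Fin n) ℝ}

theorem mulVec_nonneg (h : IsCovering A) {x : Fin n → ℝ} (hx : ∀ i, 0 ≤ x i) (j : Fin m) :
    0 ≤ (A *ᵥ x) j := by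
  unfold Matrix.mulVec dotProduct
  exact Finset.sum_nonneg fun i _ => mul_nonneg (h.nonneg j i) (hx i)

theorem mulVec_mono (h : IsCovering A) {x y : Fin n → ℝ} (hxy : ∀ i, x i ≤ y i) (j : Fin m) :
    (A *ᵥ x) j ≤ (A *ᵥ y) j := by
  unfold Matrix.mulVec dotProduct
  exact Finset.sum_le_sum fun i _ => mul_le_mul_of_nonneg_left (hxy i) (h.nonneg j i)

theorem benefit_anti (h : IsCovering A) {η : ℝ} (hη : 0 ≤ η) {x y : Fin n → ℝ}
    (hxy : ∀ i, x i ≤ y i) (i : Fin n) : benefit A η y i ≤ benefit A η x i := by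
  unfold benefit
  exact Finset.sum_le_sum fun j _ =>
    mul_le_mul_of_nonneg_left (rowWeight_anti hη (h.mulVec_mono hxy j)) (h.nonneg j i)

theorem sum_benefit (A : Matrix (Fin m) (Fin n) ℝ) (η : ℝ) (x v : Fin n → ℝ) :
    ∑ i, benefit A η x i * v i = ∑ j, rowWeight η ((A *ᵥ x) j) * (A *ᵥ v) j := by
  unfold benefit
  simp only [Finset.sum_mul]
  rw [Finset.sum_comm]
  refine Finset.sum_congr rfl fun j _ => ?_
  have : (A *ᵥ v) j = ∑ i, A j i * v i := rfl
  rw [this, Finset.mul_sum]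
  refine Finset.sum_congr rfl fun i _ => by ring

/-- Weak duality: an upper bound on all benefits bounds the potential. -/
theorem rowPotential_le (h : IsCovering A) {η : ℝ} {x : Fin n → ℝ} {b : ℝ} (hb : 0 < b)
    (hg : ∀ i, benefit A η x i ≤ b) : rowPotential A η x ≤ b * opt A := by
  rw [← div_le_iff₀' hb]
  refine h.le_opt fun v hv hvf => ?_
  rw [div_le_iff₀' hb, Finset.mul_sum]
  calc rowPotential A η x ≤ ∑ j, rowWeight η ((A *ᵥ x) j) * (A *ᵥ v) j :=
        Finset.sum_le_sum fun j _ => le_mul_of_one_le_right (rowWeight_nonneg _ _) (hvf j)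
    _ = ∑ i, benefit A η x i * v i := (sum_benefit A η x v).symm
    _ ≤ ∑ i, b * v i := Finset.sum_le_sum fun i _ => mul_le_mul_of_nonneg_right (hg i) (hv i)

theorem two_le_size (h : IsCovering A) : (2 : ℝ) ≤ n + m := by
  have h1 : (1 : ℝ) ≤ n := by exact_mod_cast h.n_pos
  have h2 : (1 : ℝ) ≤ m := by exact_mod_cast h.m_pos
  linarith

theorem logSize_lower (h : IsCovering A) : 69 / 100 ≤ logSize m n := by
  have h1 := Real.log_le_log (by norm_num) h.two_le_size
  have := Real.log_two_gt_d9
  unfold logSize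
  linarith

theorem exp_logSize (h : IsCovering A) : Real.exp (logSize m n) = n + m :=
  Real.exp_log (by linarith [h.two_le_size])

theorem coverEta_pos (h : IsCovering A) : 0 < coverEta m n := by
  unfold coverEta; linarith [h.logSize_lower]

theorem coverBeta_pos (h : IsCovering A) : 0 < coverBeta m n := by
  unfold coverBeta; have := h.logSize_lower; positivity

theorem coverBeta_le (h : IsCovering A) : coverBeta m n ≤ 1 / 69 := by
  unfold coverBeta
  apply one_div_le_one_div_of_le (by norm_num)
  linarith [h.logSize_lower]

theorem eta_mul_beta (h : IsCovering A) : coverEta m n * coverBeta m n = 1 / 10 := by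
  unfold coverEta coverBeta
  have : logSize m n ≠ 0 := by linarith [h.logSize_lower]
  field_simp; norm_num

theorem coverThreshold_pos (h : IsCovering A) (t : ℕ) : 0 < coverThreshold m n t := by
  unfold coverThreshold; have := h.two_le_size; positivity

/-- The invariant of the solver. The last inequality says that the potential decays
exponentially in the cost. -/
structure CoverInv (A : Matrix (Fin m) (Fin n) ℝ) (x : Fin n → ℝ) : Prop where
  lower : ∀ i, 1 / (10 * (n + m)) ≤ x i
  cost : ∑ i, x i ≤ 2 * opt A
  decay : rowPotential A (coverEta m n) x *
    Real.exp (81 / 10 * logSize m n * ((∑ i, x i) / opt A)) ≤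
      m * Real.exp (81 / 100 * logSize m n)

theorem CoverInv.nonneg (h : IsCovering A) {x : Fin n → ℝ} (hx : CoverInv A x) (i : Fin n) :
    0 ≤ x i := le_trans (by have := h.two_le_size; positivity) (hx.lower i)

theorem exp_lt_rowPotential {η : ℝ} (hη : 0 < η) {x : Fin n → ℝ} {j : Fin m}
    (hj : (A *ᵥ x) j < 1) : Real.exp (-η) < rowPotential A η x := by
  have h1 : Real.exp (-η) < rowWeight η ((A *ᵥ x) j) := by
    unfold rowWeight
    rw [if_pos hj]
    apply Real.exp_lt_exp.2
    nlinarith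
  exact h1.trans_le (Finset.single_le_sum (f := fun j => rowWeight η ((A *ᵥ x) j))
    (fun j _ => rowWeight_nonneg _ _) (Finset.mem_univ j))

/-- As long as a row is unsatisfied, the cost is well below the target. -/
theorem CoverInv.cost_of_active (h : IsCovering A) {x : Fin n → ℝ} (hx : CoverInv A x)
    {j : Fin m} (hj : (A *ᵥ x) j < 1) : ∑ i, x i ≤ 3 / 2 * opt A := by
  have h1 := exp_lt_rowPotential h.coverEta_pos hj
  have hℓ := h.logSize_lower
  have hopt := h.one_le_opt
  have hm : (m : ℝ) ≤ Real.exp (logSize m n) := by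
    rw [h.exp_logSize]; linarith [(Nat.cast_nonneg n : (0 : ℝ) ≤ n)]
  have h2 : Real.exp (-coverEta m n) *
      Real.exp (81 / 10 * logSize m n * ((∑ i, x i) / opt A)) ≤
      Real.exp (logSize m n) * Real.exp (81 / 100 * logSize m n) :=
    (mul_le_mul_of_nonneg_right h1.le (Real.exp_pos _).le).trans
      (hx.decay.trans (mul_le_mul_of_nonneg_right hm (Real.exp_pos _).le))
  rw [← Real.exp_add, ← Real.exp_add, Real.exp_le_exp] at h2
  unfold coverEta at h2
  have h3 : logSize m n * (81 / 10 * ((∑ i, x i) / opt A)) ≤ logSize m n * (1181 / 100) := by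
    linarith
  have h4 := le_of_mul_le_mul_left h3 (by linarith)
  have h5 : (∑ i, x i) / opt A ≤ 3 / 2 := by linarith
  rwa [div_le_iff₀ (by linarith)] at h5

theorem le_coverStep (h : IsCovering A) {η lam : ℝ} {x : Fin n → ℝ} (hx : ∀ i, 0 ≤ x i)
    (i : Fin n) : x i ≤ coverStep A η (coverBeta m n) lam x i ∧
      coverStep A η (coverBeta m n) lam x i ≤ x i * (1 + coverBeta m n) := by
  have h1 : x i ≤ x i * (1 + coverBeta m n) :=
    le_mul_of_one_le_right (hx i) (by linarith [h.coverBeta_pos])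
  unfold coverStep
  split_ifs
  · exact ⟨le_rfl, h1⟩
  · exact ⟨h1, le_rfl⟩

/-- A round keeps the invariant as long as no benefit exceeds the threshold by more than a constant
factor: by weak duality the growing variables then reduce the potential in proportion to
their cost. -/
theorem coverInv_step (h : IsCovering A) {x : Fin n → ℝ} (hx : CoverInv A x) {lam : ℝ}
    (hlam : 0 < lam) (hg : ∀ i, benefit A (coverEta m n) x i ≤ 11 / 10 * lam) :
    CoverInv A (coverStep A (coverEta m n) (coverBeta m n) lam x) := by
  have hx0 := hx.nonneg h
  have hη := h.coverEta_pos
  have hopt := h.one_le_opt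
  by_cases hact : ∃ j, (A *ᵥ x) j < 1
  swap
  · -- nothing is left to be done
    push Not at hact
    have : coverStep A (coverEta m n) (coverBeta m n) lam x = x := by
      funext i
      unfold coverStep
      rw [if_pos]
      have : benefit A (coverEta m n) x i = 0 := by
        unfold benefit
        refine Finset.sum_eq_zero fun j _ => ?_
        unfold rowWeight
        rw [if_neg (not_lt.2 (hact j)), mul_zero]
      rwa [this]
    rw [this]; exact hx
  obtain ⟨j₀, hj₀⟩ := hact
  have hcost := hx.cost_of_active h hj₀
  have hle := h.le_coverStep (η := coverEta m n) (lam := lam) hx0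
  obtain ⟨x', hx'⟩ : ∃ x', x' = coverStep A (coverEta m n) (coverBeta m n) lam x := ⟨_, rfl⟩
  rw [← hx'] at hle ⊢
  refine ⟨fun i => (hx.lower i).trans (hle i).1, ?_, ?_⟩
  · have h1 : ∑ i, x' i ≤ (∑ i, x i) * (1 + coverBeta m n) := by
      rw [Finset.sum_mul]; exact Finset.sum_le_sum fun i _ => (hle i).2
    have h2 : (∑ i, x i) * (1 + coverBeta m n) ≤ 3 / 2 * opt A * (4 / 3) :=
      mul_le_mul hcost (by linarith [h.coverBeta_le]) (by linarith [h.coverBeta_pos])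
        (by linarith)
    linarith
  · obtain ⟨d, hd⟩ : ∃ d : Fin n → ℝ, d = x' - x := ⟨_, rfl⟩
    have hd0 : ∀ i, 0 ≤ d i := fun i => by rw [hd]; exact sub_nonneg.2 (hle i).1
    have hAd : ∀ j, (A *ᵥ x') j = (A *ᵥ x) j + (A *ᵥ d) j := fun j => by
      rw [hd, Matrix.mulVec_sub, Pi.sub_apply]; ring
    have hAd0 : ∀ j, 0 ≤ (A *ᵥ d) j := h.mulVec_nonneg hd0
    have hAdx : ∀ j, (A *ᵥ d) j ≤ coverBeta m n * (A *ᵥ x) j := fun j => by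
      unfold Matrix.mulVec dotProduct
      rw [Finset.mul_sum]
      refine Finset.sum_le_sum fun i _ => ?_
      have : d i ≤ coverBeta m n * x i := by rw [hd]; simp only [Pi.sub_apply]; linarith [(hle i).2]
      have := mul_le_mul_of_nonneg_left this (h.nonneg j i)
      linarith
    have hpot : rowPotential A (coverEta m n) x' ≤ rowPotential A (coverEta m n) x -
        9 / 10 * (coverEta m n * ∑ i, benefit A (coverEta m n) x i * d i) := by
      rw [sum_benefit]
      unfold rowPotential
      rw [Finset.mul_sum, Finset.mul_sum, ← Finset.sum_sub_distrib]
      refine Finset.sum_le_sum fun j _ => ?_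
      rw [hAd]
      refine rowWeight_add_le (hAd0 j) (fun hj => ?_) hη.le
      have h1 : (A *ᵥ d) j ≤ coverBeta m n :=
        (hAdx j).trans (mul_le_of_le_one_right h.coverBeta_pos.le hj.le)
      have := mul_le_mul_of_nonneg_left h1 hη.le
      rwa [h.eta_mul_beta] at this
    have hben : lam * ∑ i, d i ≤ ∑ i, benefit A (coverEta m n) x i * d i := by
      rw [Finset.mul_sum]
      refine Finset.sum_le_sum fun i _ => ?_
      by_cases hi : benefit A (coverEta m n) x i < lam
      · have : d i = 0 := by
          rw [hd, hx']; simp [coverStep, hi]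
        rw [this]; simp
      · exact mul_le_mul_of_nonneg_right (not_lt.1 hi) (hd0 i)
    have hdual := h.rowPotential_le (by positivity) hg
    obtain ⟨Φ, hΦ⟩ : ∃ Φ, Φ = rowPotential A (coverEta m n) x := ⟨_, rfl⟩
    rw [← hΦ] at hpot hdual
    have hΦ0 : 0 ≤ Φ := by
      rw [hΦ]; exact Finset.sum_nonneg fun j _ => rowWeight_nonneg _ _
    have hsd : 0 ≤ ∑ i, d i := Finset.sum_nonneg fun i _ => hd0 i
    obtain ⟨s, hs⟩ : ∃ s, s = (∑ i, d i) / opt A := ⟨_, rfl⟩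
    have hs0 : 0 ≤ s := by rw [hs]; positivity
    have hds : ∑ i, d i = s * opt A := by rw [hs]; field_simp
    have h1 : Φ * s * (10 / 11) ≤ lam * ∑ i, d i := by
      rw [hds]
      have := mul_le_mul_of_nonneg_right hdual hs0
      linarith
    have h2 : rowPotential A (coverEta m n) x' ≤ Φ * (1 - 81 / 10 * logSize m n * s) := by
      have h3 := mul_le_mul_of_nonneg_left (h1.trans hben) hη.le
      obtain ⟨g, hgd⟩ : ∃ g, g = ∑ i, benefit A (coverEta m n) x i * d i := ⟨_, rfl⟩
      rw [← hgd] at h3 hpot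
      have h4 : coverEta m n = 10 * logSize m n := rfl
      have h6 : coverEta m n * (Φ * s * (10 / 11)) = 100 / 11 * (logSize m n * (Φ * s)) := by
        rw [h4]; ring
      have h5 : 0 ≤ logSize m n * (Φ * s) :=
        mul_nonneg (by linarith [h.logSize_lower]) (mul_nonneg hΦ0 hs0)
      linarith
    have h3 : rowPotential A (coverEta m n) x' ≤ Φ * Real.exp (-(81 / 10 * logSize m n * s)) := by
      refine h2.trans (mul_le_mul_of_nonneg_left ?_ hΦ0)
      linarith [Real.add_one_le_exp (-(81 / 10 * logSize m n * s))]
    have hsum : (∑ i, x' i) / opt A = (∑ i, x i) / opt A + s := by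
      rw [hs, ← add_div, hd, ← Finset.sum_add_distrib]
      simp
    rw [hsum, mul_add, Real.exp_add]
    have h4 : rowPotential A (coverEta m n) x' * Real.exp (81 / 10 * logSize m n * s) ≤ Φ := by
      have := mul_le_mul_of_nonneg_right h3 (Real.exp_pos (81 / 10 * logSize m n * s)).le
      rwa [mul_assoc Φ, ← Real.exp_add, neg_add_cancel, Real.exp_zero, mul_one] at this
    have h5 := hx.decay
    rw [← hΦ] at h5
    refine le_trans ?_ h5
    have := mul_le_mul_of_nonneg_right h4
      (Real.exp_pos (81 / 10 * logSize m n * ((∑ i, x i) / opt A))).le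
    linarith

/-- After a phase, all benefits are below the threshold of the phase: a variable with benefit above
it would have grown in all rounds, and its cost alone would exceed the total cost. -/
theorem coverPhase (h : IsCovering A) {x : Fin n → ℝ} (hx : CoverInv A x) {lam : ℝ}
    (hlam : 0 < lam) (hg : ∀ i, benefit A (coverEta m n) x i ≤ 11 / 10 * lam) :
    let y := (coverStep A (coverEta m n) (coverBeta m n) lam)^[coverRounds m n] x
    CoverInv A y ∧ ∀ i, benefit A (coverEta m n) y i ≤ lam := by
  intro y
  have hη := h.coverEta_pos
  have hβ := h.coverBeta_pos
  have key : ∀ r, CoverInv A ((coverStep A (coverEta m n) (coverBeta m n) lam)^[r] x) ∧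
      (∀ i, benefit A (coverEta m n)
        ((coverStep A (coverEta m n) (coverBeta m n) lam)^[r] x) i ≤ 11 / 10 * lam) ∧
      ∀ i, lam < benefit A (coverEta m n)
        ((coverStep A (coverEta m n) (coverBeta m n) lam)^[r] x) i →
        (coverStep A (coverEta m n) (coverBeta m n) lam)^[r] x i =
          x i * (1 + coverBeta m n) ^ r := by
    intro r
    induction r with
    | zero => exact ⟨hx, hg, fun i _ => by simp⟩
    | succ r ih =>
      rw [Function.iterate_succ_apply']
      obtain ⟨ih1, ih2, ih3⟩ := ih
      set w := (coverStep A (coverEta m n) (coverBeta m n) lam)^[r] x with hw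
      have hmono := h.benefit_anti hη.le fun i =>
        (h.le_coverStep (η := coverEta m n) (lam := lam) (ih1.nonneg h) i).1
      refine ⟨h.coverInv_step ih1 hlam ih2, fun i => (hmono i).trans (ih2 i), fun i hi => ?_⟩
      have h1 := hi.trans_le (hmono i)
      have h2 : coverStep A (coverEta m n) (coverBeta m n) lam w i =
          w i * (1 + coverBeta m n) := by
        unfold coverStep
        rw [if_neg (by linarith)]
      rw [h2, ih3 i h1, pow_succ]
      ring
  obtain ⟨k1, _, k3⟩ := key (coverRounds m n)
  refine ⟨k1, fun i => ?_⟩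
  by_contra hc
  push Not at hc
  have h1 := k3 i hc
  have hℓ := h.logSize_lower
  have hM := h.two_le_size
  have h2 : Real.exp (10 * logSize m n) ≤ (1 + coverBeta m n) ^ coverRounds m n := by
    have h3 : Real.exp (coverBeta m n / 2) ≤ 1 + coverBeta m n := by
      have hb1 := h.coverBeta_le
      have h3 : |coverBeta m n / 2| ≤ 1 := by
        rw [abs_of_nonneg (by linarith)]; linarith
      have h4 := (abs_le.1 (Real.abs_exp_sub_one_sub_id_le h3)).2
      nlinarith
    refine le_trans ?_ (pow_le_pow_left₀ (Real.exp_pos _).le h3 _)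
    rw [← Real.exp_nat_mul, Real.exp_le_exp]
    have h4 : 2000 * (logSize m n * logSize m n) ≤ (coverRounds m n : ℝ) := Nat.le_ceil _
    have h5 := mul_le_mul_of_nonneg_right h4 (by linarith : 0 ≤ coverBeta m n / 2)
    refine le_trans (le_of_eq ?_) h5
    unfold coverBeta
    field_simp; norm_num
  have h3 : (2 : ℝ) ^ 8 * ((n + m) * (n + m)) ≤ Real.exp (10 * logSize m n) := by
    have : Real.exp (10 * logSize m n) = ((n : ℝ) + m) ^ 10 := by
      rw [← h.exp_logSize, ← Real.exp_nat_mul]; norm_num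
    rw [this]
    have h4 : (2 : ℝ) ^ 8 ≤ ((n : ℝ) + m) ^ 8 := pow_le_pow_left₀ (by norm_num) hM 8
    have h5 := mul_le_mul_of_nonneg_right h4 (by positivity : 0 ≤ ((n : ℝ) + m) * (n + m))
    refine h5.trans (le_of_eq ?_)
    ring
  have h4 : y i ≤ 2 * n := by
    calc y i ≤ ∑ i, y i :=
          Finset.single_le_sum (f := y) (fun i _ => k1.nonneg h i) (Finset.mem_univ i)
      _ ≤ 2 * opt A := k1.cost
      _ ≤ 2 * n := by linarith [h.opt_le_n]
  have h5 : 1 / (10 * ((n : ℝ) + m)) * (2 ^ 8 * ((n + m) * (n + m))) ≤ y i := by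
    change _ ≤ (coverStep A (coverEta m n) (coverBeta m n) lam)^[coverRounds m n] x i
    rw [h1]
    exact mul_le_mul (hx.lower i) (h3.trans h2) (by positivity) (hx.nonneg h i)
  have h6 : 1 / (10 * ((n : ℝ) + m)) * (2 ^ 8 * ((n + m) * (n + m))) =
      2 ^ 8 / 10 * ((n : ℝ) + m) := by field_simp
  rw [h6] at h5
  have : (0 : ℝ) < m := by exact_mod_cast h.m_pos
  have : (0 : ℝ) < n := by exact_mod_cast h.n_pos
  linarith

/-- Initially every benefit is below the first threshold, since an unsatisfied row has entries of at
most `10 (n + m)`. -/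
theorem coverRun_spec (h : IsCovering A) (t : ℕ) : CoverInv A (coverRun A t) ∧
    ∀ i, benefit A (coverEta m n) (coverRun A t) i ≤ 11 / 10 * coverThreshold m n t := by
  have hM := h.two_le_size
  have hM0 : (0 : ℝ) < n + m := by linarith
  have hη := h.coverEta_pos
  induction t with
  | zero =>
    have hx0 : ∀ i, 0 ≤ coverRun A 0 i := fun i => by
      unfold coverRun; positivity
    have hAx0 : ∀ j, 0 ≤ (A *ᵥ coverRun A 0) j := h.mulVec_nonneg hx0
    have hcost : ∑ i, coverRun A 0 i ≤ 1 / 10 := by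
      simp only [coverRun, Finset.sum_const, Finset.card_univ, Fintype.card_fin, nsmul_eq_mul]
      rw [mul_one_div, div_le_iff₀ (by positivity)]
      linarith [(Nat.cast_nonneg m : (0 : ℝ) ≤ m)]
    have hopt := h.one_le_opt
    refine ⟨⟨fun i => le_rfl, by linarith, ?_⟩, fun i => ?_⟩
    · have h1 : rowPotential A (coverEta m n) (coverRun A 0) ≤ m := by
        calc rowPotential A (coverEta m n) (coverRun A 0) ≤ ∑ _j : Fin m, (1 : ℝ) :=
              Finset.sum_le_sum fun j _ => rowWeight_le_one hη.le (hAx0 j)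
          _ = m := by simp
      refine mul_le_mul h1 (Real.exp_le_exp.2 ?_) (Real.exp_pos _).le (by positivity)
      have h2 : (∑ i, coverRun A 0 i) / opt A ≤ 1 / 10 := by
        rw [div_le_iff₀ (by linarith)]; linarith
      have := mul_le_mul_of_nonneg_left h2
        (by linarith [h.logSize_lower] : 0 ≤ 81 / 10 * logSize m n)
      linarith
    · have h1 : benefit A (coverEta m n) (coverRun A 0) i ≤ ∑ _j : Fin m, 10 * ((n : ℝ) + m) := by
        refine Finset.sum_le_sum fun j _ => ?_
        by_cases hj : (A *ᵥ coverRun A 0) j < 1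
        · have h2 : A j i * coverRun A 0 i ≤ (A *ᵥ coverRun A 0) j :=
            Finset.single_le_sum (f := fun i => A j i * coverRun A 0 i)
              (fun i _ => mul_nonneg (h.nonneg j i) (hx0 i)) (Finset.mem_univ i)
          have h3 : A j i * (1 / (10 * ((n : ℝ) + m))) < 1 := h2.trans_lt hj
          rw [mul_one_div, div_lt_one (by positivity)] at h3
          calc A j i * rowWeight (coverEta m n) ((A *ᵥ coverRun A 0) j) ≤ A j i * 1 :=
                mul_le_mul_of_nonneg_left (rowWeight_le_one hη.le (hAx0 j)) (h.nonneg j i)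
            _ ≤ _ := by linarith
        · unfold rowWeight
          rw [if_neg hj, mul_zero]
          positivity
      refine h1.trans ?_
      simp only [Finset.sum_const, Finset.card_univ, Fintype.card_fin, nsmul_eq_mul]
      unfold coverThreshold
      have h2 : (m : ℝ) * (n + m) ≤ (n + m) * (n + m) :=
        mul_le_mul_of_nonneg_right (by linarith [(Nat.cast_nonneg n : (0 : ℝ) ≤ n)]) hM0.le
      have h3 : 0 < ((n : ℝ) + m) * (n + m) := by positivity
      linarith
  | succ t ih =>
    obtain ⟨h1, h2⟩ := h.coverPhase ih.1 (h.coverThreshold_pos t) ih.2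
    refine ⟨h1, fun i => (h2 i).trans (le_of_eq ?_)⟩
    unfold coverThreshold
    rw [pow_succ]; ring

/-- After the last phase the benefits are so small that the potential is below the weight of a
single unsatisfied row. -/
theorem cover_solution (h : IsCovering A) :
    let x := coverRun A (coverPhases m n)
    (∀ i, 0 ≤ x i) ∧ (∀ j, 1 ≤ (A *ᵥ x) j) ∧ ∑ i, x i ≤ 2 * opt A := by
  intro x
  obtain ⟨h1, h2⟩ := h.coverRun_spec (coverPhases m n)
  have hM := h.two_le_size
  have hℓ := h.logSize_lower
  refine ⟨h1.nonneg h, fun j => ?_, h1.cost⟩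
  by_contra hc
  push Not at hc
  have h3 := exp_lt_rowPotential h.coverEta_pos hc
  have h4 := h.rowPotential_le (mul_pos (by norm_num) (h.coverThreshold_pos _)) h2
  have h5 : ((10 : ℝ) / 11) ^ coverPhases m n ≤ Real.exp (-(18 * logSize m n)) := by
    have h6 : (10 : ℝ) / 11 ≤ Real.exp (-(1 / 11)) := by
      linarith [Real.add_one_le_exp (-(1 / 11) : ℝ)]
    refine (pow_le_pow_left₀ (by norm_num) h6 _).trans ?_
    rw [← Real.exp_nat_mul, Real.exp_le_exp]
    have h7 : 200 * logSize m n ≤ (coverPhases m n : ℝ) := Nat.le_ceil _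
    linarith
  have h6 : 11 / 10 * coverThreshold m n (coverPhases m n) * opt A ≤
      Real.exp (-coverEta m n) := by
    have e0 : coverThreshold m n (coverPhases m n) ≤
        10 * ((n + m) * (n + m)) * Real.exp (-(18 * logSize m n)) :=
      mul_le_mul_of_nonneg_left h5 (by positivity)
    have e1 : opt A ≤ n + m := by
      linarith [h.opt_le_n, (Nat.cast_nonneg m : (0 : ℝ) ≤ m)]
    have e2 : 11 / 10 * coverThreshold m n (coverPhases m n) * opt A ≤
        11 / 10 * (10 * ((n + m) * (n + m)) * Real.exp (-(18 * logSize m n))) * (n + m) :=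
      mul_le_mul (mul_le_mul_of_nonneg_left e0 (by norm_num)) e1
        (by linarith [h.one_le_opt]) (by positivity)
    refine e2.trans ?_
    have e3 : Real.exp (-coverEta m n) =
        Real.exp (8 * logSize m n) * Real.exp (-(18 * logSize m n)) := by
      rw [← Real.exp_add]; congr 1; unfold coverEta; ring
    have e4 : Real.exp (8 * logSize m n) = ((n : ℝ) + m) ^ 8 := by
      rw [← h.exp_logSize, ← Real.exp_nat_mul]; norm_num
    rw [e3, e4]
    have e5 : 11 / 10 * (10 * (((n : ℝ) + m) * (n + m)) * Real.exp (-(18 * logSize m n))) *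
        (n + m) = 11 * ((n : ℝ) + m) ^ 3 * Real.exp (-(18 * logSize m n)) := by ring
    rw [e5]
    refine mul_le_mul_of_nonneg_right ?_ (Real.exp_pos _).le
    have e6 : (2 : ℝ) ^ 5 ≤ ((n : ℝ) + m) ^ 5 := pow_le_pow_left₀ (by norm_num) hM 5
    have e7 : ((n : ℝ) + m) ^ 8 = ((n : ℝ) + m) ^ 5 * ((n : ℝ) + m) ^ 3 := by ring
    rw [e7]
    refine mul_le_mul_of_nonneg_right ?_ (by positivity)
    linarith
  linarith

end IsCovering

/-! ### A program logic with time bounds -/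

/-- The program `c`, started in `s` with draws `ds`, halts within `T` steps in a memory
satisfying `Q`. -/
def Halts (c : Cmd) (s : Mem) (ds : List (ℕ × ℕ)) (T : ℕ) (Q : Mem → Prop) : Prop :=
  ∃ s' t, Exec c s ds s' t ∧ t ≤ T ∧ Q s'

/-- `c` contains no assignment to integer array `a`. -/
def Cmd.keepsNat (a : ℕ) : Cmd → Bool
  | .skip => true
  | .setNat b _ _ => b != a
  | .setReal _ _ _ => true
  | .rand b _ _ => b != a
  | .seq c c' => c.keepsNat a && c'.keepsNat a
  | .ite _ c c' => c.keepsNat a && c'.keepsNat a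
  | .while _ c => c.keepsNat a

/-- `c` contains no assignment to real array `a`. -/
def Cmd.keepsReal (a : ℕ) : Cmd → Bool
  | .skip => true
  | .setNat _ _ _ => true
  | .setReal b _ _ => b != a
  | .rand _ _ _ => true
  | .seq c c' => c.keepsReal a && c'.keepsReal a
  | .ite _ c c' => c.keepsReal a && c'.keepsReal a
  | .while _ c => c.keepsReal a

/-- The memories agree on all arrays to which `c` does not assign. -/
structure Frame (c : Cmd) (s s' : Mem) : Prop where
  nat : ∀ a, c.keepsNat a = true → s'.nat a = s.nat a
  real : ∀ a, c.keepsReal a = true → s'.real a = s.real a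

theorem Frame.refl (c : Cmd) (s : Mem) : Frame c s s := ⟨fun _ _ => rfl, fun _ _ => rfl⟩

theorem Frame.trans {c : Cmd} {s s' s'' : Mem} (h : Frame c s s') (h' : Frame c s' s'') :
    Frame c s s'' :=
  ⟨fun a ha => (h'.nat a ha).trans (h.nat a ha), fun a ha => (h'.real a ha).trans (h.real a ha)⟩

theorem Mem.setNat_nat (s : Mem) (a i v b : ℕ) :
    (s.setNat a i v).nat b = if b = a then Function.update (s.nat a) i v else s.nat b := by
  unfold Mem.setNat
  simp only [Function.update_apply]

theorem Mem.setNat_real (s : Mem) (a i v : ℕ) : (s.setNat a i v).real = s.real := rfl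

theorem Mem.setReal_real (s : Mem) (a i : ℕ) (v : ℝ) (b : ℕ) :
    (s.setReal a i v).real b = if b = a then Function.update (s.real a) i v else s.real b := by
  unfold Mem.setReal
  simp only [Function.update_apply]

theorem Mem.setReal_nat (s : Mem) (a i : ℕ) (v : ℝ) : (s.setReal a i v).nat = s.nat := rfl

theorem Exec.frame {c : Cmd} {s s' : Mem} {ds : List (ℕ × ℕ)} {t : ℕ} (h : Exec c s ds s' t) :
    Frame c s s' := by
  have hmono : ∀ {c c' : Cmd} {s s' : Mem}, Frame c s s' →
      (∀ a, c'.keepsNat a = true → c.keepsNat a = true) →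
      (∀ a, c'.keepsReal a = true → c.keepsReal a = true) → Frame c' s s' :=
    fun h h1 h2 => ⟨fun a ha => h.nat a (h1 a ha), fun a ha => h.real a (h2 a ha)⟩
  induction h with
  | skip s => exact Frame.refl _ _
  | setNat a i e s =>
    refine ⟨fun b hb => ?_, fun b _ => rfl⟩
    rw [Mem.setNat_nat, if_neg]
    rintro rfl
    simp [Cmd.keepsNat] at hb
  | setReal a i r s =>
    refine ⟨fun b _ => rfl, fun b hb => ?_⟩
    rw [Mem.setReal_real, if_neg]
    rintro rfl
    simp [Cmd.keepsReal] at hb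
  | rand a i b s d hd =>
    refine ⟨fun b hb => ?_, fun b _ => rfl⟩
    rw [Mem.setNat_nat, if_neg]
    rintro rfl
    simp [Cmd.keepsNat] at hb
  | seq _ _ ih ih' =>
    refine Frame.trans (hmono ih ?_ ?_) (hmono ih' ?_ ?_) <;>
    · intro a ha
      simp only [Cmd.keepsNat, Cmd.keepsReal, Bool.and_eq_true] at ha
      first | exact ha.1 | exact ha.2
  | ite_true _ _ ih =>
    refine hmono ih ?_ ?_ <;>
    · intro a ha
      simp only [Cmd.keepsNat, Cmd.keepsReal, Bool.and_eq_true] at ha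
      exact ha.1
  | ite_false _ _ ih =>
    refine hmono ih ?_ ?_ <;>
    · intro a ha
      simp only [Cmd.keepsNat, Cmd.keepsReal, Bool.and_eq_true] at ha
      exact ha.2
  | while_true _ _ _ ih ih' => exact Frame.trans (hmono ih (fun _ h => h) (fun _ h => h)) ih'
  | while_false _ => exact Frame.refl _ _

theorem Halts.mono {c : Cmd} {s : Mem} {ds : List (ℕ × ℕ)} {T T' : ℕ} {Q Q' : Mem → Prop}
    (h : Halts c s ds T Q) (hT : T ≤ T') (hQ : ∀ s', Frame c s s' → Q s' → Q' s') :
    Halts c s ds T' Q' := by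
  obtain ⟨s', t, h1, h2, h3⟩ := h
  exact ⟨s', t, h1, h2.trans hT, hQ s' h1.frame h3⟩

theorem Halts.seq {c c' : Cmd} {s : Mem} {ds ds' : List (ℕ × ℕ)} {T T' : ℕ} {P Q : Mem → Prop}
    (h : Halts c s ds T P) (h' : ∀ s', Frame c s s' → P s' → Halts c' s' ds' T' Q) :
    Halts (.seq c c') s (ds ++ ds') (T + T') Q := by
  obtain ⟨s', t, h1, h2, h3⟩ := h
  obtain ⟨s'', t', h4, h5, h6⟩ := h' s' h1.frame h3
  exact ⟨s'', t + t', h1.seq h4, by omega, h6⟩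

/-- Sequential composition without draws in the first program. Since the time bounds add up, proofs
about composed programs first bring the bound to the form of a sum with one summand for
each component. -/
theorem Halts.seq' {c c' : Cmd} {s : Mem} {ds : List (ℕ × ℕ)} {T T' : ℕ} {P Q : Mem → Prop}
    (h : Halts c s [] T P) (h' : ∀ s', Frame c s s' → P s' → Halts c' s' ds T' Q) :
    Halts (.seq c c') s ds (T + T') Q := by
  simpa using Halts.seq h h'

/-- The effect of a program without loops and draws. -/
def Cmd.eff : Cmd → Mem → Mem
  | .skip, s => s
  | .setNat a i e, s => s.setNat a (i.eval s) (e.eval s)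
  | .setReal a i r, s => s.setReal a (i.eval s) (r.eval s)
  | .rand _ _ _, s => s
  | .seq c c', s => c'.eff (c.eff s)
  | .ite b c c', s => open Classical in if b.holds s then c.eff s else c'.eff s
  | .while _ _, s => s

/-- The program has no loops and no draws. -/
def Cmd.straight : Cmd → Bool
  | .skip => true
  | .setNat _ _ _ => true
  | .setReal _ _ _ => true
  | .rand _ _ _ => false
  | .seq c c' => c.straight && c'.straight
  | .ite _ c c' => c.straight && c'.straight
  | .while _ _ => false

/-- Bound for the running time of a program without loops and draws. -/
def Cmd.time : Cmd → ℕ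
  | .skip => 1
  | .setNat _ i e => i.cost + e.cost + 1
  | .setReal _ i r => i.cost + r.cost + 1
  | .rand _ _ _ => 0
  | .seq c c' => c.time + c'.time
  | .ite b c c' => b.cost + (c.time + c'.time)
  | .while _ _ => 0

theorem Cmd.exec_straight (c : Cmd) (hc : c.straight = true) (s : Mem) :
    ∃ t, Exec c s [] (c.eff s) t ∧ t ≤ c.time := by
  induction c generalizing s with
  | skip => exact ⟨_, Exec.skip s, le_rfl⟩
  | setNat a i e => exact ⟨_, Exec.setNat a i e s, le_rfl⟩
  | setReal a i r => exact ⟨_, Exec.setReal a i r s, le_rfl⟩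
  | seq c c' ih ih' =>
    simp only [Cmd.straight, Bool.and_eq_true] at hc
    obtain ⟨t, h1, h2⟩ := ih hc.1 s
    obtain ⟨t', h3, h4⟩ := ih' hc.2 (c.eff s)
    exact ⟨t + t', h1.seq h3, Nat.add_le_add h2 h4⟩
  | ite b c c' ih ih' =>
    simp only [Cmd.straight, Bool.and_eq_true] at hc
    by_cases hb : b.holds s
    · obtain ⟨t, h1, h2⟩ := ih hc.1 s
      refine ⟨b.cost + t, ?_, by simp only [Cmd.time]; omega⟩
      simp only [Cmd.eff, if_pos hb]
      exact Exec.ite_true hb h1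
    · obtain ⟨t, h1, h2⟩ := ih' hc.2 s
      refine ⟨b.cost + t, ?_, by simp only [Cmd.time]; omega⟩
      simp only [Cmd.eff, if_neg hb]
      exact Exec.ite_false hb h1
  | _ => simp [Cmd.straight] at hc

theorem Halts.straight {c : Cmd} {s : Mem} {T : ℕ} {Q : Mem → Prop} (hc : c.straight = true)
    (hT : c.time ≤ T) (h : Q (c.eff s)) : Halts c s [] T Q := by
  obtain ⟨t, h1, h2⟩ := c.exec_straight hc s
  exact ⟨_, t, h1, h2.trans hT, h⟩

theorem Halts.rand {a : ℕ} {i b : NExp} {s : Mem} {B d T : ℕ} {Q : Mem → Prop}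
    (hB : b.eval s = B) (hd : d < B) (hT : i.cost + b.cost + 1 ≤ T)
    (h : Q (s.setNat a (i.eval s) d)) : Halts (.rand a i b) s [(B, d)] T Q := by
  subst hB
  exact ⟨_, _, Exec.rand a i b s d hd, hT, h⟩

/-- The value of a scalar integer variable. -/
def nv (a : ℕ) : NExp := .get a (.const 0)

/-- The value of a scalar real variable. -/
def rv (a : ℕ) : RExp := .get a (.const 0)

/-- `for (v := a; b; v := v + 1) body`. -/
def forLoop (v : ℕ) (a : NExp) (b : BExp) (body : Cmd) : Cmd :=
  .seq (.setNat v (.const 0) a)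
    (.while b (.seq body (.setNat v (.const 0) (.plus (nv v) (.const 1)))))

/-- The rule for counting loops, with an invariant `I` and draws `ds k` in the round with
counter `k`. -/
theorem halts_forLoop_draws {v : ℕ} {a : NExp} {b : BExp} {body : Cmd} {s : Mem} (lo hi : ℕ)
    (T : ℕ → ℕ) (ds : ℕ → List (ℕ × ℕ)) (I : ℕ → Mem → Prop) (hlo : a.eval s = lo)
    (hle : lo ≤ hi) (hv : body.keepsNat v = true)
    (hb : ∀ k s', lo ≤ k → k ≤ hi → Frame (forLoop v a b body) s s' → s'.nat v 0 = k → I k s' →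
      (b.holds s' ↔ k < hi))
    (hI : ∀ k s' k', I k s' → I k (s'.setNat v 0 k'))
    (h0 : I lo s)
    (step : ∀ k s', lo ≤ k → k < hi → Frame (forLoop v a b body) s s' → s'.nat v 0 = k → I k s' →
      Halts body s' (ds k) (T k) (I (k + 1))) :
    Halts (forLoop v a b body) s ((List.range' lo (hi - lo)).flatMap ds)
      (∑ k ∈ Finset.Ico lo hi, (T k + b.cost + 6) + (a.cost + b.cost + 2))
      (fun s' => I hi s' ∧ s'.nat v 0 = hi) := by
  have hset : Exec (.setNat v (.const 0) a) s [] (s.setNat v 0 lo) (a.cost + 2) := by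
    have := Exec.setNat v (.const 0) a s
    rw [hlo] at this
    have e : (NExp.const 0).cost + a.cost + 1 = a.cost + 2 := by simp only [NExp.cost]; omega
    rwa [e] at this
  have hframe0 : Frame (forLoop v a b body) s (s.setNat v 0 lo) := by
    have := hset.frame
    refine ⟨fun b hb => this.nat b ?_, fun b hb => rfl⟩
    simp only [forLoop, Cmd.keepsNat, Bool.and_eq_true] at hb ⊢
    exact hb.1
  have main : ∀ d k s', k + d = hi → lo ≤ k → Frame (forLoop v a b body) s s' → s'.nat v 0 = k →
      I k s' → ∃ s'' t, Exec (.while b (.seq body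
        (.setNat v (.const 0) (.plus (nv v) (.const 1))))) s'
        ((List.range' k d).flatMap ds) s'' t ∧
        t ≤ ∑ k ∈ Finset.Ico k hi, (T k + b.cost + 6) + b.cost ∧ (I hi s'' ∧ s''.nat v 0 = hi) := by
    intro d
    induction d with
    | zero =>
      intro k s' hk hlk hf hvk hIk
      have hk' : k = hi := by omega
      subst hk'
      have hnb : ¬ b.holds s' := fun h => by
        have := (hb k s' hlk le_rfl hf hvk hIk).1 h
        omega
      exact ⟨s', b.cost, by simpa using Exec.while_false hnb, by simp, hIk, hvk⟩
    | succ d ih =>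
      intro k s' hk hlk hf hvk hIk
      have hkh : k < hi := by omega
      have hbt : b.holds s' := (hb k s' hlk hkh.le hf hvk hIk).2 hkh
      obtain ⟨s₁, t₁, e₁, ht₁, hI₁⟩ := step k s' hlk hkh hf hvk hIk
      have hv₁ : s₁.nat v 0 = k := by rw [e₁.frame.nat v hv, hvk]
      have e₂ : Exec (.setNat v (.const 0) (.plus (nv v) (.const 1))) s₁ []
          (s₁.setNat v 0 (k + 1)) 6 := by
        have := Exec.setNat v (.const 0) (.plus (nv v) (.const 1)) s₁
        simpa [NExp.eval, NExp.cost, nv, hv₁] using this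
      have e₃ := e₁.seq e₂
      rw [List.append_nil] at e₃
      have hf₃ : Frame (forLoop v a b body) s (s₁.setNat v 0 (k + 1)) := by
        refine hf.trans ⟨fun b hb => e₃.frame.nat b ?_, fun b hb => e₃.frame.real b ?_⟩
        · simp only [forLoop, Cmd.keepsNat, Bool.and_eq_true] at hb ⊢
          exact hb.2
        · simp only [forLoop, Cmd.keepsReal, Bool.and_eq_true] at hb ⊢
          exact hb.2
      obtain ⟨s₂, t₂, e₄, ht₂, hI₂⟩ := ih (k + 1) (s₁.setNat v 0 (k + 1)) (by omega) (by omega) hf₃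
        (by simp [Mem.setNat_nat]) (hI _ _ _ hI₁)
      refine ⟨s₂, b.cost + (t₁ + 6) + t₂, ?_, ?_, hI₂⟩
      · rw [List.range'_succ, List.flatMap_cons]
        exact Exec.while_true hbt e₃ e₄
      · rw [← Finset.sum_Ioo_add_eq_sum_Ico hkh]
        have : Finset.Ioo k hi = Finset.Ico (k + 1) hi := by ext; simp
        rw [this]
        omega
  obtain ⟨s₂, t₂, e, ht, hI₂⟩ := main (hi - lo) lo (s.setNat v 0 lo) (by omega) le_rfl hframe0
    (by simp [Mem.setNat_nat]) (hI _ _ _ h0)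
  exact ⟨s₂, a.cost + 2 + t₂, hset.seq e, by omega, hI₂⟩

/-- The rule for counting loops without draws. -/
theorem halts_forLoop {v : ℕ} {a : NExp} {b : BExp} {body : Cmd} {s : Mem} (lo hi : ℕ)
    (T : ℕ → ℕ) (I : ℕ → Mem → Prop) (hlo : a.eval s = lo)
    (hle : lo ≤ hi) (hv : body.keepsNat v = true)
    (hb : ∀ k s', lo ≤ k → k ≤ hi → Frame (forLoop v a b body) s s' → s'.nat v 0 = k → I k s' →
      (b.holds s' ↔ k < hi))
    (hI : ∀ k s' k', I k s' → I k (s'.setNat v 0 k'))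
    (h0 : I lo s)
    (step : ∀ k s', lo ≤ k → k < hi → Frame (forLoop v a b body) s s' → s'.nat v 0 = k → I k s' →
      Halts body s' [] (T k) (I (k + 1))) :
    Halts (forLoop v a b body) s []
      (∑ k ∈ Finset.Ico lo hi, (T k + b.cost + 6) + (a.cost + b.cost + 2)) (I hi) := by
  have := halts_forLoop_draws lo hi T (fun _ => []) I hlo hle hv hb hI h0 step
  have e : (List.range' lo (hi - lo)).flatMap (fun _ => ([] : List (ℕ × ℕ))) = [] := by simp
  rw [e] at this
  exact this.mono le_rfl fun _ _ h => h.1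

/-- The rule for counting loops whose rounds have a common time bound. -/
theorem halts_forLoop_const {v : ℕ} {a : NExp} {b : BExp} {body : Cmd} {s : Mem} (lo hi : ℕ)
    (T : ℕ) (I : ℕ → Mem → Prop) (hlo : a.eval s = lo)
    (hle : lo ≤ hi) (hv : body.keepsNat v = true)
    (hb : ∀ k s', lo ≤ k → k ≤ hi → Frame (forLoop v a b body) s s' → s'.nat v 0 = k →
      I k s' → (b.holds s' ↔ k < hi))
    (hI : ∀ k s' k', I k s' → I k (s'.setNat v 0 k'))
    (h0 : I lo s)
    (step : ∀ k s', lo ≤ k → k < hi → Frame (forLoop v a b body) s s' → s'.nat v 0 = k →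
      I k s' → Halts body s' [] T (I (k + 1))) :
    Halts (forLoop v a b body) s []
      ((hi - lo) * (T + b.cost + 6) + (a.cost + b.cost + 2)) (I hi) := by
  have := halts_forLoop lo hi (fun _ => T) I hlo hle hv hb hI h0 step
  simpa using this

/-! ### Sparse columns -/

/-- The arrays `ptr`, `idx`, `val` hold the matrix `B` in sparse column format. -/
structure Sparse {m n : ℕ} (B : Matrix (Fin m) (Fin n) ℝ) (ptr idx : ℕ → ℕ) (val : ℕ → ℝ) :
    Prop where
  ptr_zero : ptr 0 = 0
  ptr_mono : ∀ i < n, ptr i ≤ ptr (i + 1)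
  index : ∀ i : Fin n, Set.BijOn idx (Set.Ico (ptr i) (ptr (i + 1)))
    {j | ∃ j' : Fin m, B j' i ≠ 0 ∧ j = (j' : ℕ)}
  value : ∀ (i : Fin n) (e : ℕ), ptr i ≤ e → e < ptr (i + 1) →
    ∀ j : Fin m, idx e = (j : ℕ) → val e = B j i

namespace Sparse
variable {m n : ℕ} {B : Matrix (Fin m) (Fin n) ℝ} {ptr idx : ℕ → ℕ} {val : ℕ → ℝ}

theorem entry (h : Sparse B ptr idx val) (i : Fin n) {e : ℕ} (h1 : ptr i ≤ e)
    (h2 : e < ptr (i + 1)) : ∃ j : Fin m, idx e = j ∧ val e = B j i ∧ B j i ≠ 0 := by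
  obtain ⟨j, hj, hje⟩ := (h.index i).mapsTo ⟨h1, h2⟩
  exact ⟨j, hje, h.value i e h1 h2 j hje, hj⟩

theorem exists_entry (h : Sparse B ptr idx val) (i : Fin n) {j : Fin m} (hj : B j i ≠ 0) :
    ∃ e, ptr i ≤ e ∧ e < ptr (i + 1) ∧ idx e = j ∧ val e = B j i := by
  obtain ⟨e, he, hje⟩ := (h.index i).surjOn ⟨j, hj, rfl⟩
  exact ⟨e, he.1, he.2, hje, h.value i e he.1 he.2 j hje⟩

/-- A sum over the stored entries of a column. -/
theorem sum_col (h : Sparse B ptr idx val) (i : Fin n) {M : Type*} [AddCommMonoid M]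
    (g : ℕ → ℝ → M) :
    ∑ e ∈ Finset.Ico (ptr i) (ptr (i + 1)), g (idx e) (val e) =
      ∑ j : Fin m with B j i ≠ 0, g j (B j i) := by
  symm
  choose! f hf using fun j => h.exists_entry i (j := j)
  refine Finset.sum_bij (fun j _ => f j) ?_ ?_ ?_ ?_
  · intro j hj
    have := hf j (Finset.mem_filter.1 hj).2
    exact Finset.mem_Ico.2 ⟨this.1, this.2.1⟩
  · intro j hj j' hj' e
    have h1 := hf j (Finset.mem_filter.1 hj).2
    have h2 := hf j' (Finset.mem_filter.1 hj').2
    rw [e] at h1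
    exact Fin.ext (h1.2.2.1.symm.trans h2.2.2.1)
  · intro e he
    obtain ⟨h1, h2⟩ := Finset.mem_Ico.1 he
    obtain ⟨j, hj, _, hj0⟩ := h.entry i h1 h2
    have h3 := hf j hj0
    refine ⟨j, Finset.mem_filter.2 ⟨Finset.mem_univ _, hj0⟩, ?_⟩
    exact (h.index i).injOn ⟨h3.1, h3.2.1⟩ ⟨h1, h2⟩ (h3.2.2.1.trans hj.symm)
  · intro j hj
    have := hf j (Finset.mem_filter.1 hj).2
    rw [this.2.2.1, this.2.2.2]

/-- Column sums in which the entries enter linearly. -/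
theorem sum_col_mul (h : Sparse B ptr idx val) (i : Fin n) (g : ℕ → ℝ) :
    ∑ e ∈ Finset.Ico (ptr i) (ptr (i + 1)), val e * g (idx e) = ∑ j : Fin m, B j i * g j := by
  rw [h.sum_col i fun j b => b * g j]
  refine Finset.sum_filter_of_ne fun j _ hj => ?_
  exact left_ne_zero_of_mul hj

theorem sum_row (h : Sparse B ptr idx val) (i : Fin n) (j : Fin m) :
    ∑ e ∈ Finset.Ico (ptr i) (ptr (i + 1)), (if idx e = j then val e else 0) = B j i := by
  have := h.sum_col_mul i fun j' => if j' = j then 1 else 0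
  simp only [mul_ite, mul_one, mul_zero] at this
  rw [this, Finset.sum_eq_single j]
  · simp
  · intro j' _ hne
    rw [if_neg]
    exact fun e => hne (Fin.ext e)
  · simp

/-- The number of non-zero entries of column `i`. -/
theorem card_col (h : Sparse B ptr idx val) (i : Fin n) :
    ptr (i + 1) - ptr i = (Finset.univ.filter fun j => B j i ≠ 0).card := by
  have := h.sum_col i fun _ _ => 1
  simpa using this

end Sparse

theorem nnz_eq_sum {m n : ℕ} (B : Matrix (Fin m) (Fin n) ℝ) :
    nnz B = ∑ i, (Finset.univ.filter fun j => B j i ≠ 0).card := by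
  unfold nnz
  rw [Nat.card_eq_fintype_card, Fintype.card_subtype]
  simp only [Finset.card_filter]
  rw [Fintype.sum_prod_type, Finset.sum_comm]

namespace Sparse
variable {m n : ℕ} {B : Matrix (Fin m) (Fin n) ℝ} {ptr idx : ℕ → ℕ} {val : ℕ → ℝ}

theorem sum_ptr (h : Sparse B ptr idx val) : ∑ i ∈ Finset.range n, (ptr (i + 1) - ptr i) =
    nnz B := by
  rw [nnz_eq_sum, Finset.sum_range]
  exact Finset.sum_congr rfl fun i _ => h.card_col i

end Sparse

theorem IsInput.sparse {m n : ℕ} {A : Matrix (Fin m) (Fin n) ℝ} {ε : ℝ} {s : Mem}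
    (h : IsInput A ε s) : Sparse A (s.nat 1) (s.nat 2) (s.real 1) :=
  ⟨h.ptr_zero, h.ptr_mono, h.index, h.value⟩

/-! ### Loops over columns and matrix-vector products -/

attribute [simp] NExp.eval RExp.eval BExp.holds NExp.cost RExp.cost BExp.cost nv rv Cmd.eff
  Mem.setNat_nat Mem.setNat_real Mem.setReal_nat Mem.setReal_real Cmd.keepsNat Cmd.keepsReal
  Cmd.straight Cmd.time

@[simp] theorem keepsNat_forLoop (c : ℕ) (v : ℕ) (a : NExp) (b : BExp) (body : Cmd) :
    (forLoop v a b body).keepsNat c = (v != c && body.keepsNat c) := by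
  simp [forLoop, Bool.and_comm]

@[simp] theorem keepsReal_forLoop (c : ℕ) (v : ℕ) (a : NExp) (b : BExp) (body : Cmd) :
    (forLoop v a b body).keepsReal c = body.keepsReal c := by
  simp [forLoop, Bool.and_comm]

/-- `for (v := 0; v < bound; v := v + 1) body`. -/
def forN (v : ℕ) (bound : NExp) (body : Cmd) : Cmd :=
  forLoop v (.const 0) (.natLt (nv v) bound) body

@[simp] theorem keepsNat_forN (c : ℕ) (v : ℕ) (b : NExp) (body : Cmd) :
    (forN v b body).keepsNat c = (v != c && body.keepsNat c) := by
  simp [forN]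

@[simp] theorem keepsReal_forN (c : ℕ) (v : ℕ) (b : NExp) (body : Cmd) :
    (forN v b body).keepsReal c = body.keepsReal c := by
  simp [forN]

theorem halts_forN {v : ℕ} {bound : NExp} {body : Cmd} {s : Mem} (K : ℕ)
    (T : ℕ → ℕ) (I : ℕ → Mem → Prop) (hv : body.keepsNat v = true) (hc : bound.cost = 2)
    (hb : ∀ s', Frame (forN v bound body) s s' → bound.eval s' = K)
    (hI : ∀ k s' k', I k s' → I k (s'.setNat v 0 k'))
    (h0 : I 0 s)
    (step : ∀ k s', k < K → Frame (forN v bound body) s s' → s'.nat v 0 = k → I k s' →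
      Halts body s' [] (T k) (I (k + 1))) :
    Halts (forN v bound body) s [] (∑ k ∈ Finset.range K, (T k + 11) + 8) (I K) := by
  have := halts_forLoop (v := v) (a := .const 0) (b := .natLt (nv v) bound) (body := body) (s := s)
    0 K T I rfl (Nat.zero_le _) hv
    (fun k s' _ _ hf hk _ => by simp [hk, hb s' hf]) hI h0
    (fun k s' _ hk hf => step k s' hk hf)
  refine Halts.mono this ?_ fun _ _ h => h
  simp only [BExp.cost, NExp.cost, nv, hc, Finset.range_eq_Ico]
  exact le_rfl

theorem halts_forN_const {v : ℕ} {bound : NExp} {body : Cmd} {s : Mem} (K : ℕ)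
    (T : ℕ) (I : ℕ → Mem → Prop) (hv : body.keepsNat v = true) (hc : bound.cost = 2)
    (hb : ∀ s', Frame (forN v bound body) s s' → bound.eval s' = K)
    (hI : ∀ k s' k', I k s' → I k (s'.setNat v 0 k'))
    (h0 : I 0 s)
    (step : ∀ k s', k < K → Frame (forN v bound body) s s' → s'.nat v 0 = k → I k s' →
      Halts body s' [] T (I (k + 1))) :
    Halts (forN v bound body) s [] (K * (T + 11) + 8) (I K) := by
  have := halts_forN K (fun _ => T) I hv hc hb hI h0 step
  simpa using this

/-- Loop over the stored entries of the column whose number is in the integer variable `v`. The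
position of the entry is in the integer variable `4`. -/
def colLoop (ptr v : ℕ) (body : Cmd) : Cmd :=
  forLoop 4 (.get ptr (nv v)) (.natLt (nv 4) (.get ptr (.plus (nv v) (.const 1)))) body

@[simp] theorem keepsNat_colLoop (c : ℕ) (ptr v : ℕ) (body : Cmd) :
    (colLoop ptr v body).keepsNat c = (4 != c && body.keepsNat c) := by
  simp [colLoop]

@[simp] theorem keepsReal_colLoop (c : ℕ) (ptr v : ℕ) (body : Cmd) :
    (colLoop ptr v body).keepsReal c = body.keepsReal c := by
  simp [colLoop]

theorem halts_colLoop {ptr v : ℕ} {body : Cmd} {s : Mem} (lo hi T : ℕ) (I : ℕ → Mem → Prop)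
    (h4 : body.keepsNat 4 = true) (hp : (colLoop ptr v body).keepsNat ptr = true)
    (hv : (colLoop ptr v body).keepsNat v = true)
    (hlo : s.nat ptr (s.nat v 0) = lo) (hhi : s.nat ptr (s.nat v 0 + 1) = hi) (hle : lo ≤ hi)
    (hI : ∀ k s' k', I k s' → I k (s'.setNat 4 0 k'))
    (h0 : I lo s)
    (step : ∀ e s', lo ≤ e → e < hi → Frame (colLoop ptr v body) s s' → s'.nat 4 0 = e →
      I e s' → Halts body s' [] T (I (e + 1))) :
    Halts (colLoop ptr v body) s [] ((hi - lo) * (T + 14) + 13) (I hi) := by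
  have := halts_forLoop_const (v := 4) (a := .get ptr (nv v))
    (b := .natLt (nv 4) (.get ptr (.plus (nv v) (.const 1)))) (body := body) (s := s) lo hi T I
    (by simpa using hlo) hle h4
    (fun k s' _ _ hf hk _ => by
      simp only [BExp.holds, NExp.eval, nv]
      rw [hf.nat ptr hp, hf.nat v hv, hk, hhi]) hI h0 step
  exact this

/-- Add the multiple `d` of a column to the vector in real array `out`. -/
def scatter (ptr idx val out v : ℕ) (d : RExp) : Cmd :=
  colLoop ptr v (.setReal out (.get idx (nv 4))
    (.plus (.get out (.get idx (nv 4))) (.mul (.get val (nv 4)) d)))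

@[simp] theorem keepsNat_scatter (c : ℕ) (ptr idx val out v : ℕ) (d : RExp) :
    (scatter ptr idx val out v d).keepsNat c = (4 != c) := by
  simp [scatter]

@[simp] theorem keepsReal_scatter (c : ℕ) (ptr idx val out v : ℕ) (d : RExp) :
    (scatter ptr idx val out v d).keepsReal c = (out != c) := by
  simp [scatter]

theorem halts_scatter {m n : ℕ} {B : Matrix (Fin m) (Fin n) ℝ} {ptr idx val out v : ℕ} {d : RExp}
    {s : Mem} (hB : Sparse B (s.nat ptr) (s.nat idx) (s.real val)) (i : Fin n)
    (hi : s.nat v 0 = i) (dv : ℝ)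
    (hd : ∀ s', Frame (scatter ptr idx val out v d) s s' → d.eval s' = dv)
    (hp : 4 ≠ ptr) (hix : 4 ≠ idx) (hv : 4 ≠ v) (ho : out ≠ val) :
    Halts (scatter ptr idx val out v d) s []
      ((s.nat ptr (i + 1) - s.nat ptr i) * (27 + d.cost) + 13)
      (fun s' => ∀ j : Fin m, s'.real out j = s.real out j + B j i * dv) := by
  have hT : ∀ l, l * (27 + d.cost) + 13 = l * ((13 + d.cost) + 14) + 13 := fun l => by ring
  rw [hT]
  refine Halts.mono (halts_colLoop (s.nat ptr i) (s.nat ptr (i + 1)) (13 + d.cost)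
    (fun e s' => ∀ j : Fin m, s'.real out j = s.real out j +
      (∑ e' ∈ Finset.Ico (s.nat ptr i) e, if s.nat idx e' = j then s.real val e' else 0) * dv)
    rfl (by simp [hp]) (by simp [hv])
    (by rw [hi]) (by rw [hi]) (hB.ptr_mono i i.2) (fun k s' k' h => h) (by simp) ?_) le_rfl ?_
  · intro e s' hle hlt hf he hI
    refine Halts.straight rfl (by simp; omega) fun j => ?_
    have h1 : s'.nat idx = s.nat idx := hf.nat idx (by simp [hix])
    have h2 : s'.real val = s.real val :=
      hf.real val (by simp [ho])
    have h3 := hd s' hf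
    simp only [Cmd.eff, Mem.setReal_real, if_true, NExp.eval, nv, RExp.eval, he, h1, h2, h3,
      Function.update_apply]
    rw [Finset.sum_Ico_succ_top hle]
    by_cases hj : (j : ℕ) = s.nat idx e
    · rw [if_pos hj, if_pos hj.symm, ← hj, hI j]
      ring
    · rw [if_neg hj, if_neg (fun h => hj h.symm), hI j]
      ring
  · intro s' _ h j
    rw [h j, hB.sum_row]

/-- Accumulate in the real variable `7` the products of the entries of a column with the
values of `r`. -/
def gather (ptr val v : ℕ) (r : RExp) : Cmd :=
  .seq (.setReal 7 (.const 0) (.ofNat (.const 0)))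
    (colLoop ptr v (.setReal 7 (.const 0) (.plus (rv 7) (.mul (.get val (nv 4)) r))))

@[simp] theorem keepsNat_gather (c : ℕ) (ptr val v : ℕ) (r : RExp) :
    (gather ptr val v r).keepsNat c = (4 != c) := by
  simp [gather]

@[simp] theorem keepsReal_gather (c : ℕ) (ptr val v : ℕ) (r : RExp) :
    (gather ptr val v r).keepsReal c = (7 != c) := by
  simp [gather]

theorem halts_gather {m n : ℕ} {B : Matrix (Fin m) (Fin n) ℝ} {ptr idx val v : ℕ} {r : RExp}
    {s : Mem} (hB : Sparse B (s.nat ptr) (s.nat idx) (s.real val)) (i : Fin n)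
    (hi : s.nat v 0 = i) (f : ℕ → ℝ)
    (hr : ∀ e s', s.nat ptr i ≤ e → e < s.nat ptr (i + 1) →
      Frame (gather ptr val v r) s s' → s'.nat 4 0 = e → r.eval s' = f (s.nat idx e))
    (hp : 4 ≠ ptr) (hv : 4 ≠ v) (hval : 7 ≠ val) :
    Halts (gather ptr val v r) s []
      ((s.nat ptr (i + 1) - s.nat ptr i) * (23 + r.cost) + 17)
      (fun s' => s'.real 7 0 = ∑ j : Fin m, B j i * f j) := by
  have hT : ∀ l, l * (23 + r.cost) + 17 = 4 + (l * ((9 + r.cost) + 14) + 13) := fun l => by ring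
  rw [hT]
  have hframe : ∀ s', Frame (colLoop ptr v (.setReal 7 (.const 0)
      (.plus (rv 7) (.mul (.get val (nv 4)) r)))) s s' →
      Frame (gather ptr val v r) s s' := fun s' hf =>
    ⟨fun a ha => hf.nat a (by simpa using ha),
      fun a ha => hf.real a (by simpa using ha)⟩
  refine Halts.seq' (P := fun s' => s' = s.setReal 7 0 0)
    (Halts.straight rfl (by simp) (by simp)) fun s₁ _ hs₁ => ?_
  have hn : s₁.nat = s.nat := by rw [hs₁]; rfl
  have hr1 : s₁.real val = s.real val := by
    rw [hs₁, Mem.setReal_real, if_neg hval.symm]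
  refine Halts.mono (halts_colLoop (s.nat ptr i) (s.nat ptr (i + 1)) (9 + r.cost)
    (fun e s' => s'.real 7 0 =
      ∑ e' ∈ Finset.Ico (s.nat ptr i) e, s.real val e' * f (s.nat idx e'))
    rfl (by simp [hp]) (by simp [hv])
    (by rw [hn, hi]) (by rw [hn, hi]) (hB.ptr_mono i i.2) (fun k s' k' h => h)
    (by simp [hs₁]) ?_) le_rfl ?_
  · intro e s' hle hlt hf he hI
    refine Halts.straight rfl (by simp; omega) ?_
    have h2 : s'.real val = s.real val := by
      rw [hf.real val (by simp [hval]), hr1]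
    have hf' : Frame (gather ptr val v r) s s' := by
      refine ⟨fun a ha => ?_, fun a ha => ?_⟩
      · rw [hf.nat a (by simpa using ha), hn]
      · have h7 : a ≠ 7 := by
          rintro rfl; simp at ha
        rw [hf.real a (by simpa using ha), hs₁,
          Mem.setReal_real, if_neg h7]
    have h3 := hr e s' hle hlt hf' he
    simp only [Cmd.eff, Mem.setReal_real, if_true, NExp.eval, nv, rv, RExp.eval, he, h2, h3,
      Function.update_self]
    rw [Finset.sum_Ico_succ_top hle, hI]
  · intro s' _ h
    rw [h]
    exact hB.sum_col_mul i f

/-- Add to the vector in real array `out` the product of the matrix with the vector in `x`. -/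
def matVec (ptr idx val out v x : ℕ) (bound : NExp) : Cmd :=
  forN v bound (scatter ptr idx val out v (.get x (nv v)))

theorem halts_matVec {m n : ℕ} {B : Matrix (Fin m) (Fin n) ℝ} {ptr idx val out v x : ℕ}
    {bound : NExp} {s : Mem} (hB : Sparse B (s.nat ptr) (s.nat idx) (s.real val))
    (hc : bound.cost = 2)
    (hb : ∀ s', Frame (matVec ptr idx val out v x bound) s s' → bound.eval s' = n)
    (hp : 4 ≠ ptr) (hix : 4 ≠ idx) (hv : 4 ≠ v) (ho : out ≠ val) (hvp : v ≠ ptr) (hvi : v ≠ idx)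
    (hox : out ≠ x) :
    Halts (matVec ptr idx val out v x bound) s [] (30 * nnz B + 24 * n + 8)
      (fun s' => ∀ j : Fin m, s'.real out j =
        s.real out j + (B *ᵥ fun i : Fin n => s.real x i) j) := by
  refine Halts.mono (halts_forN n (fun k => (s.nat ptr (k + 1) - s.nat ptr k) * 30 + 13)
    (fun k s' => ∀ j : Fin m, s'.real out j = s.real out j +
      ∑ i ∈ Finset.range k, if h : i < n then B j ⟨i, h⟩ * s.real x i else 0)
    (by simp [hv]) hc hb (fun k s' k' h => h) (by simp) ?_) ?_ ?_
  · intro k s' hk hf hvk hI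
    have h1 : s'.nat ptr = s.nat ptr :=
      hf.nat ptr (by simp [hp, hvp])
    have h2 : s'.nat idx = s.nat idx :=
      hf.nat idx (by simp [hix, hvi])
    have h3 : s'.real val = s.real val :=
      hf.real val (by simp [ho])
    have h4 : s'.real x = s.real x :=
      hf.real x (by simp [hox])
    refine Halts.mono (halts_scatter (B := B) (by rw [h1, h2, h3]; exact hB) ⟨k, hk⟩ hvk
      (s.real x k) (fun s'' hf' => ?_) hp hix hv ho) ?_ ?_
    · simp only [RExp.eval, NExp.eval, nv]
      rw [hf'.nat v (by simp [hv]),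
        hf'.real x (by simp [hox]), h4, hvk]
    · simp [h1]
    · intro s'' _ h j
      rw [h j, hI j, Finset.sum_range_succ, dif_pos hk]
      ring
  · have e : ∑ k ∈ Finset.range n, ((s.nat ptr (k + 1) - s.nat ptr k) * 30 + 13 + 11) =
        (∑ k ∈ Finset.range n, (s.nat ptr (k + 1) - s.nat ptr k)) * 30 + n * 24 := by
      simp only [add_assoc, Finset.sum_add_distrib, Finset.sum_mul, Finset.sum_const,
        Finset.card_range, smul_eq_mul]
      ring
    rw [e, hB.sum_ptr]
    omega
  · intro s' _ h j
    rw [h j, Finset.sum_range]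
    congr 1
    unfold Matrix.mulVec dotProduct
    exact Finset.sum_congr rfl fun i _ => by rw [dif_pos i.2]

/-! ### The solver as a program -/

/-- One round of the solver. Real arrays: `3` the logarithm of the size, `4` the left-hand sides of
the rows, `5` the row weights, `6` the current point, `7` the benefit of the current column,
`8` the threshold. -/
def roundCmd : Cmd :=
  .seq (forN 5 (.get 0 (.const 1)) (.setReal 4 (nv 5) (.ofNat (.const 0))))
  (.seq (matVec 1 2 1 4 3 6 (nv 0))
  (.seq (forN 5 (.get 0 (.const 1))
    (.ite (.realLt (.get 4 (nv 5)) (.ofNat (.const 1)))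
      (.setReal 5 (nv 5) (.exp (.sub (.ofNat (.const 0))
        (.mul (.mul (.ofNat (.const 10)) (rv 3)) (.get 4 (nv 5))))))
      (.setReal 5 (nv 5) (.ofNat (.const 0)))))
  (forN 3 (nv 0) (.seq (gather 1 1 3 (.get 5 (.get 2 (nv 4))))
    (.ite (.realLt (rv 7) (rv 8)) .skip
      (.setReal 6 (nv 3) (.mul (.get 6 (nv 3)) (.plus (.ofNat (.const 1))
        (.div (.ofNat (.const 1)) (.mul (.ofNat (.const 100)) (rv 3)))))))))))

/-- The data which the solver reads but does not change. -/
structure SolverCtx {m n : ℕ} (A : Matrix (Fin m) (Fin n) ℝ) (s : Mem) : Prop where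
  cols : s.nat 0 0 = n
  rows : s.nat 0 1 = m
  sparse : Sparse A (s.nat 1) (s.nat 2) (s.real 1)
  log : s.real 3 0 = logSize m n

theorem SolverCtx.of_eq {m n : ℕ} {A : Matrix (Fin m) (Fin n) ℝ} {s s' : Mem} (h : SolverCtx A s)
    (h0 : s'.nat 0 = s.nat 0) (h1 : s'.nat 1 = s.nat 1) (h2 : s'.nat 2 = s.nat 2)
    (h3 : s'.real 1 = s.real 1) (h4 : s'.real 3 = s.real 3) : SolverCtx A s' :=
  ⟨by rw [h0]; exact h.cols, by rw [h0]; exact h.rows, by rw [h1, h2, h3]; exact h.sparse,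
    by rw [h4]; exact h.log⟩

theorem halts_roundCmd {m n : ℕ} {A : Matrix (Fin m) (Fin n) ℝ} {s : Mem} (h : SolverCtx A s)
    {x : Fin n → ℝ} {lam : ℝ} (hx : ∀ i : Fin n, s.real 6 i = x i) (hlam : s.real 8 0 = lam) :
    Halts roundCmd s [] (100 * (nnz A + n + m + 1))
      (fun s' => ∀ i : Fin n, s'.real 6 i =
        coverStep A (coverEta m n) (coverBeta m n) lam x i) := by
  have hT : (m * (5 + 11) + 8) + ((30 * nnz A + 24 * n + 8) + ((m * (30 + 11) + 8) +
      (27 * nnz A + 62 * n + 8))) ≤ 100 * (nnz A + n + m + 1) := by omega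
  refine Halts.mono (Q := fun s' => ∀ i : Fin n, s'.real 6 i =
    coverStep A (coverEta m n) (coverBeta m n) lam x i) ?_ hT fun _ _ h => h
  -- clear the row sums
  refine Halts.seq' (halts_forN_const (K := m) (T := 5)
    (I := fun k s' => ∀ j : Fin m, (j : ℕ) < k → s'.real 4 j = 0)
    rfl rfl (fun s' hf => ?_) (fun k s' k' h => h) (by simp) ?_) fun s₁ hf₁ h₁ => ?_
  · simp only [NExp.eval]; rw [hf.nat 0 rfl]; exact h.rows
  · intro k s' hk hf hv hI
    refine Halts.straight rfl (by simp) fun j hj => ?_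
    simp only [Cmd.eff, Mem.setReal_real, if_true, NExp.eval, RExp.eval, nv, hv,
      Function.update_apply]
    split_ifs with hjk
    · simp
    · exact hI j (by omega)
  have c₁ : SolverCtx A s₁ := h.of_eq (hf₁.nat 0 rfl) (hf₁.nat 1 rfl) (hf₁.nat 2 rfl)
    (hf₁.real 1 rfl) (hf₁.real 3 rfl)
  -- compute the row sums
  refine Halts.seq' (halts_matVec c₁.sparse rfl (fun s' hf => ?_) (by norm_num) (by norm_num)
    (by norm_num) (by norm_num) (by norm_num) (by norm_num) (by norm_num)) fun s₂ hf₂ h₂ => ?_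
  · simp only [NExp.eval, nv]; rw [hf.nat 0 rfl]; exact c₁.cols
  have c₂ : SolverCtx A s₂ := c₁.of_eq (hf₂.nat 0 rfl) (hf₂.nat 1 rfl) (hf₂.nat 2 rfl)
    (hf₂.real 1 rfl) (hf₂.real 3 rfl)
  have hx₁ : (fun i : Fin n => s₁.real 6 i) = x := by
    funext i; rw [hf₁.real 6 rfl]; exact hx i
  have hrow : ∀ j : Fin m, s₂.real 4 j = (A *ᵥ x) j := fun j => by
    rw [h₂ j, h₁ j j.2, hx₁, zero_add]
  -- compute the row weights
  refine Halts.seq' (halts_forN_const (K := m) (T := 30)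
    (I := fun k s' => ∀ j : Fin m, (j : ℕ) < k →
      s'.real 5 j = rowWeight (coverEta m n) ((A *ᵥ x) j))
    rfl rfl (fun s' hf => ?_) (fun k s' k' h => h) (by simp) ?_) fun s₃ hf₃ h₃ => ?_
  · simp only [NExp.eval]; rw [hf.nat 0 rfl]; exact c₂.rows
  · intro k s' hk hf hv hI
    refine Halts.straight rfl (by simp) fun j hj => ?_
    have e4 : s'.real 4 k = (A *ᵥ x) ⟨k, hk⟩ := by
      rw [hf.real 4 rfl]; exact hrow ⟨k, hk⟩
    have e3 : s'.real 3 0 = logSize m n := by rw [hf.real 3 rfl]; exact c₂.log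
    simp only [Cmd.eff, BExp.holds, NExp.eval, RExp.eval, nv, rv, hv, e4, e3]
    have hcase : ∀ w : ℝ, w = rowWeight (coverEta m n) ((A *ᵥ x) ⟨k, hk⟩) →
        (s'.setReal 5 k w).real 5 j = rowWeight (coverEta m n) ((A *ᵥ x) j) := by
      intro w hw
      simp only [Mem.setReal_real, if_true, Function.update_apply]
      split_ifs with hjk
      · rw [hw, show j = ⟨k, hk⟩ from Fin.ext hjk]
      · exact hI j (by omega)
    unfold rowWeight at hcase ⊢
    simp only [Nat.cast_one]
    split_ifs at hcase ⊢ with h5 <;> exact hcase _ (by simp [coverEta])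
  have c₃ : SolverCtx A s₃ := c₂.of_eq (hf₃.nat 0 rfl) (hf₃.nat 1 rfl) (hf₃.nat 2 rfl)
    (hf₃.real 1 rfl) (hf₃.real 3 rfl)
  have hx₃ : ∀ i : Fin n, s₃.real 6 i = x i := fun i => by
    rw [hf₃.real 6 rfl, hf₂.real 6 rfl, hf₁.real 6 rfl]; exact hx i
  have hlam₃ : s₃.real 8 0 = lam := by
    rw [hf₃.real 8 rfl, hf₂.real 8 rfl, hf₁.real 8 rfl]; exact hlam
  -- update the point
  refine Halts.mono (halts_forN (K := n)
    (T := fun k => (s₃.nat 1 (k + 1) - s₃.nat 1 k) * 27 + 51)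
    (I := fun k s' => ∀ i : Fin n, s'.real 6 i = if (i : ℕ) < k then
      coverStep A (coverEta m n) (coverBeta m n) lam x i else x i)
    rfl rfl (fun s' hf => ?_) (fun k s' k' h => h) (by simpa using hx₃) ?_) ?_ ?_
  · simp only [NExp.eval, nv]; rw [hf.nat 0 rfl]; exact c₃.cols
  · intro k s' hk hf hv hI
    have c : SolverCtx A s' := c₃.of_eq (hf.nat 0 rfl) (hf.nat 1 rfl) (hf.nat 2 rfl)
      (hf.real 1 rfl) (hf.real 3 rfl)
    have hlen : (s₃.nat 1 (k + 1) - s₃.nat 1 k) * 27 + 51 =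
        ((s'.nat 1 (k + 1) - s'.nat 1 k) * 27 + 17) + 34 := by
      rw [hf.nat 1 rfl]
    rw [hlen]
    refine Halts.seq' (halts_gather c.sparse ⟨k, hk⟩ hv (fun j => s'.real 5 j)
      (fun e s'' _ _ hf' he => ?_) (by norm_num) (by norm_num) (by norm_num))
      fun s₄ hf₄ h₄ => ?_
    · simp only [RExp.eval, NExp.eval, nv, he]
      rw [hf'.real 5 rfl, hf'.nat 2 rfl]
    · have hb : s₄.real 7 0 = benefit A (coverEta m n) x ⟨k, hk⟩ := by
        rw [h₄]
        unfold benefit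
        refine Finset.sum_congr rfl fun j _ => ?_
        rw [hf.real 5 rfl, h₃ j j.2]
      have e8 : s₄.real 8 0 = lam := by rw [hf₄.real 8 rfl, hf.real 8 rfl]; exact hlam₃
      have e3 : s₄.real 3 0 = logSize m n := by rw [hf₄.real 3 rfl]; exact c.log
      have e6 : ∀ i : Fin n, s₄.real 6 i = if (i : ℕ) < k then
          coverStep A (coverEta m n) (coverBeta m n) lam x i else x i := fun i => by
        rw [hf₄.real 6 rfl]; exact hI i
      have e33 : s₄.nat 3 0 = k := by rw [hf₄.nat 3 rfl]; exact hv
      refine Halts.straight rfl (by simp) fun i => ?_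
      simp only [Cmd.eff, BExp.holds, NExp.eval, RExp.eval, nv, rv, hb, e8, e3, e33]
      have e6k := e6 ⟨k, hk⟩
      simp only [lt_irrefl, if_false] at e6k
      by_cases hcond : benefit A (coverEta m n) x ⟨k, hk⟩ < lam
      · rw [if_pos hcond, e6 i]
        rcases lt_trichotomy (i : ℕ) k with h5 | h5 | h5
        · rw [if_pos h5, if_pos (by omega)]
        · have : i = ⟨k, hk⟩ := Fin.ext h5
          subst this
          simp [coverStep, hcond]
        · rw [if_neg (by omega), if_neg (by omega)]
      · rw [if_neg hcond, Mem.setReal_real, if_pos rfl, Function.update_apply]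
        rcases lt_trichotomy (i : ℕ) k with h5 | h5 | h5
        · rw [if_neg (by omega), e6 i, if_pos h5, if_pos (by omega)]
        · have : i = ⟨k, hk⟩ := Fin.ext h5
          subst this
          simp [coverStep, hcond, coverBeta, e6k]
        · rw [if_neg (by omega), e6 i, if_neg (by omega), if_neg (by omega)]
  · have e : ∑ k ∈ Finset.range n, ((s₃.nat 1 (k + 1) - s₃.nat 1 k) * 27 + 51 + 11) =
        (∑ k ∈ Finset.range n, (s₃.nat 1 (k + 1) - s₃.nat 1 k)) * 27 + n * 62 := by
      simp only [add_assoc, Finset.sum_add_distrib, Finset.sum_mul, Finset.sum_const,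
        Finset.card_range, smul_eq_mul]
      ring
    rw [e, c₃.sparse.sum_ptr]
    omega
  · intro s' _ h i
    rw [h i, if_pos i.2]

/-- The solver. -/
def solveCmd : Cmd :=
  .seq (.setReal 3 (.const 0) (.log (.plus (.ofNat (nv 0)) (.ofNat (.get 0 (.const 1))))))
  (.seq (.setReal 8 (.const 0) (.mul (.ofNat (.const 10))
    (.mul (.plus (.ofNat (nv 0)) (.ofNat (.get 0 (.const 1))))
      (.plus (.ofNat (nv 0)) (.ofNat (.get 0 (.const 1)))))))
  (.seq (forN 3 (nv 0) (.setReal 6 (nv 3) (.div (.ofNat (.const 1)) (.mul (.ofNat (.const 10))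
    (.plus (.ofNat (nv 0)) (.ofNat (.get 0 (.const 1))))))))
  (forLoop 6 (.const 0) (.realLt (.ofNat (nv 6)) (.mul (.ofNat (.const 200)) (rv 3)))
    (.seq (forLoop 7 (.const 0) (.realLt (.ofNat (nv 7)) (.mul (.ofNat (.const 2000))
      (.mul (rv 3) (rv 3)))) roundCmd)
      (.setReal 8 (.const 0) (.mul (rv 8) (.div (.ofNat (.const 10)) (.ofNat (.const 11)))))))))

theorem halts_solveCmd {m n : ℕ} {A : Matrix (Fin m) (Fin n) ℝ} {s : Mem}
    (hn : s.nat 0 0 = n) (hm : s.nat 0 1 = m) (hA : Sparse A (s.nat 1) (s.nat 2) (s.real 1)) :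
    Halts solveCmd s [] (100 * (nnz A + n + m + 1) +
        coverPhases m n * (coverRounds m n * (100 * (nnz A + n + m + 1) + 18) + 50))
      (fun s' => ∀ i : Fin n, s'.real 6 i = coverRun A (coverPhases m n) i) := by
  have hT : 20 + (40 + ((n * (40 + 11) + 8) +
      (coverPhases m n * (coverRounds m n * (100 * (nnz A + n + m + 1) + 18) + 50) + 12))) ≤
      100 * (nnz A + n + m + 1) +
        coverPhases m n * (coverRounds m n * (100 * (nnz A + n + m + 1) + 18) + 50) := by omega
  refine Halts.mono (Q := fun s' => ∀ i : Fin n, s'.real 6 i = coverRun A (coverPhases m n) i) ?_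
    hT fun _ _ h => h
  refine Halts.seq' (P := fun s' => s'.real 3 0 = logSize m n)
    (Halts.straight rfl (by simp) (by simp [logSize, hn, hm])) fun s₁ hf₁ h₁ => ?_
  have c₁ : SolverCtx A s₁ := ⟨by rw [hf₁.nat 0 rfl]; exact hn, by rw [hf₁.nat 0 rfl]; exact hm,
    by rw [hf₁.nat 1 rfl, hf₁.nat 2 rfl, hf₁.real 1 rfl]; exact hA, h₁⟩
  refine Halts.seq' (P := fun s' => s'.real 8 0 = coverThreshold m n 0)
    (Halts.straight rfl (by simp) (by simp [coverThreshold, c₁.cols, c₁.rows]))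
    fun s₂ hf₂ h₂ => ?_
  have c₂ : SolverCtx A s₂ := c₁.of_eq (hf₂.nat 0 rfl) (hf₂.nat 1 rfl) (hf₂.nat 2 rfl)
    (hf₂.real 1 rfl) (hf₂.real 3 rfl)
  refine Halts.seq' (halts_forN_const (K := n) (T := 40)
    (I := fun k s' => ∀ i : Fin n, (i : ℕ) < k → s'.real 6 i = coverRun A 0 i)
    rfl rfl (fun s' hf => ?_) (fun k s' k' h => h) (by simp) ?_) fun s₃ hf₃ h₃ => ?_
  · simp only [NExp.eval, nv]; rw [hf.nat 0 rfl]; exact c₂.cols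
  · intro k s' hk hf hv hI
    refine Halts.straight rfl (by simp) fun i hi => ?_
    have e0 : s'.nat 0 0 = n := by rw [hf.nat 0 rfl]; exact c₂.cols
    have e1 : s'.nat 0 1 = m := by rw [hf.nat 0 rfl]; exact c₂.rows
    simp only [Cmd.eff, Mem.setReal_real, if_true, NExp.eval, RExp.eval, nv, hv,
      Function.update_apply, e0, e1]
    split_ifs with hik
    · simp [coverRun]
    · exact hI i (by omega)
  have c₃ : SolverCtx A s₃ := c₂.of_eq (hf₃.nat 0 rfl) (hf₃.nat 1 rfl) (hf₃.nat 2 rfl)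
    (hf₃.real 1 rfl) (hf₃.real 3 rfl)
  have h8 : s₃.real 8 0 = coverThreshold m n 0 := by rw [hf₃.real 8 rfl]; exact h₂
  refine Halts.mono (halts_forLoop_const 0 (coverPhases m n)
    (coverRounds m n * (100 * (nnz A + n + m + 1) + 18) + 35)
    (fun t s' => (∀ i : Fin n, s'.real 6 i = coverRun A t i) ∧ s'.real 8 0 = coverThreshold m n t)
    rfl (Nat.zero_le _) rfl (fun k s' _ _ hf hk _ => ?_) (fun k s' k' h => h)
    ⟨fun i => h₃ i i.2, h8⟩ ?_) ?_ fun s' _ h => h.1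
  · simp only [BExp.holds, RExp.eval, NExp.eval, nv, rv, hk, hf.real 3 rfl, c₃.log, coverPhases,
      Nat.lt_ceil, Nat.cast_ofNat]
  · intro t s' _ ht hf hv hI
    have c : SolverCtx A s' := c₃.of_eq (hf.nat 0 rfl) (hf.nat 1 rfl) (hf.nat 2 rfl)
      (hf.real 1 rfl) (hf.real 3 rfl)
    have hupd : ∀ s₄ : Mem, Frame (forLoop 7 (.const 0) (.realLt (.ofNat (nv 7))
        (.mul (.ofNat (.const 2000)) (.mul (rv 3) (rv 3)))) roundCmd) s' s₄ →
        ((Cmd.setReal 8 (.const 0) (.mul (rv 8) (.div (.ofNat (.const 10))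
          (.ofNat (.const 11))))).eff s₄).real 8 0 = coverThreshold m n (t + 1) := by
      intro s₄ hf₄
      have h8' : s₄.real 8 0 = coverThreshold m n t := by rw [hf₄.real 8 rfl]; exact hI.2
      simp only [Cmd.eff, Mem.setReal_real, if_true, NExp.eval, RExp.eval, rv, h8',
        Function.update_self, coverThreshold, pow_succ, Nat.cast_ofNat]
      ring
    refine Halts.mono (Halts.seq' (halts_forLoop_const 0 (coverRounds m n)
      (100 * (nnz A + n + m + 1))
      (fun r s'' => ∀ i : Fin n, s''.real 6 i = (coverStep A (coverEta m n) (coverBeta m n)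
        (coverThreshold m n t))^[r] (coverRun A t) i) rfl (Nat.zero_le _) rfl
      (fun k s'' _ _ hf' hk _ => ?_) (fun k s' k' h => h) hI.1 ?_)
      (T' := 20) (fun s₄ hf₄ h₄ => Halts.straight rfl (by simp) ⟨fun i => h₄ i, hupd s₄ hf₄⟩)) ?_
      fun _ _ h => h
    · simp only [BExp.holds, RExp.eval, NExp.eval, nv, rv, hk, hf'.real 3 rfl, c.log, coverRounds,
        Nat.lt_ceil, Nat.cast_ofNat]
    · intro r s'' _ hr hf' hv' hI'
      have c' : SolverCtx A s'' := c.of_eq (hf'.nat 0 rfl) (hf'.nat 1 rfl) (hf'.nat 2 rfl)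
        (hf'.real 1 rfl) (hf'.real 3 rfl)
      have h8' : s''.real 8 0 = coverThreshold m n t := by rw [hf'.real 8 rfl]; exact hI.2
      have := halts_roundCmd c' hI' h8'
      simp only [Function.iterate_succ_apply']
      exact this
    · simp only [BExp.cost, RExp.cost, NExp.cost, nv, rv, Nat.sub_zero]
      exact le_of_eq (by ring)
  · simp only [BExp.cost, RExp.cost, NExp.cost, nv, rv, Nat.sub_zero]
    exact le_of_eq (by ring)

/-! ### Building the reduced matrix and the starting point -/

/-- Smallest and largest positive entry of the current column, to real variables `9` and `10`. -/
def minMaxCmd : Cmd :=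
  .seq (.setReal 9 (.const 0) (.get 1 (.get 1 (nv 3))))
  (.seq (.setReal 10 (.const 0) (.get 1 (.get 1 (nv 3))))
  (colLoop 1 3 (.seq
    (.ite (.realLt (.get 1 (nv 4)) (rv 9)) (.setReal 9 (.const 0) (.get 1 (nv 4))) .skip)
    (.ite (.realLt (rv 10) (.get 1 (nv 4))) (.setReal 10 (.const 0) (.get 1 (nv 4))) .skip))))

theorem halts_minMaxCmd {m n : ℕ} {A : Matrix (Fin m) (Fin n) ℝ} (hA : IsCovering A) {s : Mem}
    (hs : Sparse A (s.nat 1) (s.nat 2) (s.real 1)) (i : Fin n) (hi : s.nat 3 0 = i) :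
    Halts minMaxCmd s [] ((s.nat 1 (i + 1) - s.nat 1 i) * 50 + 30)
      (fun s' => s'.real 9 0 = minPos A i ∧ s'.real 10 0 = maxPos A i) := by
  have hne : s.nat 1 i < s.nat 1 (i + 1) := by
    obtain ⟨j, hj⟩ := hA.col i
    obtain ⟨e, h1, h2, _⟩ := hs.exists_entry i hj
    omega
  have hT' : 7 + (7 + ((s.nat 1 (i + 1) - s.nat 1 i) * (35 + 14) + 13)) ≤
      (s.nat 1 (i + 1) - s.nat 1 i) * 50 + 30 := by omega
  refine Halts.mono (Q := fun s' => s'.real 9 0 = minPos A i ∧ s'.real 10 0 = maxPos A i) ?_ hT'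
    fun _ _ h => h
  refine Halts.seq' (P := fun s' => s'.real 9 0 = s.real 1 (s.nat 1 i))
    (Halts.straight rfl (by simp) (by simp [hi])) fun s₁ hf₁ h₁ => ?_
  refine Halts.seq' (P := fun s' => s'.real 10 0 = s.real 1 (s.nat 1 i))
    (Halts.straight rfl (by simp) (by
      simp [hf₁.nat 1 rfl, hf₁.nat 3 rfl, hf₁.real 1 rfl, hi])) fun s₂ hf₂ h₂ => ?_
  have e9 : s₂.real 9 0 = s.real 1 (s.nat 1 i) := by rw [hf₂.real 9 rfl]; exact h₁
  have e1 : s₂.nat 1 = s.nat 1 := by rw [hf₂.nat 1 rfl, hf₁.nat 1 rfl]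
  have e3 : s₂.nat 3 0 = i := by rw [hf₂.nat 3 rfl, hf₁.nat 3 rfl]; exact hi
  have er1 : s₂.real 1 = s.real 1 := by rw [hf₂.real 1 rfl, hf₁.real 1 rfl]
  refine Halts.mono (halts_colLoop (s.nat 1 i) (s.nat 1 (i + 1)) 35 (fun e s' =>
    ((∃ e', s.nat 1 i ≤ e' ∧ e' < s.nat 1 (i + 1) ∧ s'.real 9 0 = s.real 1 e') ∧
      ∀ e', s.nat 1 i ≤ e' → e' < e → s'.real 9 0 ≤ s.real 1 e') ∧
    ((∃ e', s.nat 1 i ≤ e' ∧ e' < s.nat 1 (i + 1) ∧ s'.real 10 0 = s.real 1 e') ∧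
      ∀ e', s.nat 1 i ≤ e' → e' < e → s.real 1 e' ≤ s'.real 10 0))
    rfl rfl rfl (by rw [e1, e3]) (by rw [e1, e3]) hne.le (fun k s' k' h => h) ?_ ?_) le_rfl ?_
  · exact ⟨⟨⟨_, le_rfl, hne, e9⟩, fun e' h1 h2 => by omega⟩,
      ⟨⟨_, le_rfl, hne, h₂⟩, fun e' h1 h2 => by omega⟩⟩
  · rintro e s' hle hlt hf he ⟨⟨⟨a, ha1, ha2, ha3⟩, hmin⟩, ⟨⟨b, hb1, hb2, hb3⟩, hmax⟩⟩
    have ev : s'.real 1 e = s.real 1 e := by rw [hf.real 1 rfl, er1]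
    refine Halts.seq' (T := 18) (T' := 17) (P := fun s'' =>
      (∃ e', s.nat 1 i ≤ e' ∧ e' < s.nat 1 (i + 1) ∧ s''.real 9 0 = s.real 1 e') ∧
      ∀ e', s.nat 1 i ≤ e' → e' < e + 1 → s''.real 9 0 ≤ s.real 1 e')
      (Halts.straight rfl (by simp) ?_) fun s'' hf' h' => Halts.straight rfl (by simp) ?_
    · simp only [Cmd.eff, BExp.holds, RExp.eval, NExp.eval, nv, rv, he, ev]
      split_ifs with hc
      · simp only [Mem.setReal_real, if_true, Function.update_self]
        refine ⟨⟨e, hle, hlt, rfl⟩, fun e' h1 h2 => ?_⟩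
        rcases Nat.lt_succ_iff_lt_or_eq.1 h2 with h3 | h3
        · exact hc.le.trans (hmin e' h1 h3)
        · rw [h3]
      · refine ⟨⟨a, ha1, ha2, ha3⟩, fun e' h1 h2 => ?_⟩
        rcases Nat.lt_succ_iff_lt_or_eq.1 h2 with h3 | h3
        · exact hmin e' h1 h3
        · rw [h3]; exact not_lt.1 hc
    · have he' : s''.nat 4 0 = e := by rw [hf'.nat 4 rfl]; exact he
      have ev' : s''.real 1 e = s.real 1 e := by rw [hf'.real 1 rfl]; exact ev
      have e10 : s''.real 10 0 = s'.real 10 0 := by rw [hf'.real 10 rfl]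
      simp only [Cmd.eff, BExp.holds, RExp.eval, NExp.eval, nv, rv, he', ev', e10]
      split_ifs with hc
      · simp only [Mem.setReal_real, if_true, Function.update_self]
        refine ⟨by simpa using h', ⟨e, hle, hlt, rfl⟩, fun e' h1 h2 => ?_⟩
        rcases Nat.lt_succ_iff_lt_or_eq.1 h2 with h3 | h3
        · exact (hmax e' h1 h3).trans hc.le
        · rw [h3]
      · refine ⟨h', ⟨b, hb1, hb2, by rw [e10, hb3]⟩, fun e' h1 h2 => ?_⟩
        rw [e10]
        rcases Nat.lt_succ_iff_lt_or_eq.1 h2 with h3 | h3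
        · exact hmax e' h1 h3
        · rw [h3]; exact not_lt.1 hc
  · rintro s' _ ⟨⟨⟨a, ha1, ha2, ha3⟩, hmin⟩, ⟨⟨b, hb1, hb2, hb3⟩, hmax⟩⟩
    have hpos : ∀ {e}, s.nat 1 i ≤ e → e < s.nat 1 (i + 1) →
        s.real 1 e ∈ {a | ∃ j, 0 < A j i ∧ a = A j i} := by
      intro e h1 h2
      obtain ⟨j, _, hj, hj0⟩ := hs.entry i h1 h2
      exact ⟨j, lt_of_le_of_ne (hA.nonneg j i) hj0.symm, hj⟩
    constructor
    · refine IsLeast.unique ⟨?_, ?_⟩ (hA.isLeast_minPos i)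
      · rw [ha3]; exact hpos ha1 ha2
      · rintro _ ⟨j, hj, rfl⟩
        obtain ⟨e, h1, h2, _, h3⟩ := hs.exists_entry i hj.ne'
        rw [← h3]; exact hmin e h1 h2
    · refine IsGreatest.unique ⟨?_, ?_⟩ (hA.isGreatest_maxPos i)
      · rw [hb3]; exact hpos hb1 hb2
      · rintro _ ⟨j, hj, rfl⟩
        obtain ⟨e, h1, h2, _, h3⟩ := hs.exists_entry i hj.ne'
        rw [← h3]; exact hmax e h1 h2

/-- The reduced matrix is stored in integer arrays `11`, `12` and real array `12`, the norms of its
columns in real array `13` and the starting point in real array `2`. This is the part of the data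
which belongs to column `k`. -/
structure BuiltCol {m n : ℕ} (A : Matrix (Fin m) (Fin n) ℝ) (x₀ : Fin (redDim A) → ℝ)
    (k : Fin (redDim A)) (s : Mem) : Prop where
  mono : s.nat 11 k ≤ s.nat 11 (k + 1)
  le_cur : s.nat 11 (k + 1) ≤ s.nat 10 0
  index : Set.BijOn (s.nat 12) (Set.Ico (s.nat 11 k) (s.nat 11 (k + 1)))
    {j | ∃ j' : Fin m, reduced A j' k ≠ 0 ∧ j = (j' : ℕ)}
  value : ∀ e : ℕ, s.nat 11 k ≤ e → e < s.nat 11 (k + 1) →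
    ∀ j : Fin m, s.nat 12 e = (j : ℕ) → s.real 12 e = reduced A j k
  norm : s.real 13 k = colNorm (reduced A) k
  start : s.real 2 k = x₀ k

/-- The first `K` columns of the reduced matrix have been built. -/
structure Built {m n : ℕ} (A : Matrix (Fin m) (Fin n) ℝ) (x₀ : Fin (redDim A) → ℝ)
    (K : ℕ) (s : Mem) : Prop where
  count : s.nat 9 0 = K
  zero : s.nat 11 0 = 0
  cur : s.nat 10 0 = s.nat 11 K
  col : ∀ k : Fin (redDim A), (k : ℕ) < K → BuiltCol A x₀ k s

theorem BuiltCol.of_eq {m n : ℕ} {A : Matrix (Fin m) (Fin n) ℝ} {x₀ : Fin (redDim A) → ℝ}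
    {k : Fin (redDim A)} {s s' : Mem} (h : BuiltCol A x₀ k s)
    (h11 : s'.nat 11 k = s.nat 11 k) (h11' : s'.nat 11 (k + 1) = s.nat 11 (k + 1))
    (h10 : s.nat 10 0 ≤ s'.nat 10 0)
    (h12 : ∀ e < s.nat 10 0, s'.nat 12 e = s.nat 12 e ∧ s'.real 12 e = s.real 12 e)
    (h13 : s'.real 13 k = s.real 13 k) (h2 : s'.real 2 k = s.real 2 k) : BuiltCol A x₀ k s' := by
  have hcur := h.le_cur
  refine ⟨by rw [h11, h11']; exact h.mono, by omega, ?_, ?_, by rw [h13]; exact h.norm,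
    by rw [h2]; exact h.start⟩
  · rw [h11, h11']
    refine h.index.congr fun e he => ?_
    have := he.2
    exact ((h12 e (by omega)).1).symm
  · intro e h1 h3 j hj
    rw [h11] at h1
    rw [h11'] at h3
    obtain ⟨h4, h5⟩ := h12 e (by omega)
    rw [h5]
    rw [h4] at hj
    exact h.value e h1 h3 j hj

theorem Built.sparse {m n : ℕ} {A : Matrix (Fin m) (Fin n) ℝ} {x₀ : Fin (redDim A) → ℝ} {s : Mem}
    (h : Built A x₀ (redDim A) s) : Sparse (reduced A) (s.nat 11) (s.nat 12) (s.real 12) :=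
  ⟨h.zero, fun k hk => (h.col ⟨k, hk⟩ hk).mono, fun k => (h.col k k.2).index,
    fun k e h1 h2 => (h.col k k.2).value e h1 h2⟩

/-- Copy the current column with cap `2 * pw`, where `pw` is real variable `18`. -/
def copyEntries : Cmd :=
  colLoop 1 3 (.seq (.setNat 12 (nv 10) (.get 2 (nv 4)))
    (.seq (.ite (.realLt (rv 18) (.get 1 (nv 4))) (.setReal 12 (nv 10) (rv 18))
      (.setReal 12 (nv 10) (.get 1 (nv 4))))
    (.setNat 10 (.const 0) (.plus (nv 10) (.const 1)))))

theorem halts_copyEntries {m n : ℕ} {A : Matrix (Fin m) (Fin n) ℝ} {s : Mem}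
    (hs : Sparse A (s.nat 1) (s.nat 2) (s.real 1)) (i : Fin n) (hi : s.nat 3 0 = i) :
    Halts copyEntries s [] ((s.nat 1 (i + 1) - s.nat 1 i) * 50 + 13)
      (fun s' => s'.nat 10 0 = s.nat 10 0 + (s.nat 1 (i + 1) - s.nat 1 i) ∧
        (∀ p < s.nat 10 0, s'.nat 12 p = s.nat 12 p ∧ s'.real 12 p = s.real 12 p) ∧
        ∀ d < s.nat 1 (i + 1) - s.nat 1 i,
          s'.nat 12 (s.nat 10 0 + d) = s.nat 2 (s.nat 1 i + d) ∧
          s'.real 12 (s.nat 10 0 + d) = min (s.real 1 (s.nat 1 i + d)) (s.real 18 0)) := by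
  refine Halts.mono (halts_colLoop (s.nat 1 i) (s.nat 1 (i + 1)) 36 (fun e s' =>
      s'.nat 10 0 = s.nat 10 0 + (e - s.nat 1 i) ∧
        (∀ p < s.nat 10 0, s'.nat 12 p = s.nat 12 p ∧ s'.real 12 p = s.real 12 p) ∧
        ∀ d < e - s.nat 1 i,
          s'.nat 12 (s.nat 10 0 + d) = s.nat 2 (s.nat 1 i + d) ∧
          s'.real 12 (s.nat 10 0 + d) = min (s.real 1 (s.nat 1 i + d)) (s.real 18 0))
    rfl rfl rfl (by rw [hi]) (by rw [hi]) (hs.ptr_mono i i.2) (fun k s' k' h => h)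
    (by simp) ?_) (by omega) fun _ _ h => h
  rintro e s' hle hlt hf he ⟨h1, h2, h3⟩
  refine Halts.straight rfl (by simp) ?_
  have e2 : s'.nat 2 = s.nat 2 := hf.nat 2 rfl
  have e1 : s'.real 1 = s.real 1 := hf.real 1 rfl
  have e18 : s'.real 18 0 = s.real 18 0 := by rw [hf.real 18 rfl]
  have hmin : ∀ w : ℝ, w = min (s.real 1 e) (s.real 18 0) →
      let t := ((s'.setNat 12 (s'.nat 10 0) (s.nat 2 e)).setReal 12 (s'.nat 10 0) w).setNat 10 0
        (s'.nat 10 0 + 1)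
      t.nat 10 0 = s.nat 10 0 + (e + 1 - s.nat 1 i) ∧
        (∀ p < s.nat 10 0, t.nat 12 p = s.nat 12 p ∧ t.real 12 p = s.real 12 p) ∧
        ∀ d < e + 1 - s.nat 1 i,
          t.nat 12 (s.nat 10 0 + d) = s.nat 2 (s.nat 1 i + d) ∧
          t.real 12 (s.nat 10 0 + d) = min (s.real 1 (s.nat 1 i + d)) (s.real 18 0) := by
    intro w hw t
    have t10 : t.nat 10 0 = s'.nat 10 0 + 1 := by simp [t]
    have t12 : t.nat 12 = Function.update (s'.nat 12) (s'.nat 10 0) (s.nat 2 e) := by simp [t]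
    have t12' : t.real 12 = Function.update (s'.real 12) (s'.nat 10 0) w := by simp [t]
    rw [t10, t12, t12', h1]
    refine ⟨by omega, fun p hp => ?_, fun d hd => ?_⟩
    · rw [Function.update_of_ne (by omega), Function.update_of_ne (by omega)]
      exact h2 p hp
    · by_cases hde : d = e - s.nat 1 i
      · subst hde
        have : s.nat 1 i + (e - s.nat 1 i) = e := by omega
        rw [Function.update_self, Function.update_self, this]
        exact ⟨rfl, hw⟩
      · rw [Function.update_of_ne (by omega), Function.update_of_ne (by omega)]
        exact h3 d (by omega)
  simp only [Cmd.eff, BExp.holds, RExp.eval, NExp.eval, nv, rv, he, e2]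
  have g1 : (s'.setNat 12 (s'.nat 10 0) (s.nat 2 e)).real = s'.real := rfl
  have g4 : (s'.setNat 12 (s'.nat 10 0) (s.nat 2 e)).nat 4 = s'.nat 4 := by simp
  have g10 : (s'.setNat 12 (s'.nat 10 0) (s.nat 2 e)).nat 10 = s'.nat 10 := by simp
  rw [g1, g4, g10, he, e1, e18]
  split_ifs with hc
  · have := hmin (s.real 18 0) (min_eq_right hc.le).symm
    simpa only [Mem.setReal_nat, g10] using this
  · have := hmin (s.real 1 e) (min_eq_left (not_lt.1 hc)).symm
    simpa only [Mem.setReal_nat, g10] using this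

/-- Build one copy of the current column, of which the largest entry is in real variable `10`. Real
variable `11` is the value of the variable of the original program, real variable `18` half
of the cap. -/
def copyCmd : Cmd :=
  .seq (.setReal 18 (.const 0) (.mul (.ofNat (.const 2)) (rv 18)))
  (.seq copyEntries
  (.seq (.ite (.and (.not (.realLt (.ofNat (.const 2)) (.mul (rv 11) (rv 18))))
      (.not (.and (.realLt (rv 18) (rv 10))
        (.not (.realLt (.ofNat (.const 2)) (.mul (rv 11) (.mul (.ofNat (.const 2)) (rv 18))))))))
    (.setReal 2 (nv 9) (.mul (.plus (.ofNat (.const 1)) (.div (.get 0 (.const 0))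
      (.ofNat (.const 2)))) (rv 11)))
    (.setReal 2 (nv 9) (.ofNat (.const 0))))
  (.seq (.ite (.realLt (rv 18) (rv 10)) (.setReal 13 (nv 9) (rv 18))
    (.setReal 13 (nv 9) (rv 10)))
  (.seq (.setNat 9 (.const 0) (.plus (nv 9) (.const 1)))
    (.setNat 11 (nv 9) (nv 10))))))

/-- Number of columns of the reduced matrix before the copies of column `i`. -/
def baseIdx {m n : ℕ} (A : Matrix (Fin m) (Fin n) ℝ) (i : ℕ) : ℕ :=
  ∑ t ∈ Finset.range i, if h : t < n then copies A ⟨t, h⟩ else 0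

theorem copyIdx_val {m n : ℕ} (A : Matrix (Fin m) (Fin n) ℝ) (i : Fin n) (l : Fin (copies A i)) :
    (copyIdx A i l : ℕ) = baseIdx A i + l := by
  unfold copyIdx baseIdx
  rw [finSigmaFinEquiv_apply, Finset.sum_range]
  congr 1
  refine Finset.sum_congr rfl fun t _ => ?_
  rw [dif_pos (t.2.trans i.2)]
  rfl

theorem baseIdx_n {m n : ℕ} (A : Matrix (Fin m) (Fin n) ℝ) : baseIdx A n = redDim A := by
  unfold baseIdx redDim
  rw [Finset.sum_range]
  exact Finset.sum_congr rfl fun t _ => by rw [dif_pos t.2]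

theorem baseIdx_succ {m n : ℕ} (A : Matrix (Fin m) (Fin n) ℝ) (i : Fin n) :
    baseIdx A (i + 1) = baseIdx A i + copies A i := by
  unfold baseIdx
  rw [Finset.sum_range_succ, dif_pos i.2]

/-- The data used by the construction of the copies of column `i`. -/
structure CopyCtx {m n : ℕ} (A : Matrix (Fin m) (Fin n) ℝ) (ε : ℝ) (x : Fin n → ℝ) (i : Fin n)
    (s : Mem) : Prop where
  sparse : Sparse A (s.nat 1) (s.nat 2) (s.real 1)
  eps : s.real 0 0 = ε
  cur : s.nat 3 0 = i
  max : s.real 10 0 = maxPos A i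
  val : s.real 11 0 = min (x i) (1 / minPos A i)

theorem CopyCtx.of_eq {m n : ℕ} {A : Matrix (Fin m) (Fin n) ℝ} {ε : ℝ} {x : Fin n → ℝ} {i : Fin n}
    {s s' : Mem} (h : CopyCtx A ε x i s) (h1 : s'.nat 1 = s.nat 1) (h2 : s'.nat 2 = s.nat 2)
    (h3 : s'.real 1 = s.real 1) (h4 : s'.real 0 = s.real 0) (h5 : s'.nat 3 = s.nat 3)
    (h6 : s'.real 10 = s.real 10) (h7 : s'.real 11 = s.real 11) : CopyCtx A ε x i s' :=
  ⟨by rw [h1, h2, h3]; exact h.sparse, by rw [h4]; exact h.eps, by rw [h5]; exact h.cur,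
    by rw [h6]; exact h.max, by rw [h7]; exact h.val⟩

theorem halts_copyCmd {m n : ℕ} {A : Matrix (Fin m) (Fin n) ℝ} (hA : IsCovering A) {ε : ℝ}
    {x : Fin n → ℝ} {i : Fin n} {s : Mem} (h : CopyCtx A ε x i s) (l : Fin (copies A i))
    (hpw : s.real 18 0 = 2 ^ (l : ℕ) * minPos A i)
    (hb : Built A ((1 + ε / 2) • lift A x) (baseIdx A i + l) s) :
    Halts copyCmd s [] ((s.nat 1 (i + 1) - s.nat 1 i) * 50 + 150)
      (fun s' => s'.real 18 0 = 2 ^ ((l : ℕ) + 1) * minPos A i ∧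
        Built A ((1 + ε / 2) • lift A x) (baseIdx A i + (l + 1)) s') := by
  have hT : 10 + (((s.nat 1 (i + 1) - s.nat 1 i) * 50 + 13) + (60 + (30 + (10 + 10)))) ≤
      (s.nat 1 (i + 1) - s.nat 1 i) * 50 + 150 := by omega
  refine Halts.mono (Q := fun s' => s'.real 18 0 = 2 ^ ((l : ℕ) + 1) * minPos A i ∧
        Built A ((1 + ε / 2) • lift A x) (baseIdx A i + (l + 1)) s') ?_ hT fun _ _ h => h
  have hKv := copyIdx_val A i l
  obtain ⟨k, hk⟩ : ∃ k, k = copyIdx A i l := ⟨_, rfl⟩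
  rw [← hk] at hKv
  obtain ⟨K, hK⟩ : ∃ K, K = baseIdx A i + (l : ℕ) := ⟨_, rfl⟩
  rw [← hK] at hKv
  rw [← hK] at hb
  have hK1 : baseIdx A i + ((l : ℕ) + 1) = K + 1 := by omega
  rw [hK1]
  set q := 2 ^ ((l : ℕ) + 1) * minPos A i with hq
  -- double the cap
  refine Halts.seq' (P := fun s' => s'.real 18 0 = q)
    (Halts.straight rfl (by simp) (by simp [hpw, hq, pow_succ]; ring)) fun s₁ hf₁ h₁ => ?_
  have c₁ : CopyCtx A ε x i s₁ := h.of_eq (hf₁.nat 1 rfl) (hf₁.nat 2 rfl) (hf₁.real 1 rfl)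
    (hf₁.real 0 rfl) (hf₁.nat 3 rfl) (hf₁.real 10 rfl) (hf₁.real 11 rfl)
  -- copy the entries
  have hcopy := halts_copyEntries c₁.sparse i c₁.cur
  rw [hf₁.nat 1 rfl, hf₁.nat 10 rfl, hf₁.nat 12 rfl, hf₁.real 12 rfl, hf₁.nat 2 rfl,
    hf₁.real 1 rfl, h₁] at hcopy
  refine Halts.seq' hcopy fun s₂ hf₂ h₂ => ?_
  have c₂ : CopyCtx A ε x i s₂ := c₁.of_eq (hf₂.nat 1 rfl) (hf₂.nat 2 rfl) (hf₂.real 1 rfl)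
    (hf₂.real 0 rfl) (hf₂.nat 3 rfl) (hf₂.real 10 rfl) (hf₂.real 11 rfl)
  have p₂ : s₂.real 18 0 = q := by rw [hf₂.real 18 rfl]; exact h₁
  have k₂ : s₂.nat 9 0 = K := by rw [hf₂.nat 9 rfl, hf₁.nat 9 rfl]; exact hb.count
  -- the starting point
  refine Halts.seq' (P := fun s' => s'.real 2 =
      Function.update (s.real 2) K ((1 + ε / 2) * lift A x k))
    (Halts.straight rfl (by simp) ?_) fun s₃ hf₃ h₃ => ?_
  · have hr2 : s₂.real 2 = s.real 2 := by rw [hf₂.real 2 rfl, hf₁.real 2 rfl]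
    rw [hk, lift_copyIdx]
    simp only [Cmd.eff, BExp.holds, RExp.eval, NExp.eval, nv, rv, p₂, k₂, c₂.max, c₂.val, c₂.eps,
      ← hq, Nat.cast_ofNat, Nat.cast_one, Nat.cast_zero, not_lt, not_and, liftVal]
    have hiff : (q < maxPos A i → 2 < min (x i) (1 / minPos A i) * (2 * q)) ↔
        (maxPos A i ≤ q ∨ 2 < min (x i) (1 / minPos A i) * (2 * q)) := by
      rw [← not_lt, imp_iff_not_or]
    have hiff' : (min (x i) (1 / minPos A i) * q ≤ 2 ∧
        ¬(q < maxPos A i ∧ ¬ 2 < min (x i) (1 / minPos A i) * (2 * q))) ↔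
        (min (x i) (1 / minPos A i) * q ≤ 2 ∧
        (maxPos A i ≤ q ∨ 2 < min (x i) (1 / minPos A i) * (2 * q))) := by
      rw [not_and, not_not, hiff]
    simp only [not_lt] at hiff'
    by_cases hc : min (x i) (1 / minPos A i) * q ≤ 2 ∧
        (maxPos A i ≤ q ∨ 2 < min (x i) (1 / minPos A i) * (2 * q))
    · rw [if_pos hc, if_pos (by simpa only [hiff, not_le, not_lt, not_and] using hc)]
      simp [hr2]
    · rw [if_neg hc, if_neg (by simpa only [hiff, not_le, not_lt, not_and] using hc)]
      simp [hr2]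
  have c₃ : CopyCtx A ε x i s₃ := c₂.of_eq (hf₃.nat 1 rfl) (hf₃.nat 2 rfl) (hf₃.real 1 rfl)
    (hf₃.real 0 rfl) (hf₃.nat 3 rfl) (hf₃.real 10 rfl) (hf₃.real 11 rfl)
  have p₃ : s₃.real 18 0 = q := by rw [hf₃.real 18 rfl]; exact p₂
  have k₃ : s₃.nat 9 0 = K := by rw [hf₃.nat 9 rfl]; exact k₂
  -- the column norm
  refine Halts.seq' (P := fun s' => s'.real 13 =
      Function.update (s.real 13) K (colNorm (reduced A) k))
    (Halts.straight rfl (by simp) ?_) fun s₄ hf₄ h₄ => ?_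
  · have hr13 : s₃.real 13 = s.real 13 := by
      rw [hf₃.real 13 rfl, hf₂.real 13 rfl, hf₁.real 13 rfl]
    rw [hk, hA.colNorm_reduced]
    simp only [Cmd.eff, BExp.holds, RExp.eval, NExp.eval, nv, rv, p₃, k₃, c₃.max, ← hq]
    split_ifs with hc
    · simp [hr13, min_eq_right hc.le]
    · simp [hr13, min_eq_left (not_lt.1 hc)]
  have k₄ : s₄.nat 9 0 = K := by rw [hf₄.nat 9 rfl]; exact k₃
  -- the counters
  refine Halts.seq' (P := fun s' => s'.nat 9 0 = K + 1)
    (Halts.straight rfl (by simp) (by simp [k₄])) fun s₅ hf₅ h₅ => ?_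
  refine Halts.straight rfl (by simp) ?_
  obtain ⟨h₂a, h₂b, h₂c⟩ := h₂
  have hlen : s.nat 1 i ≤ s.nat 1 (i + 1) := h.sparse.ptr_mono i i.2
  obtain ⟨len, hlend⟩ : ∃ len, len = s.nat 1 (i + 1) - s.nat 1 i := ⟨_, rfl⟩
  rw [← hlend] at h₂a h₂c
  have f10 : s₅.nat 10 0 = s.nat 10 0 + len := by
    rw [hf₅.nat 10 rfl, hf₄.nat 10 rfl, hf₃.nat 10 rfl]; exact h₂a
  simp only [Cmd.eff, NExp.eval, nv, h₅, f10]
  set t := s₅.setNat 11 (K + 1) (s.nat 10 0 + len) with ht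
  have t9 : t.nat 9 0 = K + 1 := by simp [ht, h₅]
  have t10 : t.nat 10 0 = s.nat 10 0 + len := by simp [ht, f10]
  have t11 : t.nat 11 = Function.update (s.nat 11) (K + 1) (s.nat 10 0 + len) := by
    simp only [ht, Mem.setNat_nat, if_true]
    rw [hf₅.nat 11 rfl, hf₄.nat 11 rfl, hf₃.nat 11 rfl, hf₂.nat 11 rfl, hf₁.nat 11 rfl]
  have t12 : t.nat 12 = s₂.nat 12 := by
    have : t.nat 12 = s₅.nat 12 := by simp [ht]
    rw [this, hf₅.nat 12 rfl, hf₄.nat 12 rfl, hf₃.nat 12 rfl]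
  have r12 : t.real 12 = s₂.real 12 := by
    change s₅.real 12 = _
    rw [hf₅.real 12 rfl, hf₄.real 12 rfl, hf₃.real 12 rfl]
  have r13 : t.real 13 = Function.update (s.real 13) K (colNorm (reduced A) k) := by
    change s₅.real 13 = _
    rw [hf₅.real 13 rfl]; exact h₄
  have r2 : t.real 2 = Function.update (s.real 2) K ((1 + ε / 2) * lift A x k) := by
    change s₅.real 2 = _
    rw [hf₅.real 2 rfl, hf₄.real 2 rfl]; exact h₃
  have r18 : t.real 18 0 = q := by
    change s₅.real 18 0 = _
    rw [hf₅.real 18 rfl, hf₄.real 18 rfl]; exact p₃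
  refine ⟨r18, t9, ?_, ?_, ?_⟩
  · rw [t11, Function.update_of_ne (by omega)]; exact hb.zero
  · rw [t10, t11, Function.update_self]
  · intro k' hk'
    rcases Nat.lt_succ_iff_lt_or_eq.1 hk' with h6 | h6
    · refine (hb.col k' h6).of_eq ?_ ?_ (by omega) ?_ ?_ ?_
      · rw [t11, Function.update_of_ne (by omega)]
      · rw [t11, Function.update_of_ne (by omega)]
      · intro e he
        rw [t12, r12]
        exact h₂b e he
      · rw [r13, Function.update_of_ne (by omega)]
      · rw [r2, Function.update_of_ne (by omega)]
    · have hkk : k' = k := Fin.ext (by omega)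
      subst hkk
      have hptr : t.nat 11 k' = s.nat 10 0 := by
        rw [t11, h6, Function.update_of_ne (by omega), hb.cur]
      have hptr' : t.nat 11 (k' + 1) = s.nat 10 0 + len := by
        rw [t11, h6, Function.update_self]
      have hne : ∀ j, reduced A j k' ≠ 0 ↔ A j i ≠ 0 := fun j => by
        rw [hk]; exact hA.reduced_ne_zero_iff j i l
      refine ⟨by omega, by omega, ?_, ?_, ?_, ?_⟩
      · rw [hptr, hptr', t12]
        have hcol := h.sparse.index i
        simp only [hne]
        refine ⟨?_, ?_, ?_⟩
        · intro e he
          obtain ⟨d, rfl⟩ : ∃ d, e = s.nat 10 0 + d := ⟨e - s.nat 10 0, by have := he.1; omega⟩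
          have hd : d < len := by have := he.2; omega
          rw [(h₂c d hd).1]
          exact hcol.mapsTo ⟨by omega, by omega⟩
        · intro e he e' he' hee
          obtain ⟨d, rfl⟩ : ∃ d, e = s.nat 10 0 + d := ⟨e - s.nat 10 0, by have := he.1; omega⟩
          obtain ⟨d', rfl⟩ : ∃ d, e' = s.nat 10 0 + d :=
            ⟨e' - s.nat 10 0, by have := he'.1; omega⟩
          have hd : d < len := by have := he.2; omega
          have hd' : d' < len := by have := he'.2; omega
          rw [(h₂c d hd).1, (h₂c d' hd').1] at hee
          have := hcol.injOn (x₁ := s.nat 1 i + d) (x₂ := s.nat 1 i + d')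
            ⟨by omega, by omega⟩ ⟨by omega, by omega⟩ hee
          omega
        · intro j hj
          obtain ⟨e, he, hej⟩ := hcol.surjOn hj
          have h7 := he.1
          have h8 := he.2
          refine ⟨s.nat 10 0 + (e - s.nat 1 i), ⟨by omega, by omega⟩, ?_⟩
          rw [(h₂c _ (by omega)).1, show s.nat 1 i + (e - s.nat 1 i) = e by omega]
          exact hej
      · intro e h7 h8 j hj
        rw [hptr] at h7
        rw [hptr'] at h8
        obtain ⟨d, rfl⟩ : ∃ d, e = s.nat 10 0 + d := ⟨e - s.nat 10 0, by omega⟩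
        have hd : d < len := by omega
        rw [t12, (h₂c d hd).1] at hj
        rw [r12, (h₂c d hd).2, hk, reduced_copyIdx,
          h.sparse.value i (s.nat 1 i + d) (by omega) (by omega) j hj]
      · rw [r13, h6, Function.update_self]
      · rw [r2, h6, Function.update_self]
        rfl

theorem IsCovering.nnz_reduced {m n : ℕ} {A : Matrix (Fin m) (Fin n) ℝ} (hA : IsCovering A) :
    nnz (reduced A) = ∑ i, copies A i * (Finset.univ.filter fun j => A j i ≠ 0).card := by
  rw [nnz_eq_sum, sum_redDim]
  refine Finset.sum_congr rfl fun i _ => ?_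
  simp only [hA.reduced_ne_zero_iff]
  simp

/-- Build all copies of the current column. -/
def columnCmd : Cmd :=
  .seq minMaxCmd
  (.seq (.ite (.realLt (.div (.ofNat (.const 1)) (rv 9)) (.get 6 (nv 3)))
    (.setReal 11 (.const 0) (.div (.ofNat (.const 1)) (rv 9)))
    (.setReal 11 (.const 0) (.get 6 (nv 3))))
  (.seq (.setReal 18 (.const 0) (rv 9))
  (forLoop 8 (.const 0) (.not (.and (.not (.natLt (nv 8) (.const 1)))
    (.not (.realLt (rv 18) (rv 10))))) copyCmd)))

theorem Built.setNat {m n : ℕ} {A : Matrix (Fin m) (Fin n) ℝ} {x₀ : Fin (redDim A) → ℝ} {K : ℕ}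
    {s : Mem} (h : Built A x₀ K s) {a : ℕ} (ha : a < 9) (i v : ℕ) :
    Built A x₀ K (s.setNat a i v) := by
  have e : ∀ b, 9 ≤ b → (s.setNat a i v).nat b = s.nat b := fun b hb => by
    rw [Mem.setNat_nat, if_neg (by omega)]
  refine ⟨by rw [e 9 le_rfl]; exact h.count, by rw [e 11 (by omega)]; exact h.zero,
    by rw [e 10 (by omega), e 11 (by omega)]; exact h.cur, fun k hk => ?_⟩
  refine (h.col k hk).of_eq ?_ ?_ ?_ ?_ rfl rfl
  · rw [e 11 (by omega)]
  · rw [e 11 (by omega)]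
  · rw [e 10 (by omega)]
  · intro _ _
    rw [e 12 (by omega)]
    exact ⟨rfl, rfl⟩

theorem Built.of_eq {m n : ℕ} {A : Matrix (Fin m) (Fin n) ℝ} {x₀ : Fin (redDim A) → ℝ} {K : ℕ}
    {s s' : Mem} (h : Built A x₀ K s) (h9 : s'.nat 9 = s.nat 9) (h10 : s'.nat 10 = s.nat 10)
    (h11 : s'.nat 11 = s.nat 11) (h12 : s'.nat 12 = s.nat 12) (h12' : s'.real 12 = s.real 12)
    (h13 : s'.real 13 = s.real 13) (h2 : s'.real 2 = s.real 2) : Built A x₀ K s' := by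
  refine ⟨by rw [h9]; exact h.count, by rw [h11]; exact h.zero,
    by rw [h10, h11]; exact h.cur, fun k hk => ?_⟩
  exact (h.col k hk).of_eq (by rw [h11]) (by rw [h11]) (by rw [h10])
    (fun _ _ => by rw [h12, h12']; exact ⟨rfl, rfl⟩) (by rw [h13]) (by rw [h2])

theorem halts_columnCmd {m n : ℕ} {A : Matrix (Fin m) (Fin n) ℝ} (hA : IsCovering A) {ε : ℝ}
    {x : Fin n → ℝ} (i : Fin n) {s : Mem} (hs : Sparse A (s.nat 1) (s.nat 2) (s.real 1))
    (hε : s.real 0 0 = ε) (hi : s.nat 3 0 = i) (hx : s.real 6 i = x i)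
    (hb : Built A ((1 + ε / 2) • lift A x) (baseIdx A i) s) :
    Halts columnCmd s [] (400 * (copies A i * (s.nat 1 (i + 1) - s.nat 1 i)))
      (Built A ((1 + ε / 2) • lift A x) (baseIdx A (i + 1))) := by
  have hne : 1 ≤ s.nat 1 (i + 1) - s.nat 1 i := by
    obtain ⟨j, hj⟩ := hA.col i
    obtain ⟨e, h1, h2, _⟩ := hs.exists_entry i hj
    omega
  obtain ⟨len, hlen⟩ : ∃ len, len = s.nat 1 (i + 1) - s.nat 1 i := ⟨_, rfl⟩
  rw [← hlen] at hne ⊢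
  have hT : (len * 50 + 30) + (30 + (10 + (copies A i * ((len * 50 + 150) + 13 + 6) + 16))) ≤
      400 * (copies A i * len) := by
    have hc := IsCovering.one_le_copies A i
    nlinarith [Nat.mul_le_mul hc hne, Nat.mul_le_mul hc (le_refl len),
      Nat.mul_le_mul (le_refl (copies A i)) hne]
  refine Halts.mono (Q := Built A ((1 + ε / 2) • lift A x) (baseIdx A (i + 1))) ?_ hT
    fun _ _ h => h
  have hmm := halts_minMaxCmd hA hs i hi
  rw [← hlen] at hmm
  refine Halts.seq' hmm fun s₁ hf₁ h₁ => ?_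
  have b₁ := hb.of_eq (hf₁.nat 9 rfl) (hf₁.nat 10 rfl) (hf₁.nat 11 rfl) (hf₁.nat 12 rfl)
    (hf₁.real 12 rfl) (hf₁.real 13 rfl) (hf₁.real 2 rfl)
  have x₁ : s₁.real 6 i = x i := by rw [hf₁.real 6 rfl]; exact hx
  have i₁ : s₁.nat 3 0 = i := by rw [hf₁.nat 3 rfl]; exact hi
  refine Halts.seq' (P := fun s' => s'.real 11 0 = min (x i) (1 / minPos A i))
    (Halts.straight rfl (by simp) ?_) fun s₂ hf₂ h₂ => ?_
  · simp only [Cmd.eff, BExp.holds, RExp.eval, NExp.eval, nv, rv, i₁, x₁, h₁.1, Nat.cast_one]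
    split_ifs with hc
    · rw [min_eq_right hc.le]; simp
    · rw [min_eq_left (not_lt.1 hc)]; simp
  have b₂ := b₁.of_eq (hf₂.nat 9 rfl) (hf₂.nat 10 rfl) (hf₂.nat 11 rfl) (hf₂.nat 12 rfl)
    (hf₂.real 12 rfl) (hf₂.real 13 rfl) (hf₂.real 2 rfl)
  refine Halts.seq' (P := fun s' => s'.real 18 0 = 2 ^ 0 * minPos A i)
    (Halts.straight rfl (by simp) ?_) fun s₃ hf₃ h₃ => ?_
  · simp [hf₂.real 9 rfl, h₁.1]
  have b₃ := b₂.of_eq (hf₃.nat 9 rfl) (hf₃.nat 10 rfl) (hf₃.nat 11 rfl) (hf₃.nat 12 rfl)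
    (hf₃.real 12 rfl) (hf₃.real 13 rfl) (hf₃.real 2 rfl)
  have e1 : s₃.nat 1 = s.nat 1 := by rw [hf₃.nat 1 rfl, hf₂.nat 1 rfl, hf₁.nat 1 rfl]
  have e2 : s₃.nat 2 = s.nat 2 := by rw [hf₃.nat 2 rfl, hf₂.nat 2 rfl, hf₁.nat 2 rfl]
  have er1 : s₃.real 1 = s.real 1 := by rw [hf₃.real 1 rfl, hf₂.real 1 rfl, hf₁.real 1 rfl]
  have c₃ : CopyCtx A ε x i s₃ :=
    ⟨by rw [e1, e2, er1]; exact hs,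
      by rw [hf₃.real 0 rfl, hf₂.real 0 rfl, hf₁.real 0 rfl]; exact hε,
      by rw [hf₃.nat 3 rfl, hf₂.nat 3 rfl]; exact i₁,
      by rw [hf₃.real 10 rfl, hf₂.real 10 rfl]; exact h₁.2,
      by rw [hf₃.real 11 rfl]; exact h₂⟩
  refine Halts.mono (halts_forLoop_const 0 (copies A i) (len * 50 + 150)
    (fun l s' => s'.real 18 0 = 2 ^ l * minPos A i ∧
      Built A ((1 + ε / 2) • lift A x) (baseIdx A i + l) s')
    rfl (Nat.zero_le _) rfl (fun l s' _ _ hf hl hI => ?_)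
    (fun l s' l' h => ⟨h.1, h.2.setNat (by omega) _ _⟩) ⟨h₃, b₃⟩ fun l s' _ hl hf hv hI => ?_)
    le_rfl fun s' _ h => ?_
  · have c' : s'.real 10 0 = maxPos A i := by rw [hf.real 10 rfl]; exact c₃.max
    rw [hA.lt_copies_iff]
    simp only [BExp.holds, RExp.eval, NExp.eval, nv, rv, hl, hI.1, c']
    tauto
  · have c' : CopyCtx A ε x i s' := c₃.of_eq (hf.nat 1 rfl) (hf.nat 2 rfl) (hf.real 1 rfl)
      (hf.real 0 rfl) (hf.nat 3 rfl) (hf.real 10 rfl) (hf.real 11 rfl)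
    have := halts_copyCmd hA c' ⟨l, hl⟩ hI.1 hI.2
    rw [hf.nat 1 rfl, e1, ← hlen] at this
    exact this
  · rw [baseIdx_succ]; exact h.2

/-- Build the reduced matrix and the starting point. -/
def buildCmd : Cmd :=
  .seq (.setNat 9 (.const 0) (.const 0)) (.seq (.setNat 10 (.const 0) (.const 0))
  (.seq (.setNat 11 (.const 0) (.const 0)) (forN 3 (nv 0) columnCmd)))

theorem halts_buildCmd {m n : ℕ} {A : Matrix (Fin m) (Fin n) ℝ} (hA : IsCovering A) {ε : ℝ}
    {x : Fin n → ℝ} {s : Mem} (hs : Sparse A (s.nat 1) (s.nat 2) (s.real 1))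
    (hn : s.nat 0 0 = n) (hε : s.real 0 0 = ε) (hx : ∀ i : Fin n, s.real 6 i = x i) :
    Halts buildCmd s [] (400 * nnz (reduced A) + 11 * n + 20)
      (Built A ((1 + ε / 2) • lift A x) (redDim A)) := by
  have hT : 3 + (3 + (3 + (∑ k ∈ Finset.range n,
      (400 * ((if h : k < n then copies A ⟨k, h⟩ else 0) * (s.nat 1 (k + 1) - s.nat 1 k)) + 11)
      + 8))) ≤ 400 * nnz (reduced A) + 11 * n + 20 := by
    have e : ∑ k ∈ Finset.range n,
        (400 * ((if h : k < n then copies A ⟨k, h⟩ else 0) * (s.nat 1 (k + 1) - s.nat 1 k)) + 11)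
        = 400 * nnz (reduced A) + 11 * n := by
      rw [Finset.sum_add_distrib, ← Finset.mul_sum, hA.nnz_reduced, Finset.sum_range]
      simp only [Fin.is_lt, dif_pos, Fin.eta, hs.card_col, Finset.sum_const, Finset.card_range,
        smul_eq_mul]
      ring
    omega
  refine Halts.mono (Q := Built A ((1 + ε / 2) • lift A x) (redDim A)) ?_ hT fun _ _ h => h
  refine Halts.seq' (P := fun s' => s'.nat 9 0 = 0) (Halts.straight rfl (by simp) (by simp))
    fun s₁ hf₁ h₁ => ?_
  refine Halts.seq' (P := fun s' => s'.nat 10 0 = 0) (Halts.straight rfl (by simp) (by simp))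
    fun s₂ hf₂ h₂ => ?_
  refine Halts.seq' (P := fun s' => s'.nat 11 0 = 0) (Halts.straight rfl (by simp) (by simp))
    fun s₃ hf₃ h₃ => ?_
  have e0 : s₃.nat 0 = s.nat 0 := by rw [hf₃.nat 0 rfl, hf₂.nat 0 rfl, hf₁.nat 0 rfl]
  have e1 : s₃.nat 1 = s.nat 1 := by rw [hf₃.nat 1 rfl, hf₂.nat 1 rfl, hf₁.nat 1 rfl]
  have e2 : s₃.nat 2 = s.nat 2 := by rw [hf₃.nat 2 rfl, hf₂.nat 2 rfl, hf₁.nat 2 rfl]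
  have er1 : s₃.real 1 = s.real 1 := by rw [hf₃.real 1 rfl, hf₂.real 1 rfl, hf₁.real 1 rfl]
  have er0 : s₃.real 0 = s.real 0 := by rw [hf₃.real 0 rfl, hf₂.real 0 rfl, hf₁.real 0 rfl]
  have er6 : s₃.real 6 = s.real 6 := by rw [hf₃.real 6 rfl, hf₂.real 6 rfl, hf₁.real 6 rfl]
  have h9 : s₃.nat 9 0 = 0 := by rw [hf₃.nat 9 rfl, hf₂.nat 9 rfl]; exact h₁
  have h10 : s₃.nat 10 0 = 0 := by rw [hf₃.nat 10 rfl]; exact h₂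
  refine Halts.mono (halts_forN n _ (fun k => Built A ((1 + ε / 2) • lift A x) (baseIdx A k))
    rfl rfl (fun s' hf => ?_) (fun k s' k' h => h.setNat (by omega) _ _)
    ⟨by simpa [baseIdx] using h9, h₃, by simp [baseIdx, h10, h₃], fun k hk => by
      simp [baseIdx] at hk⟩
    fun k s' hk hf hv hI => ?_) le_rfl fun s' _ h => ?_
  · simp only [NExp.eval, nv]; rw [hf.nat 0 rfl, e0]; exact hn
  · have := halts_columnCmd hA (x := x) (ε := ε) ⟨k, hk⟩ (s := s')
      (by rw [hf.nat 1 rfl, hf.nat 2 rfl, hf.real 1 rfl, e1, e2, er1]; exact hs)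
      (by rw [hf.real 0 rfl, er0]; exact hε) hv
      (by rw [hf.real 6 rfl, er6]; exact hx _) hI
    rw [dif_pos hk]
    rw [hf.nat 1 rfl, e1] at this
    exact this
  · have h' : Built A ((1 + ε / 2) • lift A x) (baseIdx A n) s' := h
    rwa [baseIdx_n] at h'

/-- The program which computes the starting point. -/
def startCmd : Cmd := .seq solveCmd buildCmd

/-- The bound for the running time of `startCmd`. -/
def startTime {m n : ℕ} (A : Matrix (Fin m) (Fin n) ℝ) : ℕ :=
  100 * (nnz A + n + m + 1) +
    coverPhases m n * (coverRounds m n * (100 * (nnz A + n + m + 1) + 18) + 50) +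
    (400 * nnz (reduced A) + 11 * n + 20)

theorem halts_startCmd {m n : ℕ} {A : Matrix (Fin m) (Fin n) ℝ} (hA : IsCovering A) {ε : ℝ}
    {s : Mem} (hs : IsInput A ε s) :
    Halts startCmd s [] (startTime A)
      (Built A ((1 + ε / 2) • lift A (coverRun A (coverPhases m n))) (redDim A)) := by
  refine Halts.seq' (halts_solveCmd hs.cols hs.rows hs.sparse) fun s₁ hf₁ h₁ => ?_
  exact halts_buildCmd hA (by rw [hf₁.nat 1 rfl, hf₁.nat 2 rfl, hf₁.real 1 rfl]; exact hs.sparse)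
    (by rw [hf₁.nat 0 rfl]; exact hs.cols) (by rw [hf₁.real 0 rfl]; exact hs.eps) h₁

/-! ### The iterations as a program -/

/-- The iteration when `y` is represented as `z + θ w`, where `θ` is the power of `1 - τ`
belonging to the round. Then `x = z + θ' w` with the next `θ'`, and both `z` and `w` change in the
selected coordinate only. -/
theorem Setup.iterate_dir {m n : ℕ} {A : Matrix (Fin m) (Fin n) ℝ} {ε : ℝ} (h : Setup A ε) (k : ℕ)
    (i : Fin n) {z : Fin n → ℝ} (hz : z ∈ box A) (w : Fin n → ℝ) {θ p : ℝ}
    (hθ : θ = (1 - tau m n ε) ^ (k + 1))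
    (hp : p = clip (3 / colNorm A i) (z i -
      trunc (smoothGrad A (mu m n ε) (z + θ • w) i) / (lip m n ε * θ) / colNorm A i)) :
    iterate A ε (k + 1) i (z + (1 - tau m n ε) ^ k • w, z) =
      (Function.update z i p + θ • (w + Pi.single i ((p - z i) * (1 - 1 / θ))),
        Function.update z i p) := by
  have h1 := h.one_sub_tau_pos
  have h2 := h.lip_pos
  have h3 := h.one_le_n
  have hθ0 : 0 < θ := by rw [hθ]; positivity
  have hx : tau m n ε • z + (1 - tau m n ε) • (z + (1 - tau m n ε) ^ k • w) = z + θ • w := by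
    funext i'
    simp only [Pi.add_apply, Pi.smul_apply, smul_eq_mul, hθ, pow_succ]
    ring
  have hα : n * alpha m n ε (k + 1) = 1 / (lip m n ε * θ) := by
    rw [h.alpha_eq, ← hθ]
    field_simp
  have := h.iterate_eq (k + 1) i (y := z + (1 - tau m n ε) ^ k • w) hz
  simp only [hx, hα] at this
  have e : 1 / (lip m n ε * θ) * trunc (smoothGrad A (mu m n ε) (z + θ • w) i) / colNorm A i =
      trunc (smoothGrad A (mu m n ε) (z + θ • w) i) / (lip m n ε * θ) / colNorm A i := by ring
  rw [e, ← hp] at this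
  rw [this]
  congr 1
  funext i'
  rcases eq_or_ne i' i with rfl | hi
  · simp only [Pi.add_apply, Pi.smul_apply, smul_eq_mul, Pi.single_eq_same, Function.update_self]
    field_simp
    ring
  · simp [hi]

/-- The data which the iterations read but do not change. -/
structure MainCtx {m n : ℕ} (B : Matrix (Fin m) (Fin n) ℝ) (ε : ℝ) (s : Mem) : Prop where
  count : s.nat 9 0 = n
  sparse : Sparse B (s.nat 11) (s.nat 12) (s.real 12)
  norm : ∀ i : Fin n, s.real 13 i = colNorm B i
  mu : s.real 19 0 = mu m n ε
  lip : s.real 20 0 = lip m n ε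
  tau : s.real 21 0 = tau m n ε

theorem MainCtx.of_eq {m n : ℕ} {B : Matrix (Fin m) (Fin n) ℝ} {ε : ℝ} {s s' : Mem}
    (h : MainCtx B ε s) (h9 : s'.nat 9 = s.nat 9) (h11 : s'.nat 11 = s.nat 11)
    (h12 : s'.nat 12 = s.nat 12) (h12' : s'.real 12 = s.real 12) (h13 : s'.real 13 = s.real 13)
    (h19 : s'.real 19 = s.real 19) (h20 : s'.real 20 = s.real 20) (h21 : s'.real 21 = s.real 21) :
    MainCtx B ε s' :=
  ⟨by rw [h9]; exact h.count, by rw [h11, h12, h12']; exact h.sparse, by rw [h13]; exact h.norm,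
    by rw [h19]; exact h.mu, by rw [h20]; exact h.lip, by rw [h21]; exact h.tau⟩

/-- The vectors `z` and `w` together with their products with the matrix. -/
structure MainState {m n : ℕ} (B : Matrix (Fin m) (Fin n) ℝ) (z w : Fin n → ℝ) (s : Mem) :
    Prop where
  point : ∀ i : Fin n, s.real 2 i = z i
  dir : ∀ i : Fin n, s.real 16 i = w i
  point_rows : ∀ j : Fin m, s.real 14 j = (B *ᵥ z) j
  dir_rows : ∀ j : Fin m, s.real 15 j = (B *ᵥ w) j

/-- The update of the selected coordinate, whose number is in integer variable `13`, from the
partial sum in real variable `7`. -/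
def coordCmd : Cmd :=
  .seq (.setReal 23 (.const 0) (.sub (.ofNat (.const 1)) (rv 7)))
  (.seq (.ite (.realLt (rv 23) (.sub (.ofNat (.const 0)) (.ofNat (.const 1))))
    (.setReal 23 (.const 0) (.sub (.ofNat (.const 0)) (.ofNat (.const 1))))
    (.ite (.realLt (.ofNat (.const 1)) (rv 23)) (.setReal 23 (.const 0) (.ofNat (.const 1))) .skip))
  (.seq (.setReal 24 (.const 0) (.sub (.get 2 (nv 13))
    (.div (.div (rv 23) (.mul (rv 20) (rv 17))) (.get 13 (nv 13)))))
  (.seq (.ite (.realLt (rv 24) (.ofNat (.const 0))) (.setReal 24 (.const 0) (.ofNat (.const 0)))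
    (.ite (.realLt (.div (.ofNat (.const 3)) (.get 13 (nv 13))) (rv 24))
      (.setReal 24 (.const 0) (.div (.ofNat (.const 3)) (.get 13 (nv 13)))) .skip))
  (.seq (.setReal 25 (.const 0) (.sub (rv 24) (.get 2 (nv 13))))
  (.seq (.setReal 26 (.const 0) (.mul (rv 25) (.sub (.ofNat (.const 1))
    (.div (.ofNat (.const 1)) (rv 17)))))
  (.seq (.setReal 2 (nv 13) (rv 24))
    (.setReal 16 (nv 13) (.plus (.get 16 (nv 13)) (rv 26)))))))))

/-- Here `G` is the partial derivative, `p` the new value of the coordinate and `d` its change. -/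
theorem halts_coordCmd {s : Mem} {i : ℕ} {L θ c p d G : ℝ} (hi : s.nat 13 0 = i)
    (h7 : 1 - s.real 7 0 = G) (h20 : s.real 20 0 = L) (h17 : s.real 17 0 = θ)
    (h13 : s.real 13 i = c)
    (hp : p = clip (3 / c) (s.real 2 i - trunc G / (L * θ) / c)) (hd : d = p - s.real 2 i) :
    Halts coordCmd s [] 300 (fun s' => s'.real 25 0 = d ∧ s'.real 26 0 = d * (1 - 1 / θ) ∧
      s'.real 2 = Function.update (s.real 2) i p ∧
      s'.real 16 = Function.update (s.real 16) i (s.real 16 i + d * (1 - 1 / θ))) := by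
  have hT : 10 + (50 + (20 + (60 + (20 + (20 + (10 + 20)))))) ≤ 300 := by norm_num
  refine Halts.mono (Q := fun s' => s'.real 25 0 = d ∧ s'.real 26 0 = d * (1 - 1 / θ) ∧
      s'.real 2 = Function.update (s.real 2) i p ∧
      s'.real 16 = Function.update (s.real 16) i (s.real 16 i + d * (1 - 1 / θ))) ?_ hT
    fun _ _ h => h
  refine Halts.seq' (P := fun s' => s'.real 23 0 = G)
    (Halts.straight rfl (by simp) (by simp [h7])) fun s₁ f₁ h₁ => ?_
  refine Halts.seq' (P := fun s' => s'.real 23 0 = trunc G)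
    (Halts.straight rfl (by simp) ?_) fun s₂ f₂ h₂ => ?_
  · simp only [Cmd.eff, BExp.holds, RExp.eval, NExp.eval, rv, h₁, trunc, gt_iff_lt, Nat.cast_one,
      Nat.cast_zero, zero_sub]
    split_ifs <;> simp [h₁]
  refine Halts.seq' (P := fun s' => s'.real 24 0 = s.real 2 i - trunc G / (L * θ) / c)
    (Halts.straight rfl (by simp) ?_) fun s₃ f₃ h₃ => ?_
  · simp only [Cmd.eff, RExp.eval, NExp.eval, rv, nv, h₂, f₂.nat 13 rfl, f₁.nat 13 rfl,
      f₂.real 2 rfl, f₁.real 2 rfl, f₂.real 20 rfl, f₁.real 20 rfl, f₂.real 17 rfl, f₁.real 17 rfl,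
      f₂.real 13 rfl, f₁.real 13 rfl, hi, h20, h17, h13]
    simp
  have i₃ : s₃.nat 13 0 = i := by rw [f₃.nat 13 rfl, f₂.nat 13 rfl, f₁.nat 13 rfl, hi]
  have c₃ : s₃.real 13 i = c := by rw [f₃.real 13 rfl, f₂.real 13 rfl, f₁.real 13 rfl, h13]
  have p₃ : s₃.real 2 = s.real 2 := by rw [f₃.real 2 rfl, f₂.real 2 rfl, f₁.real 2 rfl]
  have w₃ : s₃.real 16 = s.real 16 := by rw [f₃.real 16 rfl, f₂.real 16 rfl, f₁.real 16 rfl]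
  have t₃ : s₃.real 17 0 = θ := by rw [f₃.real 17 rfl, f₂.real 17 rfl, f₁.real 17 rfl, h17]
  refine Halts.seq' (P := fun s' => s'.real 24 0 = p)
    (Halts.straight rfl (by simp) ?_) fun s₄ f₄ h₄ => ?_
  · simp only [Cmd.eff, BExp.holds, RExp.eval, NExp.eval, rv, nv, h₃, i₃, c₃, hp, clip,
      Nat.cast_zero, Nat.cast_ofNat]
    split_ifs <;> simp [h₃]
  refine Halts.seq' (P := fun s' => s'.real 25 0 = d)
    (Halts.straight rfl (by simp) ?_) fun s₅ f₅ h₅ => ?_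
  · simp only [Cmd.eff, RExp.eval, NExp.eval, rv, nv, h₄, f₄.nat 13 rfl, i₃, f₄.real 2 rfl, p₃, hd]
    simp
  refine Halts.seq' (P := fun s' => s'.real 26 0 = d * (1 - 1 / θ))
    (Halts.straight rfl (by simp) ?_) fun s₆ f₆ h₆ => ?_
  · simp only [Cmd.eff, RExp.eval, NExp.eval, rv, h₅, f₅.real 17 rfl, f₄.real 17 rfl, t₃,
      Nat.cast_one]
    simp
  have i₆ : s₆.nat 13 0 = i := by rw [f₆.nat 13 rfl, f₅.nat 13 rfl, f₄.nat 13 rfl, i₃]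
  have p₆ : s₆.real 24 0 = p := by rw [f₆.real 24 rfl, f₅.real 24 rfl, h₄]
  refine Halts.seq' (P := fun s' => s'.real 2 = Function.update (s.real 2) i p)
    (Halts.straight rfl (by simp) ?_) fun s₇ f₇ h₇ => ?_
  · simp only [Cmd.eff, RExp.eval, NExp.eval, rv, nv, i₆, p₆, Mem.setReal_real, if_true,
      f₆.real 2 rfl, f₅.real 2 rfl, f₄.real 2 rfl, p₃]
  refine Halts.straight rfl (by simp) ⟨?_, ?_, ?_, ?_⟩
  · simp [f₇.real 25 rfl, f₆.real 25 rfl, h₅]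
  · simp [f₇.real 26 rfl, h₆]
  · simp [h₇]
  · simp only [Cmd.eff, RExp.eval, NExp.eval, rv, nv, f₇.nat 13 rfl, i₆, Mem.setReal_real, if_true,
      f₇.real 16 rfl, f₆.real 16 rfl, f₅.real 16 rfl, f₄.real 16 rfl, w₃, f₇.real 26 rfl, h₆]

/-- One iteration: draw a coordinate, evaluate the partial derivative, update. -/
def iterCmd : Cmd :=
  .seq (.setReal 17 (.const 0) (.mul (rv 17) (.sub (.ofNat (.const 1)) (rv 21))))
  (.seq (.rand 13 (.const 0) (nv 9))
  (.seq (gather 11 12 13 (.exp (.div (.sub (.ofNat (.const 1))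
    (.plus (.get 14 (.get 12 (nv 4))) (.mul (rv 17) (.get 15 (.get 12 (nv 4)))))) (rv 19))))
  (.seq coordCmd
  (.seq (scatter 11 12 12 14 13 (rv 25)) (scatter 11 12 12 15 13 (rv 26))))))

theorem mulVec_update_add {m n : ℕ} (B : Matrix (Fin m) (Fin n) ℝ) (z : Fin n → ℝ) (i : Fin n)
    (p : ℝ) (j : Fin m) : (B *ᵥ Function.update z i p) j = (B *ᵥ z) j + B j i * (p - z i) := by
  have e : Function.update z i p = z + Pi.single i (p - z i) := by
    funext i'
    rcases eq_or_ne i' i with rfl | hi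
    · simp
    · simp [hi]
  rw [e, mulVec_add_single]

theorem halts_iterCmd {m n : ℕ} {B : Matrix (Fin m) (Fin n) ℝ} {ε : ℝ} {s : Mem}
    (h : MainCtx B ε s) {z w : Fin n → ℝ} (hz : MainState B z w s) (i : Fin n) {θ p : ℝ}
    (hθ : s.real 17 0 * (1 - tau m n ε) = θ)
    (hp : p = clip (3 / colNorm B i) (z i -
      trunc (smoothGrad B (mu m n ε) (z + θ • w) i) / (lip m n ε * θ) / colNorm B i)) :
    Halts iterCmd s [(n, (i : ℕ))] (200 * (s.nat 11 (i + 1) - s.nat 11 i) + 400)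
      (fun s' => s'.real 17 0 = θ ∧ MainState B (Function.update z i p)
        (w + Pi.single i ((p - z i) * (1 - 1 / θ))) s') := by
  obtain ⟨len, hlen⟩ : ∃ len, len = s.nat 11 (i + 1) - s.nat 11 i := ⟨_, rfl⟩
  rw [← hlen]
  have hT : 20 + (10 + ((len * (23 + 20) + 17) + (300 + ((len * (27 + 2) + 13) +
      (len * (27 + 2) + 13))))) ≤ 200 * len + 400 := by omega
  refine Halts.mono (Q := fun s' => s'.real 17 0 = θ ∧ MainState B (Function.update z i p)
        (w + Pi.single i ((p - z i) * (1 - 1 / θ))) s') ?_ hT fun _ _ h => h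
  refine Halts.seq' (P := fun s' => s'.real 17 0 = θ)
    (Halts.straight rfl (by simp) (by simp [h.tau, hθ])) fun s₁ f₁ h₁ => ?_
  have c₁ : MainCtx B ε s₁ := h.of_eq (f₁.nat 9 rfl) (f₁.nat 11 rfl) (f₁.nat 12 rfl)
    (f₁.real 12 rfl) (f₁.real 13 rfl) (f₁.real 19 rfl) (f₁.real 20 rfl) (f₁.real 21 rfl)
  have hds : [(n, (i : ℕ))] = [(n, (i : ℕ))] ++ [] := rfl
  rw [hds]
  refine Halts.seq (P := fun s' => s'.nat 13 0 = i)
    (Halts.rand (by simpa using c₁.count) i.2 (by simp) (by simp)) fun s₂ f₂ h₂ => ?_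
  have c₂ : MainCtx B ε s₂ := c₁.of_eq (f₂.nat 9 rfl) (f₂.nat 11 rfl) (f₂.nat 12 rfl)
    (f₂.real 12 rfl) (f₂.real 13 rfl) (f₂.real 19 rfl) (f₂.real 20 rfl) (f₂.real 21 rfl)
  have hptr : s₂.nat 11 = s.nat 11 := by rw [f₂.nat 11 rfl, f₁.nat 11 rfl]
  have r14 : ∀ j : Fin m, s₂.real 14 j = (B *ᵥ z) j := fun j => by
    rw [f₂.real 14 rfl, f₁.real 14 rfl]; exact hz.point_rows j
  have r15 : ∀ j : Fin m, s₂.real 15 j = (B *ᵥ w) j := fun j => by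
    rw [f₂.real 15 rfl, f₁.real 15 rfl]; exact hz.dir_rows j
  have r17 : s₂.real 17 0 = θ := by rw [f₂.real 17 rfl, h₁]
  have hg := halts_gather (ptr := 11) (idx := 12) (val := 12) (v := 13)
    (r := .exp (.div (.sub (.ofNat (.const 1))
      (.plus (.get 14 (.get 12 (nv 4))) (.mul (rv 17) (.get 15 (.get 12 (nv 4)))))) (rv 19)))
    c₂.sparse i h₂
    (fun j => Real.exp ((1 - (s₂.real 14 j + θ * s₂.real 15 j)) / mu m n ε))
    (fun e s' _ _ hf he => by
      simp only [RExp.eval, NExp.eval, nv, rv, he, hf.nat 12 rfl, hf.real 14 rfl, hf.real 15 rfl,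
        hf.real 17 rfl, hf.real 19 rfl, c₂.mu, r17, Nat.cast_one])
    (by norm_num) (by norm_num) (by norm_num)
  rw [hptr, ← hlen] at hg
  refine Halts.seq' (hg.mono (by simp; omega) fun _ _ h => h) fun s₃ f₃ h₃ => ?_
  have c₃ : MainCtx B ε s₃ := c₂.of_eq (f₃.nat 9 rfl) (f₃.nat 11 rfl) (f₃.nat 12 rfl)
    (f₃.real 12 rfl) (f₃.real 13 rfl) (f₃.real 19 rfl) (f₃.real 20 rfl) (f₃.real 21 rfl)
  have hG : 1 - s₃.real 7 0 = smoothGrad B (mu m n ε) (z + θ • w) i := by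
    rw [h₃, smoothGrad]
    congr 1
    refine Finset.sum_congr rfl fun j _ => ?_
    rw [r14, r15, Matrix.mulVec_add, Matrix.mulVec_smul]
    rfl
  have i₃ : s₃.nat 13 0 = i := by rw [f₃.nat 13 rfl, h₂]
  have p₃ : s₃.real 2 = s.real 2 := by rw [f₃.real 2 rfl, f₂.real 2 rfl, f₁.real 2 rfl]
  have w₃ : s₃.real 16 = s.real 16 := by rw [f₃.real 16 rfl, f₂.real 16 rfl, f₁.real 16 rfl]
  have t₃ : s₃.real 17 0 = θ := by rw [f₃.real 17 rfl, r17]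
  refine Halts.seq' (halts_coordCmd i₃ hG c₃.lip t₃ (c₃.norm i) (p := p) (d := p - z i)
    (by rw [p₃, hz.point]; exact hp) (by rw [p₃, hz.point])) fun s₄ f₄ h₄ => ?_
  obtain ⟨h₄a, h₄b, h₄c, h₄d⟩ := h₄
  have c₄ : MainCtx B ε s₄ := c₃.of_eq (f₄.nat 9 rfl) (f₄.nat 11 rfl) (f₄.nat 12 rfl)
    (f₄.real 12 rfl) (f₄.real 13 rfl) (f₄.real 19 rfl) (f₄.real 20 rfl) (f₄.real 21 rfl)
  have i₄ : s₄.nat 13 0 = i := by rw [f₄.nat 13 rfl, i₃]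
  have hptr₄ : s₄.nat 11 = s.nat 11 := by rw [f₄.nat 11 rfl, f₃.nat 11 rfl, hptr]
  have hs₅ := halts_scatter (out := 14) (v := 13) (d := rv 25) c₄.sparse i i₄ (p - z i)
    (fun s' hf => by simp [hf.real 25 rfl, h₄a]) (by norm_num) (by norm_num) (by norm_num)
    (by norm_num)
  rw [hptr₄, ← hlen] at hs₅
  refine Halts.seq' hs₅ fun s₅ f₅ h₅ => ?_
  have c₅ : MainCtx B ε s₅ := c₄.of_eq (f₅.nat 9 rfl) (f₅.nat 11 rfl) (f₅.nat 12 rfl)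
    (f₅.real 12 rfl) (f₅.real 13 rfl) (f₅.real 19 rfl) (f₅.real 20 rfl) (f₅.real 21 rfl)
  have i₅ : s₅.nat 13 0 = i := by rw [f₅.nat 13 rfl, i₄]
  have hptr₅ : s₅.nat 11 = s.nat 11 := by rw [f₅.nat 11 rfl, hptr₄]
  have hs₆ := halts_scatter (out := 15) (v := 13) (d := rv 26) c₅.sparse i i₅
    ((p - z i) * (1 - 1 / θ))
    (fun s' hf => by
      simp only [RExp.eval, NExp.eval, rv]
      rw [hf.real 26 rfl, f₅.real 26 rfl, h₄b]) (by norm_num) (by norm_num)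
    (by norm_num) (by norm_num)
  rw [hptr₅, ← hlen] at hs₆
  refine hs₆.mono le_rfl fun s₆ f₆ h₆ => ⟨?_, ?_, ?_, ?_, ?_⟩
  · rw [f₆.real 17 rfl, f₅.real 17 rfl, f₄.real 17 rfl, t₃]
  · intro i'
    rw [f₆.real 2 rfl, f₅.real 2 rfl, h₄c, p₃, Function.update_apply, Function.update_apply,
      hz.point]
    simp only [Fin.ext_iff]
  · intro i'
    rw [f₆.real 16 rfl, f₅.real 16 rfl, h₄d, w₃, hz.dir, Function.update_apply, Pi.add_apply]
    rcases eq_or_ne i' i with rfl | hi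
    · simp
    · rw [if_neg (by simpa [Fin.ext_iff] using hi), hz.dir]
      simp [hi]
  · intro j
    rw [f₆.real 14 rfl, h₅, f₄.real 14 rfl, f₃.real 14 rfl, r14, mulVec_update_add]
  · intro j
    rw [h₆, f₅.real 15 rfl, f₄.real 15 rfl, f₃.real 15 rfl, r15, mulVec_add_single]

/-- The parameters of the algorithm: real variables `19`, `20`, `21` for `μ`, `L`, `τ`, `22` for
the number of iterations before rounding, `17` for the power of `1 - τ`. -/
def paramCmd : Cmd :=
  .seq (.setReal 19 (.const 0) (.div (.get 0 (.const 0)) (.mul (.ofNat (.const 4))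
    (.log (.div (.mul (.ofNat (nv 9)) (.ofNat (.get 0 (.const 1)))) (.get 0 (.const 0)))))))
  (.seq (.setReal 20 (.const 0) (.div (.ofNat (.const 4)) (rv 19)))
  (.seq (.setReal 21 (.const 0) (.div (.ofNat (.const 1))
    (.mul (.mul (.ofNat (.const 8)) (.ofNat (nv 9))) (rv 20))))
  (.seq (.setReal 22 (.const 0) (.mul (.mul (.mul (.ofNat (.const 8)) (.ofNat (nv 9))) (rv 20))
    (.log (.div (.ofNat (.const 1)) (.get 0 (.const 0))))))
    (.setReal 17 (.const 0) (.ofNat (.const 1))))))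

/-- The program which runs the algorithm from the starting point. -/
def mainCmd : Cmd :=
  .seq paramCmd
  (.seq (matVec 11 12 12 14 3 2 (nv 9))
  (.seq (forLoop 6 (.const 0) (.realLt (.ofNat (nv 6)) (rv 22)) iterCmd)
  (forN 3 (nv 9) (.setReal 2 (nv 3) (.plus (.get 2 (nv 3)) (.mul (rv 17) (.get 16 (nv 3))))))))

/-- What `mainCmd` expects to find: matrix, starting point, and blank arrays. -/
structure MainInput {m n : ℕ} (B : Matrix (Fin m) (Fin n) ℝ) (ε : ℝ) (x₀ : Fin n → ℝ) (s : Mem) :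
    Prop where
  rows : s.nat 0 1 = m
  eps : s.real 0 0 = ε
  count : s.nat 9 0 = n
  sparse : Sparse B (s.nat 11) (s.nat 12) (s.real 12)
  norm : ∀ i : Fin n, s.real 13 i = colNorm B i
  start : ∀ i : Fin n, s.real 2 i = x₀ i
  blank : ∀ e, s.real 14 e = 0 ∧ s.real 15 e = 0 ∧ s.real 16 e = 0

/-- Number of non-zero entries of column `i`. -/
def colCard {m n : ℕ} (B : Matrix (Fin m) (Fin n) ℝ) (i : Fin n) : ℕ :=
  (Finset.univ.filter fun j => B j i ≠ 0).card

theorem halts_paramCmd {m n : ℕ} {B : Matrix (Fin m) (Fin n) ℝ} {ε : ℝ} {x₀ : Fin n → ℝ} {s : Mem}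
    (hs : MainInput B ε x₀ s) :
    Halts paramCmd s [] 100 (fun s' => MainCtx B ε s' ∧ s'.real 17 0 = 1 ∧
      s'.real 22 0 = 8 * n * lip m n ε * Real.log (1 / ε)) := by
  have hT : 30 + (20 + (20 + (20 + 10))) ≤ 100 := by norm_num
  refine Halts.mono (Q := fun s' => MainCtx B ε s' ∧ s'.real 17 0 = 1 ∧
      s'.real 22 0 = 8 * n * lip m n ε * Real.log (1 / ε)) ?_ hT fun _ _ h => h
  refine Halts.seq' (P := fun s' => s'.real 19 0 = mu m n ε)
    (Halts.straight rfl (by simp) (by simp [mu, hs.count, hs.rows, hs.eps])) fun s₁ f₁ h₁ => ?_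
  refine Halts.seq' (P := fun s' => s'.real 20 0 = lip m n ε)
    (Halts.straight rfl (by simp) (by simp [lip, h₁])) fun s₂ f₂ h₂ => ?_
  have n₂ : s₂.nat 9 0 = n := by rw [f₂.nat 9 rfl, f₁.nat 9 rfl, hs.count]
  have e₂ : s₂.real 0 0 = ε := by rw [f₂.real 0 rfl, f₁.real 0 rfl, hs.eps]
  refine Halts.seq' (P := fun s' => s'.real 21 0 = tau m n ε)
    (Halts.straight rfl (by simp) (by simp [tau, h₂, n₂])) fun s₃ f₃ h₃ => ?_
  refine Halts.seq' (P := fun s' => s'.real 22 0 = 8 * n * lip m n ε * Real.log (1 / ε))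
    (Halts.straight rfl (by simp) (by simp [f₃.real 20 rfl, f₃.nat 9 rfl, f₃.real 0 rfl, h₂, n₂,
      e₂])) fun s₄ f₄ h₄ => ?_
  refine Halts.straight rfl (by simp) ⟨⟨?_, ?_, ?_, ?_, ?_, ?_⟩, ?_, ?_⟩
  · change s₄.nat 9 0 = n
    rw [f₄.nat 9 rfl, f₃.nat 9 rfl, n₂]
  · change Sparse B (s₄.nat 11) (s₄.nat 12) (s₄.real 12)
    rw [f₄.nat 11 rfl, f₃.nat 11 rfl, f₂.nat 11 rfl, f₁.nat 11 rfl, f₄.nat 12 rfl, f₃.nat 12 rfl,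
      f₂.nat 12 rfl, f₁.nat 12 rfl, f₄.real 12 rfl, f₃.real 12 rfl, f₂.real 12 rfl, f₁.real 12 rfl]
    exact hs.sparse
  · change ∀ i : Fin n, s₄.real 13 i = colNorm B i
    rw [f₄.real 13 rfl, f₃.real 13 rfl, f₂.real 13 rfl, f₁.real 13 rfl]
    exact hs.norm
  · change s₄.real 19 0 = mu m n ε
    rw [f₄.real 19 rfl, f₃.real 19 rfl, f₂.real 19 rfl, h₁]
  · change s₄.real 20 0 = lip m n ε
    rw [f₄.real 20 rfl, f₃.real 20 rfl, h₂]
  · change s₄.real 21 0 = tau m n ε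
    rw [f₄.real 21 rfl, h₃]
  · simp
  · exact h₄

/-- The draws of the loop, one in each round, are the draws prescribed by `ω`. -/
theorem draws_eq_flatMap {n T : ℕ} (ω : Fin T → Fin n) :
    (List.range' 0 (T - 0)).flatMap (fun k => [(n, if h : k < T then (ω ⟨k, h⟩ : ℕ) else 0)]) =
      draws ω := by
  rw [← List.map_eq_flatMap]
  refine List.ext_getElem (by simp [draws]) fun k h1 h2 => ?_
  have hk : k < T := by simpa [draws] using h2
  simp [draws, hk]

theorem halts_mainCmd {m n : ℕ} {B : Matrix (Fin m) (Fin n) ℝ} {ε : ℝ} (hB : Setup B ε)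
    {x₀ : Fin n → ℝ} (hx : x₀ ∈ box B) {s : Mem} (hs : MainInput B ε x₀ s)
    (ω : Choices m n ε) :
    Halts mainCmd s (draws ω) (200 * (nnz B + n + 1) + ∑ k, (200 * colCard B (ω k) + 420))
      (fun s' => s'.Holds (output B ε x₀ ω)) := by
  set T := iters m n ε with hTdef
  have hT : 100 + ((30 * nnz B + 24 * n + 8) +
      ((∑ k ∈ Finset.Ico 0 T, ((if h : k < T then 200 * colCard B (ω ⟨k, h⟩) else 0) + 400 +
        6 + 6) + 9) + (n * (15 + 11) + 8))) ≤
      200 * (nnz B + n + 1) + ∑ k, (200 * colCard B (ω k) + 420) := by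
    have e : ∑ k ∈ Finset.Ico 0 T, ((if h : k < T then 200 * colCard B (ω ⟨k, h⟩) else 0) + 400 +
        6 + 6) ≤ ∑ k, (200 * colCard B (ω k) + 420) := by
      rw [← Finset.range_eq_Ico, Finset.sum_range]
      refine Finset.sum_le_sum fun k _ => ?_
      rw [dif_pos k.2, Fin.eta]
      omega
    omega
  refine Halts.mono (Q := fun s' => s'.Holds (output B ε x₀ ω)) ?_ hT fun _ _ h => h
  refine Halts.seq' (halts_paramCmd hs) fun s₁ f₁ h₁ => ?_
  obtain ⟨c₁, t₁, b₁⟩ := h₁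
  have x₁ : ∀ i : Fin n, s₁.real 2 i = x₀ i := fun i => by rw [f₁.real 2 rfl, hs.start]
  have w₁ : ∀ i : Fin n, s₁.real 16 i = 0 := fun i => by rw [f₁.real 16 rfl, (hs.blank _).2.2]
  refine Halts.seq' (halts_matVec (out := 14) (v := 3) (x := 2) c₁.sparse rfl
    (fun s' hf => by simp only [NExp.eval, nv]; rw [hf.nat 9 rfl, c₁.count])
    (by norm_num) (by norm_num) (by norm_num) (by norm_num) (by norm_num) (by norm_num)
    (by norm_num)) fun s₂ f₂ h₂ => ?_
  have c₂ : MainCtx B ε s₂ := c₁.of_eq (f₂.nat 9 rfl) (f₂.nat 11 rfl) (f₂.nat 12 rfl)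
    (f₂.real 12 rfl) (f₂.real 13 rfl) (f₂.real 19 rfl) (f₂.real 20 rfl) (f₂.real 21 rfl)
  have m₂ : MainState B x₀ 0 s₂ := by
    refine ⟨fun i => ?_, fun i => ?_, fun j => ?_, fun j => ?_⟩
    · rw [f₂.real 2 rfl, x₁]
    · rw [f₂.real 16 rfl, w₁]; rfl
    · rw [h₂ j, f₁.real 14 rfl, (hs.blank _).1, zero_add]
      simp only [x₁]
    · rw [f₂.real 15 rfl, f₁.real 15 rfl, (hs.blank _).2.1, Matrix.mulVec_zero]; rfl
  have t₂ : s₂.real 17 0 = 1 := by rw [f₂.real 17 rfl, t₁]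
  have b₂ : s₂.real 22 0 = 8 * n * lip m n ε * Real.log (1 / ε) := by rw [f₂.real 22 rfl, b₁]
  have hloop := halts_forLoop_draws (v := 6) (a := .const 0)
    (b := .realLt (.ofNat (nv 6)) (rv 22)) (body := iterCmd) (s := s₂) 0 T
    (fun k => (if h : k < T then 200 * colCard B (ω ⟨k, h⟩) else 0) + 400)
    (fun k => [(n, if h : k < T then (ω ⟨k, h⟩ : ℕ) else 0)])
    (fun k s' => s'.real 17 0 = (1 - tau m n ε) ^ k ∧ ∃ (hk : k ≤ T) (z w : Fin n → ℝ),
      run B ε x₀ k (fun t => ω (Fin.castLE hk t)) = (z + (1 - tau m n ε) ^ k • w, z) ∧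
      MainState B z w s')
    rfl (Nat.zero_le _) rfl
    (fun k s' _ _ hf hk _ => by
      simp only [BExp.holds, RExp.eval, NExp.eval, nv, rv, hk, hf.real 22 rfl, b₂, hTdef, iters,
        Nat.lt_ceil])
    (fun k s' k' h => ⟨h.1, h.2.imp fun hk h => h.imp fun z h => h.imp fun w h =>
      ⟨h.1, h.2.point, h.2.dir, h.2.point_rows, h.2.dir_rows⟩⟩)
    ⟨by simpa using t₂, Nat.zero_le _, x₀, 0, by simp [run], m₂⟩
    (fun k s' _ hk hf _ hI => by
      obtain ⟨hθ, hk', z, w, hrun, hst⟩ := hI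
      have c' : MainCtx B ε s' := c₂.of_eq (hf.nat 9 rfl) (hf.nat 11 rfl) (hf.nat 12 rfl)
        (hf.real 12 rfl) (hf.real 13 rfl) (hf.real 19 rfl) (hf.real 20 rfl) (hf.real 21 rfl)
      have hz : z ∈ box B := by
        have := hB.run_mem_box hx k (fun t => ω (Fin.castLE hk' t))
        rwa [hrun] at this
      have hstep := halts_iterCmd c' hst (ω ⟨k, hk⟩) (θ := (1 - tau m n ε) ^ (k + 1))
        (by rw [hθ, pow_succ]) rfl
      rw [c'.sparse.card_col] at hstep
      simp only [dif_pos hk]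
      refine hstep.mono le_rfl fun s'' _ h => ⟨h.1, hk, _, _, ?_, h.2⟩
      rw [← hB.iterate_dir k (ω ⟨k, hk⟩) hz w rfl rfl, ← hrun]
      rfl)
  rw [draws_eq_flatMap] at hloop
  have hds : draws ω = draws ω ++ [] := (List.append_nil _).symm
  rw [hds]
  refine Halts.seq hloop fun s₃ f₃ h₃ => ?_
  obtain ⟨⟨hθ, hk, z, w, hrun, hst⟩, _⟩ := h₃
  have hcount : s₃.nat 9 0 = n := by rw [f₃.nat 9 rfl, c₂.count]
  refine Halts.mono (halts_forN_const (K := n) (T := 15)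
    (I := fun k s' => ∀ i : Fin n, s'.real 2 i = if (i : ℕ) < k then
      z i + (1 - tau m n ε) ^ T * w i else z i) rfl rfl (fun s' hf => ?_) (fun k s' k' h => h)
    (by simpa using hst.point) fun k s' hk' hf hv hI => ?_) le_rfl fun s' _ h i => ?_
  · simp only [NExp.eval, nv]; rw [hf.nat 9 rfl, hcount]
  · refine Halts.straight rfl (by simp) fun i => ?_
    simp only [Cmd.eff, Mem.setReal_real, if_true, NExp.eval, RExp.eval, nv, rv, hv,
      hf.real 17 rfl, hf.real 16 rfl, hθ, Function.update_apply]
    split_ifs with h1 h2 h3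
    · have := hI i
      rw [if_neg (by omega), h1] at this
      rw [this, ← hst.dir i, h1]
    · omega
    · rw [hI i, if_pos (by omega)]
    · rw [hI i, if_neg (by omega)]
  · rw [h i, if_pos i.2]
    have : output B ε x₀ ω = z + (1 - tau m n ε) ^ T • w := by
      unfold output
      exact congrArg Prod.fst hrun
    rw [this]
    rfl

/-! ### Bounds for the running time -/

theorem expect_sum_choices {n : ℕ} (hn : 0 < n) (f : Fin n → ℝ) (K : ℕ) :
    (𝔼 ω : Fin K → Fin n, ∑ k, f (ω k)) = K * 𝔼 i, f i := by
  have : Nonempty (Fin n) := ⟨⟨0, hn⟩⟩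
  induction K with
  | zero => simp
  | succ K ih =>
    rw [expect_choices_succ]
    simp only [Fin.sum_univ_castSucc, Fin.snoc_castSucc, Fin.snoc_last, Finset.expect_add_distrib,
      Fintype.expect_const, ih]
    push_cast
    ring

theorem sum_colCard {m n : ℕ} (B : Matrix (Fin m) (Fin n) ℝ) :
    ∑ i, (colCard B i : ℝ) = nnz B := by
  rw [nnz_eq_sum]
  push_cast
  rfl

namespace IsCovering
variable {m n : ℕ} {A : Matrix (Fin m) (Fin n) ℝ}

theorem one_le_card_col (h : IsCovering A) (i : Fin n) :
    1 ≤ (Finset.univ.filter fun j => A j i ≠ 0).card := by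
  obtain ⟨j, hj⟩ := h.col i
  exact Finset.card_pos.2 ⟨j, by simpa using hj⟩

theorem n_le_nnz (h : IsCovering A) : n ≤ nnz A := by
  rw [nnz_eq_sum]
  calc n = ∑ _i : Fin n, 1 := by simp
    _ ≤ _ := Finset.sum_le_sum fun i _ => h.one_le_card_col i

theorem m_le_nnz (h : IsCovering A) : m ≤ nnz A := by
  choose f hf using h.exists_one_le
  have := Nat.card_le_card_of_injective
    (fun j : Fin m => (⟨(j, f j), (zero_lt_one.trans_le (hf j)).ne'⟩ :
      {p : Fin m × Fin n // A p.1 p.2 ≠ 0}))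
    (fun j j' e => by simpa using congrArg (fun p => p.1.1) e)
  simpa [nnz] using this

theorem nnz_le_nnz_reduced (h : IsCovering A) : nnz A ≤ nnz (reduced A) := by
  rw [h.nnz_reduced, nnz_eq_sum]
  exact Finset.sum_le_sum fun i _ => Nat.le_mul_of_pos_left _ (one_le_copies A i)

theorem redDim_le_nnz_reduced (h : IsCovering A) : redDim A ≤ nnz (reduced A) := by
  rw [h.nnz_reduced]
  exact Finset.sum_le_sum fun i _ => Nat.le_mul_of_pos_right _ (h.one_le_card_col i)

theorem one_le_nnz (h : IsCovering A) : 1 ≤ nnz A := le_trans h.n_pos h.n_le_nnz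

/-- Keeps the logarithms in the time bounds away from zero. For a matrix with a single entry this is
the assumption `ε ≤ 1 / 2`. -/
theorem two_le_nnz_div (h : IsCovering A) {ε : ℝ} (h0 : 0 < ε) (h1 : ε < 1)
    (h2 : 2 * ε ≤ (n : ℝ) * m) : 2 ≤ nnz A / ε := by
  rw [le_div_iff₀ h0]
  have hn := h.n_le_nnz
  have hm := h.m_le_nnz
  rcases (show nnz A = 1 ∨ 2 ≤ nnz A by have := h.one_le_nnz; omega) with hN | hN
  · have hn1 : n = 1 := by have := h.n_pos; omega
    have hm1 : m = 1 := by have := h.m_pos; omega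
    rw [hN]
    simpa [hn1, hm1] using h2
  · have : (2 : ℝ) ≤ nnz A := by exact_mod_cast hN
    linarith

theorem log_nnz_lower (h : IsCovering A) {ε : ℝ} (h0 : 0 < ε) (h1 : ε < 1)
    (h2 : 2 * ε ≤ (n : ℝ) * m) : 69 / 100 ≤ Real.log (nnz A / ε) := by
  have := Real.log_le_log (by norm_num) (h.two_le_nnz_div h0 h1 h2)
  linarith [Real.log_two_gt_d9]

theorem log_nnz_le (h : IsCovering A) {ε : ℝ} (h0 : 0 < ε) :
    Real.log (nnz A / ε) ≤ Real.log (nnz (reduced A) / ε) := by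
  have h3 : (1 : ℝ) ≤ nnz A := by exact_mod_cast h.one_le_nnz
  have h4 : (nnz A : ℝ) ≤ nnz (reduced A) := by exact_mod_cast h.nnz_le_nnz_reduced
  refine Real.log_le_log (by positivity) ?_
  gcongr

theorem log_inv_le (h : IsCovering A) {ε : ℝ} (h0 : 0 < ε) :
    Real.log (1 / ε) ≤ Real.log (nnz A / ε) := by
  have h3 : (1 : ℝ) ≤ nnz A := by exact_mod_cast h.one_le_nnz
  refine Real.log_le_log (by positivity) ?_
  gcongr

theorem logSize_le (h : IsCovering A) {ε : ℝ} (h0 : 0 < ε) (h1 : ε < 1)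
    (h2 : 2 * ε ≤ (n : ℝ) * m) : logSize m n ≤ 2 * Real.log (nnz A / ε) := by
  have hn : (n : ℝ) ≤ nnz A := by exact_mod_cast h.n_le_nnz
  have hm : (m : ℝ) ≤ nnz A := by exact_mod_cast h.m_le_nnz
  have h3 : (1 : ℝ) ≤ nnz A := by exact_mod_cast h.one_le_nnz
  have h4 := h.two_le_nnz_div h0 h1 h2
  have h5 : (nnz A : ℝ) ≤ nnz A / ε := by
    rw [le_div_iff₀ h0]; nlinarith
  have h6 := h.two_le_size
  unfold logSize
  rw [show 2 * Real.log (nnz A / ε) = Real.log ((nnz A / ε) ^ 2) by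
    rw [Real.log_pow]; norm_num]
  refine Real.log_le_log (by linarith) ?_
  nlinarith

/-- The solver takes polylogarithmically many rounds, each linear in the size of the input. -/
theorem startTime_le (h : IsCovering A) {ε : ℝ} (h0 : 0 < ε) (h1 : ε < 1)
    (h2 : 2 * ε ≤ (n : ℝ) * m) : (startTime A : ℝ) ≤
      2000000000 * (nnz A * Real.log (nnz A / ε) ^ 3) + 400 * nnz (reduced A) := by
  have hn : (n : ℝ) ≤ nnz A := by exact_mod_cast h.n_le_nnz
  have hm : (m : ℝ) ≤ nnz A := by exact_mod_cast h.m_le_nnz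
  have hN : (1 : ℝ) ≤ nnz A := by exact_mod_cast h.one_le_nnz
  have hl := h.log_nnz_lower h0 h1 h2
  have hs := h.logSize_le h0 h1 h2
  have hs0 := h.logSize_lower
  have hP : (coverPhases m n : ℝ) ≤ 200 * logSize m n + 1 :=
    (Nat.ceil_lt_add_one (by linarith)).le
  have hR : (coverRounds m n : ℝ) ≤ 2000 * (logSize m n * logSize m n) + 1 :=
    (Nat.ceil_lt_add_one (by positivity)).le
  set l := Real.log (nnz A / ε)
  set N : ℝ := ((nnz A : ℕ) : ℝ)
  have hsq : logSize m n * logSize m n ≤ 4 * l ^ 2 := by nlinarith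
  have hl2 : 1 ≤ 4 * l ^ 2 := by nlinarith
  have hP' : (coverPhases m n : ℝ) ≤ 402 * l := by linarith
  have hR' : (coverRounds m n : ℝ) ≤ 8004 * l ^ 2 := by linarith
  have hround : (coverRounds m n : ℝ) * (100 * (N + n + m + 1) + 18) + 50 ≤
      3345872 * (N * l ^ 2) := by
    have : (coverRounds m n : ℝ) * (100 * (N + n + m + 1) + 18) ≤ 8004 * l ^ 2 * (418 * N) :=
      mul_le_mul hR' (by linarith) (by positivity) (by positivity)
    have h3 : 1 * 1 ≤ N * (4 * l ^ 2) := mul_le_mul hN hl2 (by norm_num) (by linarith)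
    nlinarith
  have hphase : (coverPhases m n : ℝ) * ((coverRounds m n : ℝ) * (100 * (N + n + m + 1) + 18) + 50)
      ≤ 402 * l * (3345872 * (N * l ^ 2)) :=
    mul_le_mul hP' hround (by positivity) (by linarith)
  have hNl : N ≤ 8 * (N * l ^ 3) := by
    have : 1 ≤ 8 * l ^ 3 := by
      have : l ^ 3 = l * l ^ 2 := by ring
      nlinarith
    nlinarith
  unfold startTime
  push_cast
  have e : 402 * l * (3345872 * (N * l ^ 2)) = 1345040544 * (N * l ^ 3) := by ring
  rw [e] at hphase
  linarith

theorem iters_le (h : IsCovering A) {ε : ℝ} (h0 : 0 < ε) (h1 : ε < 1)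
    (h2 : 2 * ε ≤ (n : ℝ) * m) : (iters m (redDim A) ε : ℝ) ≤
      redDim A * (256 * (Real.log (nnz (reduced A) / ε) * Real.log (1 / ε)) / ε) + 1 := by
  have hB := h.setup h0 h1 h2
  have hinv : 0 ≤ Real.log (1 / ε) := Real.log_nonneg (by rw [le_div_iff₀ h0]; linarith)
  have hL := hB.lip_pos
  refine (Nat.ceil_lt_add_one (by positivity)).le.trans ?_
  have hn : (redDim A : ℝ) ≤ nnz (reduced A) := by exact_mod_cast h.redDim_le_nnz_reduced
  have hm : (m : ℝ) ≤ nnz (reduced A) := by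
    exact_mod_cast h.m_le_nnz.trans h.nnz_le_nnz_reduced
  have hn1 := hB.one_le_n
  have hm1 : (1 : ℝ) ≤ m := by exact_mod_cast h.m_pos
  have hlog : Real.log ((redDim A : ℝ) * m / ε) ≤ 2 * Real.log (nnz (reduced A) / ε) := by
    rw [show 2 * Real.log (nnz (reduced A) / ε) = Real.log ((nnz (reduced A) / ε) ^ 2) by
      rw [Real.log_pow]; norm_num]
    refine Real.log_le_log (by positivity) ?_
    rw [div_pow, div_le_div_iff₀ h0 (by positivity)]
    have h3 : (redDim A : ℝ) * m ≤ (nnz (reduced A) : ℝ) ^ 2 := by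
      rw [sq]; exact mul_le_mul hn hm (by linarith) (by linarith)
    have h4 : ε ^ 2 ≤ ε := by nlinarith
    exact mul_le_mul h3 h4 (by positivity) (by positivity)
  have hlip : lip m (redDim A) ε ≤ 32 * Real.log (nnz (reduced A) / ε) / ε := by
    rw [hB.lip_eq, div_le_div_iff_of_pos_right h0]
    linarith
  have : 8 * redDim A * lip m (redDim A) ε * Real.log (1 / ε) ≤
      8 * redDim A * (32 * Real.log (nnz (reduced A) / ε) / ε) * Real.log (1 / ε) := by
    gcongr
  refine add_le_add (this.trans (le_of_eq ?_)) le_rfl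
  ring

/-- A round of the algorithm takes time proportional to the number of non-zero entries of the
selected column, which is `nnz (reduced A) / redDim A` on average. -/
theorem expect_mainTime_le (h : IsCovering A) {ε : ℝ} (h0 : 0 < ε) (h1 : ε < 1)
    (h2 : 2 * ε ≤ (n : ℝ) * m) :
    (𝔼 ω : Choices m (redDim A) ε, ((200 * (nnz (reduced A) + redDim A + 1) +
      ∑ k, (200 * colCard (reduced A) (ω k) + 420) : ℕ) : ℝ)) ≤
      1220 * nnz (reduced A) + 158720 * (nnz (reduced A) *
        (Real.log (nnz (reduced A) / ε) * Real.log (1 / ε)) / ε) := by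
  have hn0 : 0 < redDim A := h.n_pos.trans_le (le_redDim A)
  have : Nonempty (Fin (redDim A)) := ⟨⟨0, hn0⟩⟩
  have hn1 : (1 : ℝ) ≤ redDim A := by exact_mod_cast hn0
  have hn : (redDim A : ℝ) ≤ nnz (reduced A) := by exact_mod_cast h.redDim_le_nnz_reduced
  have hl : 0 ≤ Real.log (nnz (reduced A) / ε) := by
    linarith [h.log_nnz_lower h0 h1 h2, h.log_nnz_le h0]
  have hinv : 0 ≤ Real.log (1 / ε) := Real.log_nonneg (by rw [le_div_iff₀ h0]; linarith)
  have hmean : (𝔼 i, (200 * (colCard (reduced A) i : ℝ) + 420)) =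
      200 * nnz (reduced A) / redDim A + 420 := by
    rw [Fintype.expect_eq_sum_div_card, Finset.sum_add_distrib, ← Finset.mul_sum, sum_colCard]
    simp
    field_simp
  push_cast
  rw [Finset.expect_add_distrib, Fintype.expect_const,
    expect_sum_choices hn0 fun i => 200 * (colCard (reduced A) i : ℝ) + 420, hmean]
  have hround : 200 * (nnz (reduced A) : ℝ) / redDim A + 420 ≤
      620 * (nnz (reduced A) / redDim A) := by
    have : 1 ≤ (nnz (reduced A) : ℝ) / redDim A := by rw [le_div_iff₀ (by linarith)]; linarith
    rw [mul_div_assoc]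
    linarith
  have hT := h.iters_le h0 h1 h2
  set q := Real.log (nnz (reduced A) / ε) * Real.log (1 / ε)
  have hq : 0 ≤ q := mul_nonneg hl hinv
  have hprod := mul_le_mul hT hround (by positivity) (by positivity)
  have hdiv : (nnz (reduced A) : ℝ) / redDim A ≤ nnz (reduced A) :=
    div_le_self (by linarith) hn1
  have e : ((redDim A : ℝ) * (256 * q / ε) + 1) * (620 * (nnz (reduced A) / redDim A)) =
      158720 * (nnz (reduced A) * q / ε) + 620 * (nnz (reduced A) / redDim A) := by
    field_simp
    ring
  rw [e] at hprod
  linarith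

/-- Moderate entries differ by a factor of at most `(nnz A / ε) ^ 3`. -/
theorem copies_le (h : IsCovering A) {ε : ℝ} (h0 : 0 < ε) (h1 : ε < 1)
    (h2 : 2 * ε ≤ (n : ℝ) * m) (hmod : ModerateEntries A ε) (i : Fin n) :
    (copies A i : ℝ) ≤ 7 * Real.log (nnz A / ε) := by
  have hn : (n : ℝ) ≤ nnz A := by exact_mod_cast h.n_le_nnz
  have hm : (m : ℝ) ≤ nnz A := by exact_mod_cast h.m_le_nnz
  have hn1 : (1 : ℝ) ≤ n := by exact_mod_cast h.n_pos
  have hm1 : (1 : ℝ) ≤ m := by exact_mod_cast h.m_pos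
  have hl := h.log_nnz_lower h0 h1 h2
  rcases Nat.lt_or_ge 1 (copies A i) with hc | hc
  · obtain ⟨l, hl1⟩ : ∃ l, copies A i = l + 1 := ⟨copies A i - 1, by omega⟩
    have hlt : 2 ^ l * minPos A i < maxPos A i :=
      ((h.lt_copies_iff i l).1 (by omega)).resolve_left (by omega)
    obtain ⟨j, hj, hje⟩ := (h.isLeast_minPos i).1
    obtain ⟨j', hj', hje'⟩ := (h.isGreatest_maxPos i).1
    have hmin : ε / ((m : ℝ) * n) ≤ minPos A i := by rw [hje]; exact (hmod j i hj.ne').1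
    have hmax : maxPos A i ≤ n / ε := by rw [hje']; exact (hmod j' i hj'.ne').2
    have hpow : (2 : ℝ) ^ l ≤ (nnz A / ε) ^ 3 := by
      have h3 : (2 : ℝ) ^ l * (ε / ((m : ℝ) * n)) ≤ n / ε :=
        ((mul_le_mul_of_nonneg_left hmin (by positivity)).trans hlt.le).trans hmax
      rw [← mul_div_assoc, div_le_div_iff₀ (by positivity) h0] at h3
      rw [div_pow, le_div_iff₀ (by positivity)]
      calc (2 : ℝ) ^ l * ε ^ 3 = 2 ^ l * ε * ε * ε := by ring
        _ ≤ n * (m * n) * ε := mul_le_mul_of_nonneg_right h3 h0.le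
        _ ≤ n * (m * n) * 1 := by gcongr
        _ ≤ nnz A * (nnz A * nnz A) * 1 := by gcongr
        _ = _ := by ring
    have hlog := Real.log_le_log (by positivity) hpow
    rw [Real.log_pow, Real.log_pow] at hlog
    have hln := Real.log_two_gt_d9
    rw [hl1]
    push_cast at hlog ⊢
    have : (l : ℝ) * (69 / 100) ≤ l * Real.log 2 :=
      mul_le_mul_of_nonneg_left (by linarith) (by positivity)
    linarith
  · have : (copies A i : ℝ) ≤ 1 := by exact_mod_cast hc
    linarith

theorem nnz_reduced_le (h : IsCovering A) {ε : ℝ} (h0 : 0 < ε) (h1 : ε < 1)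
    (h2 : 2 * ε ≤ (n : ℝ) * m) (hmod : ModerateEntries A ε) :
    (nnz (reduced A) : ℝ) ≤ 7 * (nnz A * Real.log (nnz A / ε)) := by
  have e : 7 * (nnz A * Real.log (nnz A / ε)) =
      ∑ i, 7 * Real.log (nnz A / ε) * (colCard A i : ℝ) := by
    rw [← Finset.mul_sum, sum_colCard]
    ring
  rw [e, h.nnz_reduced]
  push_cast
  exact Finset.sum_le_sum fun i _ =>
    mul_le_mul_of_nonneg_right (h.copies_le h0 h1 h2 hmod i) (Nat.cast_nonneg _)

theorem log_nnz_reduced_le (h : IsCovering A) {ε : ℝ} (h0 : 0 < ε) (h1 : ε < 1)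
    (h2 : 2 * ε ≤ (n : ℝ) * m) (hmod : ModerateEntries A ε) :
    Real.log (nnz (reduced A) / ε) ≤ 8 * Real.log (nnz A / ε) := by
  have hl := h.log_nnz_lower h0 h1 h2
  have hN : (1 : ℝ) ≤ nnz A := by exact_mod_cast h.one_le_nnz
  have hN' : (nnz A : ℝ) ≤ nnz (reduced A) := by exact_mod_cast h.nnz_le_nnz_reduced
  have h3 : (nnz (reduced A) : ℝ) / ε ≤ 7 * Real.log (nnz A / ε) * (nnz A / ε) := by
    rw [← mul_div_assoc]
    gcongr
    linarith [h.nnz_reduced_le h0 h1 h2 hmod]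
  have h4 := Real.log_le_log (div_pos (by linarith) h0) h3
  rw [Real.log_mul (by linarith) (by positivity)] at h4
  have h5 := Real.log_le_self (show 0 ≤ 7 * Real.log (nnz A / ε) by linarith)
  linarith

end IsCovering

/-! ### The complete program -/

theorem Built.mainInput {m n : ℕ} {A : Matrix (Fin m) (Fin n) ℝ} {ε : ℝ}
    {x₀ : Fin (redDim A) → ℝ} {s s' : Mem} (hs : IsInput A ε s) (hf : Frame startCmd s s')
    (h : Built A x₀ (redDim A) s') : MainInput (reduced A) ε x₀ s' where
  rows := by rw [hf.nat 0 rfl]; exact hs.rows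
  eps := by rw [hf.real 0 rfl]; exact hs.eps
  count := h.count
  sparse := h.sparse
  norm k := (h.col k k.2).norm
  start k := (h.col k k.2).start
  blank e := by
    rw [hf.real 14 rfl, hf.real 15 rfl, hf.real 16 rfl]
    exact ⟨hs.blank_real 14 (by norm_num) e, hs.blank_real 15 (by norm_num) e,
      hs.blank_real 16 (by norm_num) e⟩

namespace IsCovering
variable {m n : ℕ} {A : Matrix (Fin m) (Fin n) ℝ}

theorem isTwoApprox_start (h : IsCovering A) :
    IsTwoApprox A (lift A (coverRun A (coverPhases m n))) := by
  obtain ⟨h1, h2, h3⟩ := h.cover_solution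
  exact h.isTwoApprox_lift h1 h2 h3

theorem halts_program (h : IsCovering A) {ε : ℝ} (h0 : 0 < ε) (h1 : ε < 1)
    (h2 : 2 * ε ≤ (n : ℝ) * m) {s : Mem} (hs : IsInput A ε s)
    (ω : Choices m (redDim A) ε) :
    Halts (startCmd.seq mainCmd) s (draws ω) (startTime A +
      (200 * (nnz (reduced A) + redDim A + 1) +
        ∑ k, (200 * colCard (reduced A) (ω k) + 420)))
      (fun s' => s'.Holds (output (reduced A) ε
        ((1 + ε / 2) • lift A (coverRun A (coverPhases m n))) ω)) := by
  refine Halts.seq' (halts_startCmd h hs) fun s₁ hf h₁ => ?_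
  have hB := h.setup h0 h1 h2
  refine halts_mainCmd hB ?_ (h₁.mainInput hs hf) ω
  exact hB.smul_mem_box h.isTwoApprox_start.nonneg h.isTwoApprox_start.le_bound

theorem start_bound (h : IsCovering A) {ε : ℝ} (h0 : 0 < ε) (h1 : ε < 1)
    (h2 : 2 * ε ≤ (n : ℝ) * m) : (startTime A : ℝ) ≤
      3000000000 * nnz (reduced A) * Real.log (nnz (reduced A) / ε) ^ 3 := by
  have hs := h.startTime_le h0 h1 h2
  have hl := h.log_nnz_lower h0 h1 h2
  have hll := h.log_nnz_le h0
  have hN : (nnz A : ℝ) ≤ nnz (reduced A) := by exact_mod_cast h.nnz_le_nnz_reduced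
  have h3 : nnz A * Real.log (nnz A / ε) ^ 3 ≤
      nnz (reduced A) * Real.log (nnz (reduced A) / ε) ^ 3 := by gcongr
  have h4 : (1 / 4 : ℝ) ≤ Real.log (nnz (reduced A) / ε) ^ 3 := by
    refine le_trans (by norm_num) (pow_le_pow_left₀ (by norm_num) (hl.trans hll) 3)
  have h5 := mul_le_mul_of_nonneg_left h4 (Nat.cast_nonneg (α := ℝ) (nnz (reduced A)))
  nlinarith

theorem start_bound_moderate (h : IsCovering A) {ε : ℝ} (h0 : 0 < ε) (h1 : ε < 1)
    (h2 : 2 * ε ≤ (n : ℝ) * m) (hmod : ModerateEntries A ε) : (startTime A : ℝ) ≤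
      3000000000 * nnz A * Real.log (nnz A / ε) ^ 3 := by
  have hs := h.startTime_le h0 h1 h2
  have hl := h.log_nnz_lower h0 h1 h2
  have hN := h.nnz_reduced_le h0 h1 h2 hmod
  have h4 : Real.log (nnz A / ε) ≤ 4 * Real.log (nnz A / ε) ^ 3 := by
    nlinarith [sq_nonneg (Real.log (nnz A / ε))]
  have h5 := mul_le_mul_of_nonneg_left h4 (Nat.cast_nonneg (α := ℝ) (nnz A))
  nlinarith

/-- The expected time in terms of the sizes of both matrices. -/
theorem expect_time_le (h : IsCovering A) {ε : ℝ} (h0 : 0 < ε) (h1 : ε < 1)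
    (h2 : 2 * ε ≤ (n : ℝ) * m) {t : Choices m (redDim A) ε → ℕ}
    (ht : ∀ ω, t ω ≤ startTime A + (200 * (nnz (reduced A) + redDim A + 1) +
        ∑ k, (200 * colCard (reduced A) (ω k) + 420))) :
    (𝔼 ω, (t ω : ℝ)) ≤ 2000000000 * (nnz A * Real.log (nnz A / ε) ^ 3) +
      1620 * nnz (reduced A) + 158720 * (nnz (reduced A) *
        (Real.log (nnz (reduced A) / ε) * Real.log (nnz A / ε)) / ε) := by
  have : Nonempty (Fin (redDim A)) := ⟨⟨0, h.n_pos.trans_le (le_redDim A)⟩⟩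
  have h3 : (𝔼 ω, (t ω : ℝ)) ≤ 𝔼 ω : Choices m (redDim A) ε, ((startTime A : ℝ) +
      ((200 * (nnz (reduced A) + redDim A + 1) +
        ∑ k, (200 * colCard (reduced A) (ω k) + 420) : ℕ) : ℝ)) :=
    Finset.expect_le_expect fun ω _ => by exact_mod_cast ht ω
  rw [Finset.expect_add_distrib, Fintype.expect_const] at h3
  have h4 := h.expect_mainTime_le h0 h1 h2
  have h5 := h.startTime_le h0 h1 h2
  have hl : 0 ≤ Real.log (nnz (reduced A) / ε) := by
    linarith [h.log_nnz_lower h0 h1 h2, h.log_nnz_le h0]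
  have h6 : nnz (reduced A) * (Real.log (nnz (reduced A) / ε) * Real.log (1 / ε)) / ε ≤
      nnz (reduced A) * (Real.log (nnz (reduced A) / ε) * Real.log (nnz A / ε)) / ε := by
    have := h.log_inv_le h0
    gcongr
  linarith

theorem expect_bound (h : IsCovering A) {ε : ℝ} (h0 : 0 < ε) (h1 : ε < 1)
    (h2 : 2 * ε ≤ (n : ℝ) * m) {t : Choices m (redDim A) ε → ℕ}
    (ht : ∀ ω, t ω ≤ startTime A + (200 * (nnz (reduced A) + redDim A + 1) +
        ∑ k, (200 * colCard (reduced A) (ω k) + 420))) :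
    (𝔼 ω, (t ω : ℝ)) ≤ 3000000000 * (nnz (reduced A) / ε) *
      Real.log (nnz (reduced A) / ε) ^ 3 := by
  refine (h.expect_time_le h0 h1 h2 ht).trans ?_
  have hl := h.log_nnz_lower h0 h1 h2
  have hll := h.log_nnz_le h0
  have hN : (nnz A : ℝ) ≤ nnz (reduced A) := by exact_mod_cast h.nnz_le_nnz_reduced
  have hN' : (nnz (reduced A) : ℝ) ≤ nnz (reduced A) / ε :=
    le_div_self (Nat.cast_nonneg _) h0 h1.le
  rw [mul_div_right_comm]
  set l := Real.log (nnz A / ε)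
  set l' := Real.log (nnz (reduced A) / ε)
  set M : ℝ := (nnz (reduced A) : ℝ) / ε
  have hM : 0 ≤ M := by positivity
  have h3 : nnz A * l ^ 3 ≤ M * l' ^ 3 := by
    have := hN.trans hN'
    gcongr
  have h4 : (1 / 4 : ℝ) ≤ l' ^ 3 :=
    le_trans (by norm_num) (pow_le_pow_left₀ (by norm_num) (hl.trans hll) 3)
  have h5 : l' * l ≤ 2 * l' ^ 3 := by
    have h6 : l' * l ≤ l' * l' := mul_le_mul_of_nonneg_left hll (by linarith)
    nlinarith [mul_nonneg (show 0 ≤ l' by linarith) (show 0 ≤ l' by linarith)]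
  have h7 := mul_le_mul_of_nonneg_left h4 hM
  have h8 := mul_le_mul_of_nonneg_left h5 hM
  have h9 : 0 ≤ M * l' ^ 3 := by positivity
  nlinarith

theorem expect_bound_moderate (h : IsCovering A) {ε : ℝ} (h0 : 0 < ε) (h1 : ε < 1)
    (h2 : 2 * ε ≤ (n : ℝ) * m) (hmod : ModerateEntries A ε) {t : Choices m (redDim A) ε → ℕ}
    (ht : ∀ ω, t ω ≤ startTime A + (200 * (nnz (reduced A) + redDim A + 1) +
        ∑ k, (200 * colCard (reduced A) (ω k) + 420))) :
    (𝔼 ω, (t ω : ℝ)) ≤ 3000000000 * (nnz A / ε) * Real.log (nnz A / ε) ^ 3 := by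
  refine (h.expect_time_le h0 h1 h2 ht).trans ?_
  have hl := h.log_nnz_lower h0 h1 h2
  have hll := h.log_nnz_reduced_le h0 h1 h2 hmod
  have hll0 := h.log_nnz_le h0
  have hN := h.nnz_reduced_le h0 h1 h2 hmod
  have hN' : (nnz A : ℝ) ≤ nnz A / ε := le_div_self (Nat.cast_nonneg _) h0 h1.le
  set l := Real.log (nnz A / ε)
  set l' := Real.log (nnz (reduced A) / ε)
  set M : ℝ := (nnz A : ℝ) / ε with hMdef
  have hM : 0 ≤ M := by positivity
  have h3 : nnz A * l ^ 3 ≤ M * l ^ 3 := by gcongr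
  have h4 : l ≤ 4 * l ^ 3 := by nlinarith [sq_nonneg l]
  have h5 : (nnz (reduced A) : ℝ) ≤ 28 * (M * l ^ 3) := by
    have h6 : nnz A * l ≤ M * (4 * l ^ 3) := mul_le_mul hN' h4 (by linarith) hM
    linarith
  have h7 : nnz (reduced A) * (l' * l) / ε ≤ 56 * (M * l ^ 3) := by
    calc nnz (reduced A) * (l' * l) / ε ≤ 7 * (nnz A * l) * (8 * l * l) / ε := by
          gcongr
          exact mul_nonneg (by linarith) (by linarith)
      _ = 56 * (M * l ^ 3) := by rw [hMdef]; ring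
  have h9 : 0 ≤ M * l ^ 3 := by positivity
  nlinarith

end IsCovering

end CovLP

end

theorem theorem1 :
    ∃ (start main : Cmd) (C : ℝ) (p : ℕ),
      ∀ (m n : ℕ) (A : Matrix (Fin m) (Fin n) ℝ) (ε : ℝ),
        (∀ j i, 0 ≤ A j i) → (∀ i, ∃ j, A j i ≠ 0) → (⨅ j, rowNorm A j) = 1 →
        0 < ε → ε < 1 → 2 * ε ≤ (n : ℝ) * m →
        -- approximation guarantee, from every starting point of the required form
        (∀ x : Fin (redDim A) → ℝ, IsTwoApprox A x →
          (𝔼 ω : Choices m (redDim A) ε,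
            smoothed (reduced A) (mu m (redDim A) ε)
              (output (reduced A) ε ((1 + ε / 2) • x) ω)) ≤ (1 + 6 * ε) * opt A) ∧
        -- computation of such a starting point, then of the output of the algorithm
        (∀ s : Mem, IsInput A ε s →
          ∃ x : Fin (redDim A) → ℝ, IsTwoApprox A x ∧
            (∃ (s₁ : Mem) (t₁ : ℕ), Exec start s [] s₁ t₁ ∧ s₁.Holds ((1 + ε / 2) • x) ∧
              (t₁ : ℝ) ≤ C * nnz (reduced A) * Real.log (nnz (reduced A) / ε) ^ p ∧
              (ModerateEntries A ε → (t₁ : ℝ) ≤ C * nnz A * Real.log (nnz A / ε) ^ p)) ∧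
            (∃ t : Choices m (redDim A) ε → ℕ,
              (∀ ω, ∃ s₂ : Mem, Exec (start.seq main) s (draws ω) s₂ (t ω) ∧
                s₂.Holds (output (reduced A) ε ((1 + ε / 2) • x) ω)) ∧
              (𝔼 ω, (t ω : ℝ)) ≤
                C * (nnz (reduced A) / ε) * Real.log (nnz (reduced A) / ε) ^ p ∧
              (ModerateEntries A ε →
                (𝔼 ω, (t ω : ℝ)) ≤ C * (nnz A / ε) * Real.log (nnz A / ε) ^ p))) := by
  refine ⟨startCmd, mainCmd, 3000000000, 3, fun m n A ε hnonneg hcol hrow h0 h1 h2 => ?_⟩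
  have h : IsCovering A := ⟨hnonneg, hcol, hrow⟩
  refine ⟨fun x hx => h.approximation h0 h1 h2 hx, fun s hs => ?_⟩
  refine ⟨lift A (coverRun A (coverPhases m n)), h.isTwoApprox_start, ?_, ?_⟩
  · obtain ⟨s₁, t₁, e, ht, hb⟩ := halts_startCmd h hs
    have ht' : (t₁ : ℝ) ≤ startTime A := by exact_mod_cast ht
    exact ⟨s₁, t₁, e, fun k => (hb.col k k.2).start, ht'.trans (h.start_bound h0 h1 h2),
      fun hmod => ht'.trans (h.start_bound_moderate h0 h1 h2 hmod)⟩
  · choose s₂ t e ht hout using h.halts_program h0 h1 h2 hs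
    exact ⟨t, fun ω => ⟨s₂ ω, e ω, hout ω⟩, h.expect_bound h0 h1 h2 ht,
      fun hmod => h.expect_bound_moderate h0 h1 h2 hmod ht⟩
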